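/- Setting. Let $d,N\ge 1$, $I=\{1,\dots,N\}$, and let $\Omega\subset\mathbb R^d$ be a nonempty bounded domain (open and connected) with Lipschitz boundary $\Gamma=\partial\Omega$, i.e. locally $\Omega$ is the region below the graph of a Lipschitz function and $\Gamma$ is the graph. Let $\delta\in\{0,1\}$, with $d\ge 2$ if $\delta=1$. Let $\lambda$ be Lebesgue measure on $\Omega$, $\sigma$ the surface measure on $\Gamma$ (the $(d-1)$-dimensional Hausdorff measure; counting measure if $d=1$), $n$ the outward unit normal (which exists $\sigma$-a.e.), and $P(x)z=z-(n(x),z)\,n(x)$. Put $\Lambda=\overline\Omega^N$ and write $x=(x^1,\dots,x^N)$ with $x^i\in\overline\Omega$; $\lambda_i,\sigma_i$ are copies of $\lambda,\sigma$ acting on $x^i$, $\nabla_i$ is the gradient with respect to $x^i$, and $\nabla_{\Gamma,i}f(x)=P(x^i)\nabla_i f(x)$. Let $C^1(\Lambda)$ be the space of restrictions to $\Lambda$ of $C^1$ functions on $\mathbb R^{Nd}$. Let $\varrho:\Lambda\to\mathbb R$ satisfy $\varrho\in L^1(\Lambda;\prod_{i=1}^N(\lambda_i+\sigma_i))$ and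 $\varrho>0$ $\prod_{i=1}^N(\lambda_i+\sigma_i)$-a.e., and put $\mu=\varrho\prod_{i=1}^N(\lambda_i+\sigma_i)$. For $B\subset I$ regard $\varrho$ as a function of $y=(x^i)_{i\in B}$ and $x=(x^i)_{i\in I\setminus B}$. Let $R^\Omega_\varrho(B,x)$ be the set of $y\in\Omega^{|B|}$ such that $\int_{\{z\in\Omega^{|B|}:|z-y|<\epsilon\}}\varrho(z,x)^{-1}\prod_{i\in B}d\lambda_i(z)<\infty$ for some $\epsilon>0$, and let $R^\Gamma_\varrho(B,y)$ be the set of $x\in\Gamma^{N-|B|}$ such that $\int_{\{z\in\Gamma^{N-|B|}:|z-x|<\epsilon\}}\varrho(y,z)^{-1}\prod_{i\in I\setminus B}d\sigma_i(z)<\infty$ for some $\epsilon>0$. Assume the generalized Hamza condition: (H1) for every $\emptyset\ne B\subset I$ and $\prod_{i\in I\setminus B}\sigma_i$-a.e. $x\in\Gamma^{N-|B|}$, $\varrho(\cdot,x)=0$ $\prod_{i\in B}\lambda_i$-a.e. on $\Omega^{|B|}\setminus R^\Omega_\varrho(B,x)$; (H2) if $\delta=1$: for every $B\subsetneq I$ and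 $\prod_{i\in B}\lambda_i$-a.e. $y\in\Omega^{|B|}$, $\varrho(y,\cdot)=0$ $\prod_{i\in I\setminus B}\sigma_i$-a.e. on $\Gamma^{N-|B|}\setminus R^\Gamma_\varrho(B,y)$. For $f,g\in\mathcal D:=C^1(\Lambda)$ let $$\mathcal E(f,g)=\frac12\int_\Lambda\sum_{i=1}^N\Big(\mathbf 1_{\{x^i\in\Omega\}}(\nabla_if,\nabla_ig)+\delta\,\mathbf 1_{\{x^i\in\Gamma\}}(\nabla_{\Gamma,i}f,\nabla_{\Gamma,i}g)\Big)\,d\mu .$$ Theorem. $(\mathcal E,\mathcal D)$ is a well-defined bilinear form on ($\mu$-classes of) functions in $L^2(\Lambda;\mu)$; it is symmetric, positive definite (that is, $\mathcal E(f,f)\ge 0$), densely defined and closable on $L^2(\Lambda;\mu)$. Its closure $(\mathcal E,D(\mathcal E))$ is a recurrent, strongly local, regular, symmetric Dirichlet form on $L^2(\Lambda;\mu)$. Here, with $\mathcal E_1(f,g)=\mathcal E(f,g)+(f,g)_{L^2(\Lambda;\mu)}$: - closable: if $(f_k)\subset\mathcal D$ is $\mathcal E$-Cauchy and $f_k\to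 0$ in $L^2(\Lambda;\mu)$, then $\mathcal E(f_k,f_k)\to 0$. The closure is the $\mathcal E_1$-complete extension of $(\mathcal E,\mathcal D)$ in whose domain $\mathcal D$ is $\mathcal E_1^{1/2}$-dense; - symmetric Dirichlet form: densely defined, symmetric, nonnegative, closed, and $f\in D(\mathcal E)$ implies $f^\#:=(0\vee f)\wedge 1\in D(\mathcal E)$ and $\mathcal E(f^\#,f^\#)\le\mathcal E(f,f)$; - regular: $\mu$ is finite on compact sets with full support $\Lambda$, and $D(\mathcal E)\cap C(\Lambda)$ is dense in $D(\mathcal E)$ for $\mathcal E_1^{1/2}$ and in $C(\Lambda)$ for the supremum norm; - strongly local: $\mathcal E(u,v)=0$ whenever $u,v\in D(\mathcal E)$ and $v$ is $\mu$-a.e. constant on an open set (relative to $\Lambda$) containing the support of the measure $|u|\mu$; - recurrent: with $G_\alpha$, $\alpha>0$, the resolvent of $(\mathcal E,D(\mathcal E))$ (given by $\mathcal E(G_\alpha f,v)+\alpha(G_\alpha f,v)_{L^2(\Lambda;\mu)}=(f,v)_{L^2(\Lambda;\mu)}$ for all $v\in D(\mathcal E)$), for every $f\in L^1(\Lambda;\mu)\cap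 L^2(\Lambda;\mu)$ with $f\ge 0$ the potential $Gf=\lim_{k\to\infty}G_{1/k}f$ takes $\mu$-a.e. only the values $0$ and $\infty$. -/

import Mathlib

open MeasureTheory Filter Topology Set
open scoped InnerProductSpace ENNReal

noncomputable section

/-! ## Bilinear forms on a Hilbert space: closedness, closability, closure -/

/-- A bilinear form `form` defined on a linear subspace `dom` of a real Hilbert space `H`. -/
structure DForm (H : Type*) [NormedAddCommGroup H] [InnerProductSpace ℝ H] where
  dom : Submodule ℝ H
  form : LinearMap.BilinForm ℝ dom

namespace DForm

section Hilbert

variable {H : Type*} [NormedAddCommGroup H] [InnerProductSpace ℝ H]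

/-- The quadratic form of the form norm, `E₁(f, f) = E(f, f) + (f, f)`. -/
def norm1Sq (E : DForm H) (f : E.dom) : ℝ := E.form f f + ⟪(f : H), (f : H)⟫_ℝ

def IsSymmetric (E : DForm H) : Prop := ∀ f g : E.dom, E.form f g = E.form g f

/-- Positive definiteness in the sense of Dirichlet form theory: `E(f, f) ≥ 0`. -/
def IsNonneg (E : DForm H) : Prop := ∀ f : E.dom, 0 ≤ E.form f f

def IsDenselyDefined (E : DForm H) : Prop := Dense (E.dom : Set H)

/-- `u` is Cauchy with respect to the seminorm `E(·, ·)^{1/2}`. -/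
def IsFormCauchy (E : DForm H) (u : ℕ → E.dom) : Prop :=
  ∀ ε : ℝ, 0 < ε → ∃ n₀ : ℕ, ∀ m ≥ n₀, ∀ n ≥ n₀, E.form (u m - u n) (u m - u n) < ε

/-- Closability: every `E`-Cauchy sequence of the domain that tends to `0` in `H` satisfies
`E(uₙ, uₙ) → 0`. -/
def IsClosable (E : DForm H) : Prop :=
  ∀ u : ℕ → E.dom, E.IsFormCauchy u → Tendsto (fun n => (u n : H)) atTop (𝓝 0) →
    Tendsto (fun n => E.form (u n) (u n)) atTop (𝓝 0)

/-- Closedness: the domain is complete with respect to the norm `E₁(·, ·)^{1/2}`. -/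
def IsClosedForm (E : DForm H) : Prop :=
  ∀ u : ℕ → E.dom,
    (∀ ε : ℝ, 0 < ε → ∃ n₀ : ℕ, ∀ m ≥ n₀, ∀ n ≥ n₀, E.norm1Sq (u m - u n) < ε) →
    ∃ f : E.dom, Tendsto (fun n => E.norm1Sq (u n - f)) atTop (𝓝 0)

/-- `E` is the closure of `A`: a closed form extending `A` whose domain contains the domain of `A`
densely with respect to `E₁(·, ·)^{1/2}`. -/
structure IsClosureOf (E A : DForm H) : Prop where
  dom_le : A.dom ≤ E.dom
  extends_form : ∀ f g : A.dom,
    E.form ⟨f, dom_le f.2⟩ ⟨g, dom_le g.2⟩ = A.form f g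
  closed : E.IsClosedForm
  dense : ∀ f : E.dom, ∀ ε : ℝ, 0 < ε →
    ∃ g : A.dom, E.norm1Sq (f - ⟨g, dom_le g.2⟩) < ε

end Hilbert

/-! ## Dirichlet forms on `L²(X; m)` -/

section L2

variable {X : Type*} [MeasurableSpace X] {m : Measure X}

/-- A symmetric Dirichlet form on `L²(X; m)`: a densely defined, symmetric, nonnegative, closed form
on which the unit contraction `f ↦ (0 ∨ f) ∧ 1` operates. -/
structure IsSymmDirichletForm (E : DForm (Lp ℝ 2 m)) : Prop where
  denselyDefined : E.IsDenselyDefined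
  symmetric : E.IsSymmetric
  nonneg : E.IsNonneg
  closed : E.IsClosedForm
  markov : ∀ f : E.dom, ∃ g : E.dom,
    ((g : Lp ℝ 2 m) : X → ℝ) =ᵐ[m] (fun x => min (max (((f : Lp ℝ 2 m) : X → ℝ) x) 0) 1) ∧
      E.form g g ≤ E.form f f

/-- Recurrence: for every nonnegative `f ∈ L¹(X; m) ∩ L²(X; m)` the potential
`G f = ∫₀^∞ T_t f dt = lim_{α ↓ 0} G_α f` takes almost everywhere only the values `0` and `∞`.
Here `u n = G_α f` with `α = 1 / (n + 1)` is the resolvent of the form, that is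
`E(G_α f, v) + α (G_α f, v) = (f, v)` for all `v` in the domain. -/
def IsRecurrent (E : DForm (Lp ℝ 2 m)) : Prop :=
  ∀ f : Lp ℝ 2 m, (∀ᵐ x ∂m, 0 ≤ (f : X → ℝ) x) → Integrable (f : X → ℝ) m →
    ∀ u : ℕ → E.dom,
      (∀ (n : ℕ) (v : E.dom),
        E.form (u n) v + (1 / ((n : ℝ) + 1)) * ⟪(u n : Lp ℝ 2 m), (v : Lp ℝ 2 m)⟫_ℝ
          = ⟪f, (v : Lp ℝ 2 m)⟫_ℝ) →
      ∀ᵐ x ∂m, Tendsto (fun n => ((u n : Lp ℝ 2 m) : X → ℝ) x) atTop (𝓝 0) ∨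
        Tendsto (fun n => ((u n : Lp ℝ 2 m) : X → ℝ) x) atTop atTop

variable [TopologicalSpace X]

/-- The support of the measure `|u| · m`: the complement of the largest open set on which `u`
vanishes almost everywhere. -/
def essSupport (m : Measure X) (u : X → ℝ) : Set X :=
  {x | ∀ V ∈ 𝓝 x, ¬ ∀ᵐ y ∂m, y ∈ V → u y = 0}

/-- Strong locality: `E(u, v) = 0` if `u, v` have compact support and `v` is constant on a
neighbourhood of the support of `u`. -/
def IsStronglyLocal (E : DForm (Lp ℝ 2 m)) : Prop :=
  ∀ u v : E.dom,
    IsCompact (essSupport m ((u : Lp ℝ 2 m) : X → ℝ)) →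
    IsCompact (essSupport m ((v : Lp ℝ 2 m) : X → ℝ)) →
    (∃ (U : Set X) (c : ℝ), IsOpen U ∧ essSupport m ((u : Lp ℝ 2 m) : X → ℝ) ⊆ U ∧
      ∀ᵐ x ∂m, x ∈ U → ((v : Lp ℝ 2 m) : X → ℝ) x = c) →
    E.form u v = 0

/-- Regularity (including the usual requirement that `m` is finite on compacts and has full
support): the compactly supported continuous functions in the domain are dense in the domain for
`E₁(·, ·)^{1/2}` and in the space of all compactly supported continuous functions for the uniform
norm. -/
structure IsRegular (E : DForm (Lp ℝ 2 m)) : Prop where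
  finite_on_compacts : IsFiniteMeasureOnCompacts m
  full_support : m.IsOpenPosMeasure
  dense_dom : ∀ f : E.dom, ∀ ε : ℝ, 0 < ε → ∃ (g : E.dom) (w : C(X, ℝ)),
    HasCompactSupport w ∧ ((g : Lp ℝ 2 m) : X → ℝ) =ᵐ[m] w ∧ E.norm1Sq (f - g) < ε
  dense_cont : ∀ v : C(X, ℝ), HasCompactSupport v → ∀ ε : ℝ, 0 < ε →
    ∃ (g : E.dom) (w : C(X, ℝ)),
      HasCompactSupport w ∧ ((g : Lp ℝ 2 m) : X → ℝ) =ᵐ[m] w ∧ ∀ x, |v x - w x| < ε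

end L2

end DForm

/-! ## Domains, their boundary, normal vectors and surface measure -/

/-- `Ω` has Lipschitz boundary: near every boundary point, with respect to some direction `e`, `Ω` is
the region below the graph of a Lipschitz function of the coordinates orthogonal to `e`, and the
boundary is the graph. -/
def HasLipschitzBoundary {d : ℕ} (Ω : Set (EuclideanSpace ℝ (Fin d))) : Prop :=
  ∀ x ∈ frontier Ω, ∃ (e : EuclideanSpace ℝ (Fin d)) (φ : (ℝ ∙ e)ᗮ → ℝ) (K : NNReal) (r : ℝ),
    ‖e‖ = 1 ∧ LipschitzWith K φ ∧ 0 < r ∧ ∀ y ∈ Metric.ball x r,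
      (y ∈ Ω ↔ ⟪e, y⟫_ℝ < φ ((ℝ ∙ e)ᗮ.orthogonalProjectionOnto y)) ∧
      (y ∈ frontier Ω ↔ ⟪e, y⟫_ℝ = φ ((ℝ ∙ e)ᗮ.orthogonalProjectionOnto y))

/-- `ν` is the outward unit normal of `Ω` at `x`: up to a cone around the hyperplane `ν^⊥` of
arbitrarily small opening, `Ω` agrees near `x` with the half space `{y | ⟪ν, y - x⟫ < 0}`. For a
domain below the graph of a Lipschitz function such a `ν` exists at the points where that function is
differentiable, and it is then the usual normal of the graph. -/
def IsOutwardNormal {d : ℕ} (Ω : Set (EuclideanSpace ℝ (Fin d)))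
    (x ν : EuclideanSpace ℝ (Fin d)) : Prop :=
  ‖ν‖ = 1 ∧ ∀ ε : ℝ, 0 < ε → ∃ r : ℝ, 0 < r ∧ ∀ y ∈ Metric.ball x r,
    (⟪ν, y - x⟫_ℝ < -(ε * ‖y - x‖) → y ∈ Ω) ∧ (ε * ‖y - x‖ < ⟪ν, y - x⟫_ℝ → y ∉ Ω)

open Classical in
/-- The outward unit normal `n(x)` (with the value `0` where no normal exists). -/
def outwardNormal {d : ℕ} (Ω : Set (EuclideanSpace ℝ (Fin d)))
    (x : EuclideanSpace ℝ (Fin d)) : EuclideanSpace ℝ (Fin d) :=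
  if h : ∃ ν, IsOutwardNormal Ω x ν then h.choose else 0

/-- The projection `P(x) z = z - (n(x), z) n(x)` on the tangent space of the boundary at `x`. -/
def tangentProj {d : ℕ} (Ω : Set (EuclideanSpace ℝ (Fin d)))
    (x z : EuclideanSpace ℝ (Fin d)) : EuclideanSpace ℝ (Fin d) :=
  z - ⟪outwardNormal Ω x, z⟫_ℝ • outwardNormal Ω x

/-- Lebesgue measure on `Ω`, as a measure on the closure of `Ω`. -/
def interiorMeasure {d : ℕ} (Ω : Set (EuclideanSpace ℝ (Fin d))) : Measure (closure Ω) :=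
  Measure.comap Subtype.val ((volume : Measure (EuclideanSpace ℝ (Fin d))).restrict Ω)

/-- Surface measure on the boundary of `Ω`, as a measure on the closure of `Ω`: the
`(d - 1)`-dimensional Hausdorff measure, normalized to agree with Lebesgue measure on
`(d - 1)`-dimensional Euclidean space (counting measure if `d = 1`). -/
def surfaceMeasure {d : ℕ} (Ω : Set (EuclideanSpace ℝ (Fin d))) : Measure (closure Ω) :=
  Measure.comap Subtype.val
    ((Measure.euclideanHausdorffMeasure (d - 1) :
      Measure (EuclideanSpace ℝ (Fin d))).restrict (frontier Ω))

/-! ## The configuration space and the gradient form -/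

/-- The configuration space `Λ`, the `N`-fold product of the closure of `Ω`. -/
abbrev Config {d : ℕ} (Ω : Set (EuclideanSpace ℝ (Fin d))) (N : ℕ) : Type := Fin N → closure Ω

/-- The inclusion of `Λ` in `(ℝ^d)^N`. -/
def Config.coe {d N : ℕ} {Ω : Set (EuclideanSpace ℝ (Fin d))} (x : Config Ω N) :
    Fin N → EuclideanSpace ℝ (Fin d) := fun i => (x i : EuclideanSpace ℝ (Fin d))

/-- The product measure `∏ᵢ (λᵢ + σᵢ)` on `Λ`. -/
def baseMeasure {d : ℕ} (Ω : Set (EuclideanSpace ℝ (Fin d))) (N : ℕ) : Measure (Config Ω N) :=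
  Measure.pi (fun _ => interiorMeasure Ω + surfaceMeasure Ω)

/-- The measure `μ = ϱ ∏ᵢ (λᵢ + σᵢ)` on `Λ`. -/
def weightedMeasure {d N : ℕ} (Ω : Set (EuclideanSpace ℝ (Fin d))) (ϱ : Config Ω N → ℝ) :
    Measure (Config Ω N) :=
  (baseMeasure Ω N).withDensity (fun x => ENNReal.ofReal (ϱ x))

/-- The gradient `∇ᵢ F(x)` with respect to the position of the `i`-th particle. -/
def partGrad {d N : ℕ} (F : (Fin N → EuclideanSpace ℝ (Fin d)) → ℝ)
    (i : Fin N) (x : Fin N → EuclideanSpace ℝ (Fin d)) : EuclideanSpace ℝ (Fin d) :=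
  gradient (fun y => F (Function.update x i y)) (x i)

/-- The gradient `∇_{Γ,i} F(x)` along the boundary with respect to the `i`-th particle. -/
def partSurfGrad {d N : ℕ} (Ω : Set (EuclideanSpace ℝ (Fin d)))
    (F : (Fin N → EuclideanSpace ℝ (Fin d)) → ℝ)
    (i : Fin N) (x : Fin N → EuclideanSpace ℝ (Fin d)) : EuclideanSpace ℝ (Fin d) :=
  tangentProj Ω (x i) (partGrad F i x)

open Classical in
/-- The square field `∑ᵢ (1_{xⁱ ∈ Ω} (∇ᵢ F, ∇ᵢ G) + δ 1_{xⁱ ∈ Γ} (∇_{Γ,i} F, ∇_{Γ,i} G))` at `x`. -/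
def squareField {d N : ℕ} (Ω : Set (EuclideanSpace ℝ (Fin d))) (δ : ℝ)
    (F G : (Fin N → EuclideanSpace ℝ (Fin d)) → ℝ) (x : Config Ω N) : ℝ :=
  ∑ i : Fin N,
    ((if (x i : EuclideanSpace ℝ (Fin d)) ∈ Ω then
        ⟪partGrad F i x.coe, partGrad G i x.coe⟫_ℝ else 0) +
      δ * (if (x i : EuclideanSpace ℝ (Fin d)) ∈ frontier Ω then
        ⟪partSurfGrad Ω F i x.coe, partSurfGrad Ω G i x.coe⟫_ℝ else 0))

/-- `½ ∫_Λ ∑ᵢ (1_{xⁱ ∈ Ω} (∇ᵢ F, ∇ᵢ G) + δ 1_{xⁱ ∈ Γ} (∇_{Γ,i} F, ∇_{Γ,i} G)) dμ`. -/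
def gradEnergy {d N : ℕ} (Ω : Set (EuclideanSpace ℝ (Fin d))) (δ : ℝ) (ϱ : Config Ω N → ℝ)
    (F G : (Fin N → EuclideanSpace ℝ (Fin d)) → ℝ) : ℝ :=
  (1 / 2) * ∫ x, squareField Ω δ F G x ∂(weightedMeasure Ω ϱ)

/-- `A` is the gradient form on `L²(Λ; μ)` with domain `C¹(Λ)`, the restrictions to `Λ` of the
continuously differentiable functions on `(ℝ^d)^N`. -/
structure IsGradientForm {d N : ℕ} (Ω : Set (EuclideanSpace ℝ (Fin d))) (δ : ℝ)
    (ϱ : Config Ω N → ℝ) (A : DForm (Lp ℝ 2 (weightedMeasure Ω ϱ))) : Prop where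
  mem_dom : ∀ f : Lp ℝ 2 (weightedMeasure Ω ϱ), f ∈ A.dom ↔
    ∃ F : (Fin N → EuclideanSpace ℝ (Fin d)) → ℝ, ContDiff ℝ 1 F ∧
      (f : Config Ω N → ℝ) =ᵐ[weightedMeasure Ω ϱ] (fun x => F x.coe)
  restrict_mem_dom : ∀ F : (Fin N → EuclideanSpace ℝ (Fin d)) → ℝ, ContDiff ℝ 1 F →
    ∃ f : A.dom, ((f : Lp ℝ 2 (weightedMeasure Ω ϱ)) : Config Ω N → ℝ)
      =ᵐ[weightedMeasure Ω ϱ] (fun x => F x.coe)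
  integrable : ∀ F G : (Fin N → EuclideanSpace ℝ (Fin d)) → ℝ, ContDiff ℝ 1 F → ContDiff ℝ 1 G →
    Integrable (squareField Ω δ F G) (weightedMeasure Ω ϱ)
  form_eq : ∀ (f g : A.dom) (F G : (Fin N → EuclideanSpace ℝ (Fin d)) → ℝ),
    ContDiff ℝ 1 F → ContDiff ℝ 1 G →
    ((f : Lp ℝ 2 (weightedMeasure Ω ϱ)) : Config Ω N → ℝ)
      =ᵐ[weightedMeasure Ω ϱ] (fun x => F x.coe) →
    ((g : Lp ℝ 2 (weightedMeasure Ω ϱ)) : Config Ω N → ℝ)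
      =ᵐ[weightedMeasure Ω ϱ] (fun x => G x.coe) →
    A.form f g = gradEnergy Ω δ ϱ F G

/-! ## The generalized Hamza condition -/

open Classical in
/-- The configuration with components `y i` for `i ∈ B` and `x i` for `i ∉ B`. -/
def glue {d N : ℕ} {Ω : Set (EuclideanSpace ℝ (Fin d))} (B : Finset (Fin N))
    (y : {i // i ∈ B} → closure Ω) (x : {i // i ∉ B} → closure Ω) : Config Ω N :=
  fun i => if h : i ∈ B then y ⟨i, h⟩ else x ⟨i, h⟩

/-- `R_ϱ^Ω(B, x)`: the points of `Ω^B` near which `ϱ⁻¹` is integrable, the components outside of `B`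
being fixed by `x`. (Here `1 / 0 = ∞`; maximum metric and Euclidean metric give the same set.) -/
def regInterior {d N : ℕ} (Ω : Set (EuclideanSpace ℝ (Fin d))) (ϱ : Config Ω N → ℝ)
    (B : Finset (Fin N)) (x : {i // i ∉ B} → closure Ω) : Set ({i // i ∈ B} → closure Ω) :=
  {y | (∀ i, (y i : EuclideanSpace ℝ (Fin d)) ∈ Ω) ∧ ∃ ε : ℝ, 0 < ε ∧
    ∫⁻ z in {z | (∀ i, (z i : EuclideanSpace ℝ (Fin d)) ∈ Ω) ∧ dist z y < ε},
      (ENNReal.ofReal (ϱ (glue B z x)))⁻¹ ∂(Measure.pi fun _ => interiorMeasure Ω) < ∞}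

/-- `R_ϱ^Γ(B, y)`: the points of `Γ^(I \ B)` near which `ϱ⁻¹` is integrable, the components in `B`
being fixed by `y`. -/
def regBoundary {d N : ℕ} (Ω : Set (EuclideanSpace ℝ (Fin d))) (ϱ : Config Ω N → ℝ)
    (B : Finset (Fin N)) (y : {i // i ∈ B} → closure Ω) : Set ({i // i ∉ B} → closure Ω) :=
  {x | (∀ i, (x i : EuclideanSpace ℝ (Fin d)) ∈ frontier Ω) ∧ ∃ ε : ℝ, 0 < ε ∧
    ∫⁻ z in {z | (∀ i, (z i : EuclideanSpace ℝ (Fin d)) ∈ frontier Ω) ∧ dist z x < ε},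
      (ENNReal.ofReal (ϱ (glue B y z)))⁻¹ ∂(Measure.pi fun _ => surfaceMeasure Ω) < ∞}

/-- Hamza condition (H1) for the components inside `Ω`. -/
def HamzaInterior {d N : ℕ} (Ω : Set (EuclideanSpace ℝ (Fin d))) (ϱ : Config Ω N → ℝ) : Prop :=
  ∀ B : Finset (Fin N), B.Nonempty →
    ∀ᵐ x ∂(Measure.pi fun _ : {i // i ∉ B} => surfaceMeasure Ω),
      ∀ᵐ y ∂(Measure.pi fun _ : {i // i ∈ B} => interiorMeasure Ω),
        (∀ i, (y i : EuclideanSpace ℝ (Fin d)) ∈ Ω) → y ∉ regInterior Ω ϱ B x → ϱ (glue B y x) = 0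

/-- Hamza condition (H2) for the components on the boundary. -/
def HamzaBoundary {d N : ℕ} (Ω : Set (EuclideanSpace ℝ (Fin d))) (ϱ : Config Ω N → ℝ) : Prop :=
  ∀ B : Finset (Fin N), B ≠ Finset.univ →
    ∀ᵐ y ∂(Measure.pi fun _ : {i // i ∈ B} => interiorMeasure Ω),
      ∀ᵐ x ∂(Measure.pi fun _ : {i // i ∉ B} => surfaceMeasure Ω),
        (∀ i, (x i : EuclideanSpace ℝ (Fin d)) ∈ frontier Ω) → x ∉ regBoundary Ω ϱ B y →
          ϱ (glue B y x) = 0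

end

/-!
The form is `½ ⟪T f, T g⟫` for the gradient operator `T` (`gradOperator`), which sends the class
of `F ∈ C¹(Λ)` to the field with components `∇ᵢ F` where `xⁱ ∈ Ω` and `δ P(xⁱ) ∇ᵢ F` where `xⁱ ∈
Γ`. The measure `μ` has full support and `Λ` is the closure of the open set `Ω^N`, so the class of
`F` determines the gradient on `Λ` (`gradField_congr`), and `T` is well defined. The form is
closable if and only if `T` is, and its closure is the form of the closure of `T`. Everything thus
reduces to the closability of `T` and to facts on operators between `L²` spaces.

Closability (`isClosable_gradOperator`). The Hamza conditions are stated for groups of particles,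
but by Tonelli's theorem they yield local integrability of `ϱ⁻¹` in the position of a single
particle, for almost all positions of the others (`HamzaInterior.ae_regular`,
`HamzaBoundary.ae_regular`); here one uses that `ϱ > 0` almost everywhere and that the balls of
the maximum metric are boxes. Convergence in `L²(Λ; μ)` passes, along a subsequence, to almost all
sections in one particle (`exists_subseq_tendsto_section`), so only one particle has to be
considered. Where `ϱ⁻¹` is integrable, convergence in `L²(ϱ)` implies convergence in `L¹`, and
integration by parts shows that directional derivatives of functions tending to `0` can only tend
to `0` (`ae_eq_zero_of_tendsto_lineDeriv`). On the boundary this is applied in the chart `t ↦ t +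
φ(t) e` of a Lipschitz graph. The chart maps Lebesgue measure to a measure that is dominated by
surface measure and has the same null sets, which is all that is needed of the area formula. By
Rademacher's theorem the graph has almost everywhere the normal `e - ∇φ` up to normalization, and
`P` is the projection on the range of the derivative of the chart
(`IsGraphNear.tangentProj_graphMap`).

Markov property. By the chain rule, `C¹` contractions of the real line operate on the domain of
`T`. Each contraction is a uniform limit of those, and `f ↦ ‖T f‖` is lower semicontinuous for a
closed operator, so that all contractions operate on the domain of the closure
(`DForm.operates_closure`).

Regularity and density follow from the Stone–Weierstrass theorem (`dense_contDiffRestrict`).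

Strong locality. An open set of `Λ` is the set where some smooth `χ ≥ 0` on `(ℝ^d)^N` does not
vanish. If `f` vanishes there and `uₙ → f` in the graph norm, then `χ uₙ → 0`, while `T (χ uₙ) → χ
T f` (`DForm.closure_apply_eq_zero_of_eq_zero`).

Recurrence (`DForm.isRecurrent_ofOperator`). `μ` is finite and `T 1 = 0`. For `β < α` the
resolvent equation gives `G_β f - G_α f = (α - β) G_β g` with `g = G_α f`. Testing the equation
for `w = G_β g` with `1 - (w ∧ c) / c` yields `∫ g (1 - (w ∧ c) / c) dμ ≤ β c μ(Λ) → 0` as `β →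
0`, so that `w`, and with it `G_β f`, tends to `∞` where `g > 0`.
-/

noncomputable section

/-! ### Forms given by operators -/

namespace DForm

section Operator

variable {H K : Type*} [NormedAddCommGroup H] [InnerProductSpace ℝ H]
  [NormedAddCommGroup K] [InnerProductSpace ℝ K]

/-- The form `½ ⟪T f, T g⟫` on the domain of a partially defined operator `T`. -/
abbrev ofOperator (T : H →ₗ.[ℝ] K) : DForm H where
  dom := T.domain
  form := (1 / 2 : ℝ) • (innerₗ K).compl₁₂ T.toFun T.toFun

variable (T : H →ₗ.[ℝ] K)

lemma ofOperator_form (f g : T.domain) :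
    (ofOperator T).form f g = (1 / 2) * ⟪T f, T g⟫_ℝ := by
  rfl

lemma ofOperator_form_self (f : T.domain) :
    (ofOperator T).form f f = (1 / 2) * ‖T f‖ ^ 2 := by
  rw [ofOperator_form, real_inner_self_eq_norm_sq]

lemma ofOperator_norm1Sq (f : T.domain) :
    (ofOperator T).norm1Sq f = (1 / 2) * ‖T f‖ ^ 2 + ‖(f : H)‖ ^ 2 := by
  rw [norm1Sq, ofOperator_form_self, real_inner_self_eq_norm_sq]

lemma ofOperator_isSymmetric : (ofOperator T).IsSymmetric := by
  intro f g
  rw [ofOperator_form, ofOperator_form, real_inner_comm]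

lemma ofOperator_isNonneg : (ofOperator T).IsNonneg := by
  intro f
  rw [ofOperator_form_self]
  positivity

variable {T}

lemma mem_domain_of_tendsto (hT : T.IsClosed) {u : ℕ → T.domain} {f : H} {v : K}
    (hu : Tendsto (fun n => (u n : H)) atTop (𝓝 f))
    (hv : Tendsto (fun n => T (u n)) atTop (𝓝 v)) :
    ∃ hf : f ∈ T.domain, T ⟨f, hf⟩ = v := by
  have hmem : (f, v) ∈ (T.graph : Set (H × K)) :=
    IsClosed.mem_of_tendsto hT (hu.prodMk_nhds hv)
      (Eventually.of_forall fun n => T.mem_graph (u n))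
  obtain ⟨y, h1, h2⟩ := T.mem_graph_iff.1 hmem
  simp only at h1 h2
  subst h1
  exact ⟨y.2, h2⟩

lemma exists_seq_of_mem_closure (hT : T.IsClosable) (f : T.closure.domain) :
    ∃ u : ℕ → T.domain, Tendsto (fun n => (u n : H)) atTop (𝓝 (f : H)) ∧
      Tendsto (fun n => T (u n)) atTop (𝓝 (T.closure f)) := by
  have hmem : ((f : H), T.closure f) ∈ _root_.closure (T.graph : Set (H × K)) := by
    have h := T.closure.mem_graph f
    rw [← hT.graph_closure_eq_closure_graph] at h
    exact h
  obtain ⟨p, hp, hlim⟩ := mem_closure_iff_seq_limit.1 hmem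
  choose y h1 h2 using fun n => T.mem_graph_iff.1 (hp n)
  refine ⟨y, ?_, ?_⟩
  · simpa only [h1, Function.comp_def] using (continuous_fst.tendsto _).comp hlim
  · simpa only [h2, Function.comp_def] using (continuous_snd.tendsto _).comp hlim

lemma isClosable_of_forall_seq
    (h : ∀ (u : ℕ → T.domain) (v : K), Tendsto (fun n => (u n : H)) atTop (𝓝 0) →
      Tendsto (fun n => T (u n)) atTop (𝓝 v) → v = 0) : T.IsClosable := by
  refine ⟨T.graph.topologicalClosure.toLinearPMap,
    (Submodule.toLinearPMap_graph_eq _ ?_).symm⟩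
  rintro ⟨x, v⟩ hx (rfl : x = 0)
  obtain ⟨p, hp, hlim⟩ := mem_closure_iff_seq_limit.1 hx
  choose y h1 h2 using fun n => T.mem_graph_iff.1 (hp n)
  refine h y v ?_ ?_
  · simpa only [h1, Function.comp_def] using (continuous_fst.tendsto _).comp hlim
  · simpa only [h2, Function.comp_def] using (continuous_snd.tendsto _).comp hlim

lemma cauchySeq_of_form [CompleteSpace K] {u : ℕ → T.domain}
    (h : ∀ ε : ℝ, 0 < ε → ∃ n₀ : ℕ, ∀ m ≥ n₀, ∀ n ≥ n₀, ‖T (u m) - T (u n)‖ ^ 2 < ε) :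
    CauchySeq fun n => T (u n) := by
  rw [Metric.cauchySeq_iff]
  intro ε hε
  obtain ⟨n₀, hn⟩ := h (ε ^ 2) (by positivity)
  refine ⟨n₀, fun m hm n hn' => ?_⟩
  rw [dist_eq_norm]
  exact lt_of_pow_lt_pow_left₀ 2 hε.le (hn m hm n hn')

lemma ofOperator_isClosable [CompleteSpace K] (hT : T.IsClosable) :
    (ofOperator T).IsClosable := by
  intro u hu hu0
  change ℕ → T.domain at u
  have hc : CauchySeq fun n => T (u n) := by
    refine cauchySeq_of_form fun ε hε => ?_
    obtain ⟨n₀, hn⟩ := hu (ε / 2) (by positivity)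
    refine ⟨n₀, fun m hm n hn' => ?_⟩
    have := hn m hm n hn'
    rw [ofOperator_form_self] at this
    rw [T.map_sub] at this
    linarith
  obtain ⟨v, hv⟩ := cauchySeq_tendsto_of_complete hc
  obtain ⟨h0, hv0⟩ := mem_domain_of_tendsto (T := T.closure) hT.closure_isClosed
    (u := fun n => ⟨u n, T.le_closure.1 (u n).2⟩) hu0
    (hv.congr fun n => T.le_closure.2 (x := u n) (y := ⟨u n, T.le_closure.1 (u n).2⟩) rfl)
  have hv0' : v = 0 := by
    rw [← hv0]
    exact T.closure.map_zero
  have : Tendsto (fun n => (1 / 2) * ‖T (u n)‖ ^ 2) atTop (𝓝 ((1 / 2) * ‖(0 : K)‖ ^ 2)) :=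
    ((hv0' ▸ hv).norm.pow 2).const_mul _
  simpa [ofOperator_form_self] using! this

lemma ofOperator_isClosedForm [CompleteSpace H] [CompleteSpace K] (hT : T.IsClosed) :
    (ofOperator T).IsClosedForm := by
  intro u hu
  change ℕ → T.domain at u
  have key : ∀ ε : ℝ, 0 < ε → ∃ n₀ : ℕ, ∀ m ≥ n₀, ∀ n ≥ n₀,
      (1 / 2) * ‖T (u m) - T (u n)‖ ^ 2 + ‖(u m : H) - u n‖ ^ 2 < ε := by
    intro ε hε
    obtain ⟨n₀, hn⟩ := hu ε hε
    refine ⟨n₀, fun m hm n hn' => ?_⟩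
    have := hn m hm n hn'
    rw [ofOperator_norm1Sq] at this
    rwa [T.map_sub] at this
  have hc : CauchySeq fun n => T (u n) := by
    refine cauchySeq_of_form fun ε hε => ?_
    obtain ⟨n₀, hn⟩ := key (ε / 2) (by positivity)
    refine ⟨n₀, fun m hm n hn' => ?_⟩
    nlinarith [hn m hm n hn', sq_nonneg ‖(u m : H) - u n‖]
  have hc' : CauchySeq fun n => (u n : H) := by
    rw [Metric.cauchySeq_iff]
    intro ε hε
    obtain ⟨n₀, hn⟩ := key (ε ^ 2) (by positivity)
    refine ⟨n₀, fun m hm n hn' => ?_⟩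
    rw [dist_eq_norm]
    refine lt_of_pow_lt_pow_left₀ 2 hε.le ?_
    nlinarith [hn m hm n hn', sq_nonneg ‖T (u m) - T (u n)‖]
  obtain ⟨v, hv⟩ := cauchySeq_tendsto_of_complete hc
  obtain ⟨f, hf⟩ := cauchySeq_tendsto_of_complete hc'
  obtain ⟨hmem, hTf⟩ := mem_domain_of_tendsto hT hf hv
  refine ⟨⟨f, hmem⟩, ?_⟩
  have h1 : Tendsto (fun n => (1 / 2) * ‖T (u n) - v‖ ^ 2 + ‖(u n : H) - f‖ ^ 2) atTop
      (𝓝 ((1 / 2) * ‖v - v‖ ^ 2 + ‖f - f‖ ^ 2)) :=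
    (((hv.sub_const v).norm.pow 2).const_mul _).add ((hf.sub_const f).norm.pow 2)
  rw [sub_self, sub_self, norm_zero, norm_zero] at h1
  simp only [ne_eq, OfNat.ofNat_ne_zero, not_false_eq_true, zero_pow, mul_zero, add_zero] at h1
  refine h1.congr fun n => ?_
  rw [ofOperator_norm1Sq]
  rw [T.map_sub, hTf]
  rfl

lemma ofOperator_closure_isClosureOf [CompleteSpace H] [CompleteSpace K] (hT : T.IsClosable) :
    (ofOperator T.closure).IsClosureOf (ofOperator T) where
  dom_le := T.le_closure.1
  extends_form f g := by
    change T.domain at f g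
    rw [ofOperator_form, ofOperator_form,
      ← T.le_closure.2 (x := f) (y := ⟨f, T.le_closure.1 f.2⟩) rfl,
      ← T.le_closure.2 (x := g) (y := ⟨g, T.le_closure.1 g.2⟩) rfl]
  closed := ofOperator_isClosedForm hT.closure_isClosed
  dense f ε hε := by
    change T.closure.domain at f
    obtain ⟨u, hu, hTu⟩ := exists_seq_of_mem_closure hT f
    have h1 : Tendsto (fun n => (1 / 2) * ‖T.closure f - T (u n)‖ ^ 2 + ‖(f : H) - u n‖ ^ 2) atTop
        (𝓝 ((1 / 2) * ‖T.closure f - T.closure f‖ ^ 2 + ‖(f : H) - f‖ ^ 2)) :=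
      (((hTu.const_sub _).norm.pow 2).const_mul _).add ((hu.const_sub _).norm.pow 2)
    rw [sub_self, sub_self, norm_zero, norm_zero] at h1
    simp only [ne_eq, OfNat.ofNat_ne_zero, not_false_eq_true, zero_pow, mul_zero, add_zero] at h1
    obtain ⟨n, hn⟩ := (h1.eventually (gt_mem_nhds hε)).exists
    refine ⟨u n, ?_⟩
    rw [ofOperator_norm1Sq]
    rw [T.closure.map_sub, ← T.le_closure.2 (x := u n) (y := ⟨u n, T.le_closure.1 (u n).2⟩) rfl]
    exact hn

/-- Lower semicontinuity of `f ↦ ‖T f‖` for a closed operator `T`. Convex combinations `w n` of the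
tails of the sequence whose images almost minimize the norm form a Cauchy sequence in the graph, by
the parallelogram law. -/
lemma norm_le_of_tendsto_of_norm_le [CompleteSpace K] (hT : T.IsClosed) {u : ℕ → T.domain} {f : H}
    {c : ℕ → ℝ} {C : ℝ} (hu : Tendsto (fun n => (u n : H)) atTop (𝓝 f))
    (hle : ∀ n, ‖T (u n)‖ ≤ c n) (hc : Tendsto c atTop (𝓝 C)) :
    ∃ hf : f ∈ T.domain, ‖T ⟨f, hf⟩‖ ≤ C := by
  set S : ℕ → Set T.domain := fun n => convexHull ℝ (u '' Ici n) with hS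
  have hS_anti : ∀ {m n}, m ≤ n → S n ⊆ S m := fun h =>
    convexHull_mono (image_mono (Ici_subset_Ici.2 h))
  have hmemS : ∀ {n k}, n ≤ k → u k ∈ S n := fun h =>
    subset_convexHull ℝ _ ⟨_, h, rfl⟩
  set d : ℕ → ℝ := fun n => sInf ((fun w => ‖T w‖) '' S n) with hd
  have hbdd : ∀ n, BddBelow ((fun w => ‖T w‖) '' S n) := fun n =>
    ⟨0, by rintro _ ⟨w, -, rfl⟩; exact norm_nonneg _⟩
  have hne : ∀ n, ((fun w => ‖T w‖) '' S n).Nonempty := fun n => ⟨_, u n, hmemS le_rfl, rfl⟩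
  have hd_le : ∀ {n} {w : T.domain}, w ∈ S n → d n ≤ ‖T w‖ := fun {n w} hw =>
    csInf_le (hbdd n) ⟨w, hw, rfl⟩
  have hd0 : ∀ n, 0 ≤ d n := fun n =>
    le_csInf (hne n) (by rintro _ ⟨w, -, rfl⟩; exact norm_nonneg _)
  have hd_mono : Monotone d := fun m n h =>
    le_csInf (hne n) (by rintro _ ⟨w, hw, rfl⟩; exact hd_le (hS_anti h hw))
  have hdC : ∀ n, d n ≤ C := fun n => ge_of_tendsto hc
    ((eventually_ge_atTop n).mono fun k hk => (hd_le (hmemS hk)).trans (hle k))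
  have hdlim := tendsto_atTop_ciSup hd_mono ⟨C, by rintro _ ⟨n, rfl⟩; exact hdC n⟩
  set L := ⨆ n, d n
  have hdL : ∀ n, d n ≤ L := fun n => hd_mono.ge_of_tendsto hdlim n
  have hLC : L ≤ C := le_of_tendsto' hdlim hdC
  set e : ℕ → ℝ := fun n => 1 / ((n : ℝ) + 1)
  have he0 : ∀ n, 0 < e n := fun n => Nat.one_div_pos_of_nat
  have he_lim : Tendsto e atTop (𝓝 0) := tendsto_one_div_add_atTop_nhds_zero_nat
  have hex : ∀ n, ∃ w ∈ S n, ‖T w‖ < d n + e n := fun n => by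
    obtain ⟨_, ⟨w, hw, rfl⟩, h⟩ :=
      exists_lt_of_csInf_lt (hne n) (lt_add_of_pos_right (d n) (he0 n))
    exact ⟨w, hw, h⟩
  choose w hwS hw using hex
  have hcauchy : CauchySeq fun n => T (w n) := by
    refine cauchySeq_of_le_tendsto_0 (fun n => √(4 * (L + e n) ^ 2 - 4 * d n ^ 2)) ?_ ?_
    · intro n m k hn hm
      have hmid : d k ≤ ‖T ((1 / 2 : ℝ) • w n + (1 / 2 : ℝ) • w m)‖ :=
        hd_le (convex_convexHull ℝ _ (hS_anti hn (hwS n)) (hS_anti hm (hwS m))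
          (by norm_num) (by norm_num) (by norm_num))
      rw [T.map_add, T.map_smul, T.map_smul, ← smul_add, norm_smul] at hmid
      norm_num at hmid
      have hpar := parallelogram_law_with_norm ℝ (T (w n)) (T (w m))
      have hbd : ∀ {j}, k ≤ j → ‖T (w j)‖ ≤ L + e k := fun {j} hj =>
        (hw j).le.trans (add_le_add (hdL j) (Nat.one_div_le_one_div hj))
      rw [dist_eq_norm]
      refine Real.le_sqrt_of_sq_le ?_
      nlinarith [hbd hn, hbd hm, hd0 k, norm_nonneg (T (w n)), norm_nonneg (T (w m)),
        pow_le_pow_left₀ (norm_nonneg _) (hbd hn) 2, pow_le_pow_left₀ (norm_nonneg _) (hbd hm) 2,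
        pow_le_pow_left₀ (hd0 k) hmid 2]
    · have : Tendsto (fun n => √(4 * (L + e n) ^ 2 - 4 * d n ^ 2)) atTop
          (𝓝 √(4 * (L + 0) ^ 2 - 4 * L ^ 2)) :=
        ((((he_lim.const_add L).pow 2).const_mul 4).sub ((hdlim.pow 2).const_mul 4)).sqrt
      simpa using this
  obtain ⟨v, hv⟩ := cauchySeq_tendsto_of_complete hcauchy
  have hwf : Tendsto (fun n => (w n : H)) atTop (𝓝 f) := by
    rw [Metric.tendsto_atTop]
    intro ε hε
    obtain ⟨n₀, hn₀⟩ := Metric.tendsto_atTop.1 hu ε hε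
    refine ⟨n₀, fun n hn => ?_⟩
    have hsub : S n ⊆ T.domain.subtype ⁻¹' Metric.ball f ε := by
      refine convexHull_min ?_ ((convex_ball f ε).linear_preimage _)
      rintro _ ⟨k, hk, rfl⟩
      exact hn₀ k (hn.trans hk)
    exact hsub (hwS n)
  obtain ⟨hf, hTf⟩ := mem_domain_of_tendsto hT hwf hv
  refine ⟨hf, ?_⟩
  rw [hTf]
  have hlim : Tendsto (fun n => L + e n) atTop (𝓝 (L + 0)) := he_lim.const_add L
  rw [add_zero] at hlim
  exact (le_of_tendsto_of_tendsto' hv.norm hlim fun n =>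
    (hw n).le.trans (add_le_add_left (hdL n) _)).trans hLC

end Operator

end DForm

/-! ### Contractions operating on the domain -/

/-- A Lipschitz function is uniformly approximated by its averages over short intervals, which are
continuously differentiable with the same Lipschitz constant. -/
lemma LipschitzWith.exists_contDiff_approx {φ : ℝ → ℝ} (hφ : LipschitzWith 1 φ) {ε : ℝ}
    (hε : 0 < ε) :
    ∃ ψ : ℝ → ℝ, ContDiff ℝ 1 ψ ∧ (∀ t, |deriv ψ t| ≤ 1) ∧ ∀ t, |ψ t - φ t| ≤ ε := by
  have hcont := hφ.continuous
  have hint : ∀ a b, IntervalIntegrable φ volume a b := fun a b => hcont.intervalIntegrable a b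
  have hdist : ∀ s t, |φ s - φ t| ≤ |s - t| := fun s t => by
    simpa [Real.dist_eq] using hφ.dist_le_mul s t
  set P : ℝ → ℝ := fun t => ∫ s in (0 : ℝ)..t, φ s
  have hP : ∀ t, HasDerivAt P (φ t) t := fun t =>
    intervalIntegral.integral_hasDerivAt_right (hint _ _)
      (hcont.stronglyMeasurableAtFilter _ _) hcont.continuousAt
  set ψ : ℝ → ℝ := fun t => ε⁻¹ * (P (t + ε) - P t)
  have hψ : ∀ t, HasDerivAt ψ (ε⁻¹ * (φ (t + ε) - φ t)) t := fun t =>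
    (((hP (t + ε)).comp_add_const t ε).sub (hP t)).const_mul _
  have hderiv : deriv ψ = fun t => ε⁻¹ * (φ (t + ε) - φ t) := funext fun t => (hψ t).deriv
  refine ⟨ψ, ?_, ?_, ?_⟩
  · rw [contDiff_one_iff_deriv]
    refine ⟨fun t => (hψ t).differentiableAt, ?_⟩
    rw [hderiv]
    fun_prop
  · intro t
    rw [hderiv, abs_mul, abs_inv, abs_of_pos hε, inv_mul_le_iff₀ hε]
    simpa [abs_of_pos hε] using hdist (t + ε) t
  · intro t
    have h1 : P (t + ε) - P t = ∫ s in t..t + ε, φ s :=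
      intervalIntegral.integral_interval_sub_left (hint _ _) (hint _ _)
    have h2 : ψ t - φ t = ε⁻¹ * ∫ s in t..t + ε, (φ s - φ t) := by
      rw [intervalIntegral.integral_sub (hint _ _) (by simp), intervalIntegral.integral_const, ← h1]
      simp only [ψ, smul_eq_mul]
      field_simp
      ring
    have h3 : ‖∫ s in t..t + ε, (φ s - φ t)‖ ≤ ε * |t + ε - t| := by
      refine intervalIntegral.norm_integral_le_of_norm_le_const fun s hs => ?_
      rw [uIoc_of_le (by linarith)] at hs
      refine (hdist s t).trans ?_
      rw [abs_of_pos (by linarith [hs.1])]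
      linarith [hs.2]
    rw [h2, abs_mul, abs_inv, abs_of_pos hε, inv_mul_le_iff₀ hε]
    simpa [abs_of_pos hε] using h3

namespace DForm

variable {X : Type*} [MeasurableSpace X] {m : Measure X}
  {K : Type*} [NormedAddCommGroup K] [InnerProductSpace ℝ K]

lemma inner_lp_eq (f g : Lp ℝ 2 m) : ⟪f, g⟫_ℝ = ∫ x, f x * g x ∂m := by
  rw [L2.inner_def]
  refine integral_congr_ae (Eventually.of_forall fun x => ?_)
  simp [mul_comm]

/-- `φ` operates on the domain of `T` and contracts `‖T f‖`. -/
def Operates (T : Lp ℝ 2 m →ₗ.[ℝ] K) (φ : ℝ → ℝ) : Prop :=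
  ∀ f : T.domain, ∃ g : T.domain,
    ((g : Lp ℝ 2 m) : X → ℝ) =ᵐ[m] (fun x => φ ((f : Lp ℝ 2 m) x)) ∧ ‖T g‖ ≤ ‖T f‖

/-- If the smooth contractions of the real line operate on the domain of `T`, then all contractions
operate on the domain of the closure of `T`. -/
lemma operates_closure [IsFiniteMeasure m] [CompleteSpace K] {T : Lp ℝ 2 m →ₗ.[ℝ] K}
    (hT : T.IsClosable)
    (hsmooth : ∀ φ : ℝ → ℝ, ContDiff ℝ 1 φ → (∀ t, |deriv φ t| ≤ 1) → Operates T φ)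
    {φ : ℝ → ℝ} (hφ : LipschitzWith 1 φ) : Operates T.closure φ := by
  intro f
  have hdist : ∀ s t, |φ s - φ t| ≤ |s - t| := fun s t => by
    simpa [Real.dist_eq] using hφ.dist_le_mul s t
  obtain ⟨u, hu, hTu⟩ := exists_seq_of_mem_closure hT f
  have hε : ∀ n : ℕ, (0 : ℝ) < 1 / ((n : ℝ) + 1) := fun n => Nat.one_div_pos_of_nat
  choose ψ hψ1 hψ2 hψ3 using fun n => hφ.exists_contDiff_approx (hε n)
  choose g hg1 hg2 using fun n => hsmooth (ψ n) (hψ1 n) (hψ2 n) (u n)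
  have hmem : MemLp (fun x => φ ((f : Lp ℝ 2 m) x)) 2 m := by
    have h1 : MemLp (fun x => φ ((f : Lp ℝ 2 m) x) - φ 0) 2 m :=
      (hφ.sub (LipschitzWith.const (φ 0))).comp_memLp (by simp) (Lp.memLp _)
    exact (h1.add (memLp_const (φ 0))).ae_eq (Eventually.of_forall fun x => sub_add_cancel _ _)
  have hlim : Tendsto (fun n => (g n : Lp ℝ 2 m)) atTop (𝓝 (hmem.toLp _)) := by
    rw [tendsto_iff_norm_sub_tendsto_zero]
    have h0 : Tendsto (fun n => ‖(u n : Lp ℝ 2 m) - f‖ +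
        ‖Lp.constL 2 m ℝ (1 / ((n : ℝ) + 1))‖) atTop (𝓝 0) := by
      have := ((tendsto_iff_norm_sub_tendsto_zero.1 hu)).add
        (((Lp.constL 2 m ℝ : ℝ →L[ℝ] Lp ℝ 2 m).continuous.tendsto 0).comp
          (tendsto_one_div_add_atTop_nhds_zero_nat (𝕜 := ℝ))).norm
      simpa using this
    refine squeeze_zero (fun _ => norm_nonneg _) (fun n => ?_) h0
    rw [← norm_abs_eq_norm ((u n : Lp ℝ 2 m) - (f : Lp ℝ 2 m))]
    refine le_trans ?_ (norm_add_le _ _)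
    refine Lp.norm_le_norm_of_ae_le ?_
    filter_upwards [Lp.coeFn_sub (g n : Lp ℝ 2 m) (hmem.toLp _), hmem.coeFn_toLp, hg1 n,
      Lp.coeFn_add |(u n : Lp ℝ 2 m) - (f : Lp ℝ 2 m)| (Lp.constL 2 m ℝ (1 / ((n : ℝ) + 1))),
      Lp.coeFn_abs ((u n : Lp ℝ 2 m) - (f : Lp ℝ 2 m)),
      Lp.coeFn_sub (u n : Lp ℝ 2 m) (f : Lp ℝ 2 m),
      Lp.coeFn_const (p := 2) (μ := m) (1 / ((n : ℝ) + 1))] with x h1 h2 h3 h4 h5 h6 h7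
    rw [h1, h4, Pi.sub_apply, Pi.add_apply, h2, h3, h5, h6, Pi.sub_apply]
    erw [h7]
    simp only [Function.const_apply, Real.norm_eq_abs]
    rw [abs_of_nonneg (add_nonneg (abs_nonneg _) (hε n).le)]
    have h8 := abs_sub_le (ψ n ((u n : Lp ℝ 2 m) x)) (φ ((u n : Lp ℝ 2 m) x))
      (φ ((f : Lp ℝ 2 m) x))
    have h9 := hψ3 n ((u n : Lp ℝ 2 m) x)
    have h10 := hdist ((u n : Lp ℝ 2 m) x) ((f : Lp ℝ 2 m) x)
    linarith
  obtain ⟨hf, hle⟩ := norm_le_of_tendsto_of_norm_le (T := T.closure) hT.closure_isClosed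
    (u := fun n => ⟨g n, T.le_closure.1 (g n).2⟩) (c := fun n => ‖T (u n)‖)
    (C := ‖T.closure f‖) hlim
    (fun n => by
      rw [← T.le_closure.2 (x := g n) (y := ⟨g n, T.le_closure.1 (g n).2⟩) rfl]
      exact hg2 n)
    hTu.norm
  exact ⟨⟨_, hf⟩, hmem.coeFn_toLp, hle⟩

lemma lipschitzWith_clamp (c : ℝ) : LipschitzWith 1 (fun t : ℝ => min (max t 0) c) :=
  (LipschitzWith.id.max_const 0).min_const c

/-- The function `t ↦ t - 2 ((0 ∨ t) ∧ c)` is a contraction: it reflects the interval `[0, c]`. -/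
lemma lipschitzWith_sub_two_mul_clamp {c : ℝ} (hc : 0 ≤ c) :
    LipschitzWith 1 (fun t : ℝ => t - 2 * min (max t 0) c) := by
  refine LipschitzWith.of_dist_le_mul fun s t => ?_
  simp only [Real.dist_eq, NNReal.coe_one, one_mul]
  rcases le_total s 0 with h1 | h1 <;> rcases le_total t 0 with h2 | h2 <;>
  rcases le_total s c with h3 | h3 <;> rcases le_total t c with h4 | h4 <;>
  simp only [max_eq_left, max_eq_right, min_eq_left, min_eq_right, h1, h2, h3, h4, hc] <;>
  rw [abs_le] <;> rcases abs_cases (s - t) with h | h <;> constructor <;> linarith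

/-! ### Recurrence -/

section Recurrence

variable {T : Lp ℝ 2 m →ₗ.[ℝ] K}

/-- `u = G_α f` for the resolvent of the form `½ ⟪T ·, T ·⟫`. -/
def IsResolvent (T : Lp ℝ 2 m →ₗ.[ℝ] K) (α : ℝ) (f : Lp ℝ 2 m) (u : T.domain) : Prop :=
  ∀ v : T.domain, (1 / 2) * ⟪T u, T v⟫_ℝ + α * ⟪(u : Lp ℝ 2 m), (v : Lp ℝ 2 m)⟫_ℝ
    = ⟪f, (v : Lp ℝ 2 m)⟫_ℝ

lemma integrable_mul_lp (f g : Lp ℝ 2 m) : Integrable (fun x => f x * g x) m :=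
  (Lp.memLp f).integrable_mul (Lp.memLp g)

/-- The resolvent preserves positivity: test the resolvent equation with the negative part `u - u⁺`
of `u`. -/
lemma IsResolvent.nonneg (hop : ∀ φ : ℝ → ℝ, LipschitzWith 1 φ → Operates T φ) {α : ℝ}
    (hα : 0 < α) {f : Lp ℝ 2 m} (hf : ∀ᵐ x ∂m, 0 ≤ f x) {u : T.domain} (hu : IsResolvent T α f u) :
    ∀ᵐ x ∂m, 0 ≤ (u : Lp ℝ 2 m) x := by
  obtain ⟨g, hg, hTg⟩ := hop (fun t => max t 0) (LipschitzWith.id.max_const 0) u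
  have hT : 0 ≤ ⟪T u, T (u - g)⟫_ℝ := by
    rw [T.map_sub, inner_sub_right, real_inner_self_eq_norm_sq]
    nlinarith [real_inner_le_norm (T u) (T g), norm_nonneg (T u)]
  have hsub := Lp.coeFn_sub (u : Lp ℝ 2 m) (g : Lp ℝ 2 m)
  have hle : ⟪f, ((u - g : T.domain) : Lp ℝ 2 m)⟫_ℝ ≤ 0 := by
    rw [inner_lp_eq]
    refine integral_nonpos_of_ae ?_
    filter_upwards [hf, hg, hsub] with x h1 h2 h3
    rw [Submodule.coe_sub, h3, Pi.sub_apply, h2]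
    exact mul_nonpos_of_nonneg_of_nonpos h1 (sub_nonpos.2 (le_max_left _ _))
  have heq : ⟪(u : Lp ℝ 2 m), ((u - g : T.domain) : Lp ℝ 2 m)⟫_ℝ
      = ‖(u : Lp ℝ 2 m) - g‖ ^ 2 := by
    rw [← real_inner_self_eq_norm_sq, inner_lp_eq, inner_lp_eq]
    refine integral_congr_ae ?_
    filter_upwards [hg, hsub] with x h2 h3
    rw [Submodule.coe_sub, h3, Pi.sub_apply, h2]
    rcases le_total ((u : Lp ℝ 2 m) x) 0 with h | h
    · simp [h]
    · simp [h]
  have h0 : ‖(u : Lp ℝ 2 m) - g‖ ^ 2 ≤ 0 := by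
    have := hu (u - g)
    rw [heq] at this
    have h' : α * ‖(u : Lp ℝ 2 m) - g‖ ^ 2 ≤ 0 := by linarith
    exact nonpos_of_mul_nonpos_right h' hα
  have hzero : (u : Lp ℝ 2 m) = g := by
    rw [← sub_eq_zero, ← norm_eq_zero]
    exact pow_eq_zero_iff (two_ne_zero) |>.1 (le_antisymm h0 (sq_nonneg _))
  filter_upwards [hg] with x hx
  rw [hzero, hx]
  exact le_max_right _ _

/-- Testing the resolvent equation of `w = G_α g` with the decreasing function
`1 - (w ∧ c) / c` of `w`. -/
lemma IsResolvent.integral_le [IsFiniteMeasure m]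
    (hop : ∀ φ : ℝ → ℝ, LipschitzWith 1 φ → Operates T φ)
    {one : T.domain} (hone : ((one : Lp ℝ 2 m) : X → ℝ) =ᵐ[m] fun _ => 1) (hTone : T one = 0)
    {α c : ℝ} (hα : 0 < α) (hc : 0 < c) {g : Lp ℝ 2 m} {w : T.domain}
    (hw0 : ∀ᵐ x ∂m, 0 ≤ (w : Lp ℝ 2 m) x) (hw : IsResolvent T α g w) :
    Integrable (fun x => g x * (1 - min ((w : Lp ℝ 2 m) x) c / c)) m ∧
      ∫ x, g x * (1 - min ((w : Lp ℝ 2 m) x) c / c) ∂m ≤ α * (c * m.real univ) := by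
  obtain ⟨r, hr, hTr⟩ := hop _ (lipschitzWith_sub_two_mul_clamp hc.le) w
  -- `2⁻¹ • (w - r)` is the truncation `w ∧ c`
  set v : T.domain := one - (1 / (2 * c)) • (w - r) with hv
  have hvx : ((v : Lp ℝ 2 m) : X → ℝ) =ᵐ[m] fun x => 1 - min ((w : Lp ℝ 2 m) x) c / c := by
    have h1 := Lp.coeFn_sub (one : Lp ℝ 2 m) ((1 / (2 * c)) • ((w : Lp ℝ 2 m) - (r : Lp ℝ 2 m)))
    have h2 := Lp.coeFn_smul (1 / (2 * c)) ((w : Lp ℝ 2 m) - (r : Lp ℝ 2 m))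
    have h3 := Lp.coeFn_sub (w : Lp ℝ 2 m) (r : Lp ℝ 2 m)
    filter_upwards [h1, h2, h3, hone, hr, hw0] with x h1 h2 h3 h4 h5 h6
    have : (v : Lp ℝ 2 m) =
        (one : Lp ℝ 2 m) - (1 / (2 * c)) • ((w : Lp ℝ 2 m) - (r : Lp ℝ 2 m)) := rfl
    rw [this, h1, Pi.sub_apply, h2, Pi.smul_apply, h3, Pi.sub_apply, h4, h5, max_eq_left h6,
      smul_eq_mul]
    field_simp
    ring
  have hTv : ⟪T w, T v⟫_ℝ ≤ 0 := by
    have h1 : T v = -((1 / (2 * c)) • (T w - T r)) := by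
      rw [hv, T.map_sub, T.map_smul, T.map_sub, hTone, zero_sub]
    rw [h1, inner_neg_right, inner_smul_right, inner_sub_right, real_inner_self_eq_norm_sq]
    have h2 : 0 ≤ ‖T w‖ ^ 2 - ⟪T w, T r⟫_ℝ := by
      nlinarith [real_inner_le_norm (T w) (T r), norm_nonneg (T w)]
    have : 0 ≤ 1 / (2 * c) * (‖T w‖ ^ 2 - ⟪T w, T r⟫_ℝ) := by positivity
    linarith
  have hgv : (fun x => g x * (v : Lp ℝ 2 m) x)
      =ᵐ[m] fun x => g x * (1 - min ((w : Lp ℝ 2 m) x) c / c) := by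
    filter_upwards [hvx] with x hx
    rw [hx]
  refine ⟨(integrable_mul_lp g v).congr hgv, ?_⟩
  rw [← integral_congr_ae hgv, ← inner_lp_eq]
  have hle : ⟪(w : Lp ℝ 2 m), (v : Lp ℝ 2 m)⟫_ℝ ≤ c * m.real univ := by
    rw [inner_lp_eq]
    have : ∫ _, c ∂m = c * m.real univ := by simp [mul_comm]
    rw [← this]
    refine integral_mono_ae (integrable_mul_lp _ _) (integrable_const _) ?_
    filter_upwards [hvx, hw0] with x hx h0
    rw [hx]
    rcases le_total ((w : Lp ℝ 2 m) x) c with h | h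
    · rw [min_eq_left h]
      have : 0 ≤ (w : Lp ℝ 2 m) x / c := by positivity
      nlinarith
    · rw [min_eq_right h, div_self hc.ne']
      simpa using hc.le
  have := hw v
  nlinarith

/-- A conservative form on a finite measure space is recurrent: if `u n = G_{α n} f`, then
`w = (u k - u n) / (α n - α k)` is `G_{α k} (u n)`, and `IsResolvent.integral_le` forces `w`, and
hence `u k`, to tend to infinity where `u n` does not vanish. -/
lemma isRecurrent_ofOperator [IsFiniteMeasure m]
    (hop : ∀ φ : ℝ → ℝ, LipschitzWith 1 φ → Operates T φ)
    {one : T.domain} (hone : ((one : Lp ℝ 2 m) : X → ℝ) =ᵐ[m] fun _ => 1) (hTone : T one = 0) :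
    (ofOperator T).IsRecurrent := by
  intro f hf _ u hu
  change ℕ → T.domain at u
  set α : ℕ → ℝ := fun n => 1 / ((n : ℝ) + 1) with hαdef
  have hα : ∀ n, 0 < α n := fun n => Nat.one_div_pos_of_nat
  have hα_lt : ∀ {n k}, n < k → α k < α n := fun h => Nat.one_div_lt_one_div h
  have hres : ∀ n, IsResolvent T (α n) f (u n) := fun n v => by
    have := hu n v
    rwa [ofOperator_form] at this
  have hpos : ∀ n, ∀ᵐ x ∂m, 0 ≤ ((u n : Lp ℝ 2 m) x) := fun n =>
    (hres n).nonneg hop (hα n) hf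
  have hresw : ∀ n k, n < k →
      IsResolvent T (α k) (u n) ((α n - α k)⁻¹ • (u k - u n)) := by
    intro n k hnk v
    have h1 := hres n v
    have h2 := hres k v
    have h3 : α n - α k ≠ 0 := (sub_pos.2 (hα_lt hnk)).ne'
    rw [T.map_smul, T.map_sub, Submodule.coe_smul, Submodule.coe_sub, real_inner_smul_left,
      real_inner_smul_left, inner_sub_left, inner_sub_left]
    field_simp
    linarith
  have hw0 : ∀ n k, n < k →
      ∀ᵐ x ∂m, 0 ≤ (((α n - α k)⁻¹ • (u k - u n) : T.domain) : Lp ℝ 2 m) x :=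
    fun n k hnk => (hresw n k hnk).nonneg hop (hα k) (hpos n)
  have hwx : ∀ n k, ((((α n - α k)⁻¹ • (u k - u n) : T.domain) : Lp ℝ 2 m) : X → ℝ) =ᵐ[m]
      fun x => (α n - α k)⁻¹ * ((u k : Lp ℝ 2 m) x - (u n : Lp ℝ 2 m) x) := fun n k => by
    filter_upwards [Lp.coeFn_smul (α n - α k)⁻¹ ((u k : Lp ℝ 2 m) - (u n : Lp ℝ 2 m)),
      Lp.coeFn_sub (u k : Lp ℝ 2 m) (u n : Lp ℝ 2 m)] with x h1 h2
    rw [Submodule.coe_smul, Submodule.coe_sub, h1, Pi.smul_apply, h2, Pi.sub_apply, smul_eq_mul]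
  have hmono : ∀ᵐ x ∂m, Monotone fun n => (u n : Lp ℝ 2 m) x := by
    have h1 : ∀ᵐ x ∂m, ∀ n,
        0 ≤ (α n - α (n + 1))⁻¹ * ((u (n + 1) : Lp ℝ 2 m) x - (u n : Lp ℝ 2 m) x) := by
      rw [ae_all_iff]
      intro n
      filter_upwards [hw0 n (n + 1) n.lt_succ_self, hwx n (n + 1)] with x hx hx'
      rwa [← hx']
    filter_upwards [h1] with x hx
    refine monotone_nat_of_le_succ fun n => ?_
    have := nonneg_of_mul_nonneg_right (hx n) (inv_pos.2 (sub_pos.2 (hα_lt n.lt_succ_self)))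
    linarith
  -- the functions `h n c k` have integrals tending to `0` as `k → ∞`
  set h : ℕ → ℕ → ℕ → X → ℝ := fun n c k x => (u n : Lp ℝ 2 m) x *
    (1 - min ((((α n - α (n + 1 + k))⁻¹ • (u (n + 1 + k) - u n) : T.domain) : Lp ℝ 2 m) x)
      ((c : ℝ) + 1) / ((c : ℝ) + 1)) with hh
  have hinf : ∀ᵐ x ∂m, ∀ n c, ⨅ k, ENNReal.ofReal (h n c k x) = 0 := by
    rw [ae_all_iff]; intro n
    rw [ae_all_iff]; intro c
    have hc : (0 : ℝ) < (c : ℝ) + 1 := by positivity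
    have hk : ∀ k, Integrable (h n c k) m ∧
        ∫ x, h n c k x ∂m ≤ α (n + 1 + k) * (((c : ℝ) + 1) * m.real univ) := fun k =>
      (hresw n (n + 1 + k) (by omega)).integral_le hop hone hTone (hα _) hc (hw0 _ _ (by omega))
    have h0 : ∀ k, 0 ≤ᵐ[m] h n c k := fun k => by
      filter_upwards [hpos n] with x hx
      refine mul_nonneg hx (sub_nonneg.2 ((div_le_one hc).2 (min_le_right _ _)))
    have hle : ∀ k, ∫⁻ x, ⨅ k, ENNReal.ofReal (h n c k x) ∂m ≤
        ENNReal.ofReal (α (n + 1 + k) * (((c : ℝ) + 1) * m.real univ)) := fun k => by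
      refine (lintegral_mono fun x => iInf_le _ k).trans ?_
      rw [← ofReal_integral_eq_lintegral_ofReal (hk k).1 (h0 k)]
      exact ENNReal.ofReal_le_ofReal (hk k).2
    have hlim : Tendsto (fun k => ENNReal.ofReal (α (n + 1 + k) * (((c : ℝ) + 1) * m.real univ)))
        atTop (𝓝 (ENNReal.ofReal (0 * (((c : ℝ) + 1) * m.real univ)))) := by
      refine ENNReal.tendsto_ofReal (Tendsto.mul_const _ ?_)
      have := tendsto_one_div_add_atTop_nhds_zero_nat (𝕜 := ℝ)
      exact this.comp (tendsto_add_atTop_nat (n + 1) |>.congr fun k => by omega)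
    rw [zero_mul, ENNReal.ofReal_zero] at hlim
    have hz : ∫⁻ x, ⨅ k, ENNReal.ofReal (h n c k x) ∂m = 0 :=
      le_antisymm (ge_of_tendsto' hlim hle) bot_le
    rw [lintegral_eq_zero_iff' (AEMeasurable.iInf fun k =>
      (hk k).1.aestronglyMeasurable.aemeasurable.ennreal_ofReal)] at hz
    exact hz
  have hw' : ∀ᵐ x ∂m, ∀ n k,
      ((((α n - α k)⁻¹ • (u k - u n) : T.domain) : Lp ℝ 2 m) : X → ℝ) x =
        (α n - α k)⁻¹ * ((u k : Lp ℝ 2 m) x - (u n : Lp ℝ 2 m) x) := by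
    rw [ae_all_iff]; intro n
    rw [ae_all_iff]; intro k
    exact hwx n k
  have hpos' : ∀ᵐ x ∂m, ∀ n, 0 ≤ ((u n : Lp ℝ 2 m) x) := by
    rw [ae_all_iff]
    exact hpos
  filter_upwards [hmono, hinf, hw', hpos'] with x hm hi hwx hp
  by_cases hzero : ∀ n, (u n : Lp ℝ 2 m) x = 0
  · left
    simp only [hzero, tendsto_const_nhds_iff]
  right
  push Not at hzero
  obtain ⟨n, hn⟩ := hzero
  have hn0 : 0 < (u n : Lp ℝ 2 m) x := lt_of_le_of_ne (hp n) (Ne.symm hn)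
  rcases tendsto_atTop_of_monotone hm with h1 | ⟨M, hM⟩
  · exact h1
  exfalso
  have hMle : ∀ k, (u k : Lp ℝ 2 m) x ≤ M := fun k => hm.ge_of_tendsto hM k
  set γ : ℝ := α n - α (n + 1)
  have hγ : 0 < γ := sub_pos.2 (hα_lt n.lt_succ_self)
  obtain ⟨c, hc⟩ := exists_nat_ge (2 * (γ⁻¹ * M))
  have hc1 : (0 : ℝ) < (c : ℝ) + 1 := by positivity
  have hlow : ∀ k, (u n : Lp ℝ 2 m) x / 2 ≤ h n c k x := fun k => by
    simp only [hh]
    rw [hwx]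
    have h1 : γ ≤ α n - α (n + 1 + k) := by
      have : α (n + 1 + k) ≤ α (n + 1) := Nat.one_div_le_one_div (by omega)
      linarith
    have h2 : (α n - α (n + 1 + k))⁻¹ * ((u (n + 1 + k) : Lp ℝ 2 m) x - (u n : Lp ℝ 2 m) x)
        ≤ γ⁻¹ * M := by
      refine mul_le_mul (inv_anti₀ hγ h1) ?_ (sub_nonneg.2 (hm (by omega))) (inv_pos.2 hγ).le
      linarith [hMle (n + 1 + k)]
    have h3 : min ((α n - α (n + 1 + k))⁻¹ *
        ((u (n + 1 + k) : Lp ℝ 2 m) x - (u n : Lp ℝ 2 m) x)) ((c : ℝ) + 1) / ((c : ℝ) + 1)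
        ≤ 1 / 2 := by
      rw [div_le_iff₀ hc1]
      refine (min_le_left _ _).trans (h2.trans ?_)
      linarith
    nlinarith
  have := hi n c
  have h2 : ENNReal.ofReal ((u n : Lp ℝ 2 m) x / 2) ≤ ⨅ k, ENNReal.ofReal (h n c k x) :=
    le_iInf fun k => ENNReal.ofReal_le_ofReal (hlow k)
  rw [this, nonpos_iff_eq_zero, ENNReal.ofReal_eq_zero] at h2
  linarith

end Recurrence

lemma isSymmDirichletForm_ofOperator [CompleteSpace K] {T : Lp ℝ 2 m →ₗ.[ℝ] K} (hT : T.IsClosed)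
    (hdense : Dense (T.domain : Set (Lp ℝ 2 m)))
    (hop : ∀ φ : ℝ → ℝ, LipschitzWith 1 φ → Operates T φ) :
    (ofOperator T).IsSymmDirichletForm where
  denselyDefined := hdense
  symmetric := ofOperator_isSymmetric T
  nonneg := ofOperator_isNonneg T
  closed := ofOperator_isClosedForm hT
  markov f := by
    change T.domain at f
    obtain ⟨g, hg, hle⟩ := hop _ (lipschitzWith_clamp 1) f
    refine ⟨g, hg, ?_⟩
    rw [ofOperator_form_self, ofOperator_form_self]
    gcongr

/-! ### Locality and regularity -/

section Locality

variable {V : Type*} [NormedAddCommGroup V] [InnerProductSpace ℝ V]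

/-- Locality passes to the closure: if for the set `U` the domain of `T` is invariant under
multiplication by a function `χ` that does not vanish on `U`, with a product rule in which the
derivative `Dχ` of `χ` vanishes where `χ` does, then `T f = 0` on `U` if `f = 0` on `{χ ≠ 0}`. -/
lemma closure_apply_eq_zero_of_eq_zero {T : Lp ℝ 2 m →ₗ.[ℝ] Lp V 2 m} (hT : T.IsClosable)
    {χ : X → ℝ} {Dχ : X → V} {C : ℝ} (hχm : AEStronglyMeasurable χ m)
    (hDχm : AEStronglyMeasurable Dχ m) (hχ : ∀ x, |χ x| ≤ C) (hDχ : ∀ᵐ x ∂m, ‖Dχ x‖ ≤ C)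
    (hzero : ∀ᵐ x ∂m, χ x = 0 → Dχ x = 0)
    (hmul : ∀ f : T.domain, ∃ g : T.domain,
      ((g : Lp ℝ 2 m) : X → ℝ) =ᵐ[m] (fun x => χ x * (f : Lp ℝ 2 m) x) ∧
      (T g : X → V) =ᵐ[m] fun x => χ x • (T f : X → V) x + ((f : Lp ℝ 2 m) x) • Dχ x)
    (f : T.closure.domain) (hf : ∀ᵐ x ∂m, χ x ≠ 0 → (f : Lp ℝ 2 m) x = 0) :
    ∀ᵐ x ∂m, χ x ≠ 0 → (T.closure f : X → V) x = 0 := by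
  obtain ⟨u, hu, hTu⟩ := exists_seq_of_mem_closure hT f
  choose g hg1 hg2 using fun n => hmul (u n)
  have hmem : MemLp (fun x => χ x • (T.closure f : X → V) x) 2 m :=
    MemLp.of_le_mul (c := C) (Lp.memLp (T.closure f)) (hχm.smul (Lp.aestronglyMeasurable _))
      (Eventually.of_forall fun x => by
        rw [norm_smul]
        exact mul_le_mul_of_nonneg_right (hχ x) (norm_nonneg _))
  have hglim : Tendsto (fun n => (g n : Lp ℝ 2 m)) atTop (𝓝 0) := by
    rw [tendsto_zero_iff_norm_tendsto_zero]
    have h0 : Tendsto (fun n => C * ‖(u n : Lp ℝ 2 m) - f‖) atTop (𝓝 0) := by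
      simpa using (tendsto_iff_norm_sub_tendsto_zero.1 hu).const_mul C
    refine squeeze_zero (fun _ => norm_nonneg _) (fun n => ?_) h0
    refine Lp.norm_le_mul_norm_of_ae_le_mul ?_
    filter_upwards [hg1 n, Lp.coeFn_sub (u n : Lp ℝ 2 m) (f : Lp ℝ 2 m), hf] with x h1 h2 h3
    rw [h1, h2, Pi.sub_apply, norm_mul]
    by_cases hx : χ x = 0
    · rw [hx, norm_zero, zero_mul]
      exact mul_nonneg ((abs_nonneg _).trans (hχ x)) (norm_nonneg _)
    · rw [h3 hx, sub_zero]
      exact mul_le_mul_of_nonneg_right (hχ x) (norm_nonneg _)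
  have hTlim : Tendsto (fun n => T (g n)) atTop (𝓝 (hmem.toLp _)) := by
    rw [tendsto_iff_norm_sub_tendsto_zero]
    have h0 : Tendsto (fun n => C * ‖T (u n) - T.closure f‖ + C * ‖(u n : Lp ℝ 2 m) - f‖) atTop
        (𝓝 0) := by
      simpa using ((tendsto_iff_norm_sub_tendsto_zero.1 hTu).const_mul C).add
        ((tendsto_iff_norm_sub_tendsto_zero.1 hu).const_mul C)
    refine squeeze_zero (fun _ => norm_nonneg _) (fun n => ?_) h0
    have hmem1 : MemLp (fun x => χ x • (T (u n) - T.closure f : Lp V 2 m) x) 2 m :=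
      MemLp.of_le_mul (c := C) (Lp.memLp _) (hχm.smul (Lp.aestronglyMeasurable _))
        (Eventually.of_forall fun x => by
          rw [norm_smul]
          exact mul_le_mul_of_nonneg_right (hχ x) (norm_nonneg _))
    have hbd2 : ∀ᵐ x ∂m, ‖((u n : Lp ℝ 2 m) - f : Lp ℝ 2 m) x • Dχ x‖
        ≤ C * ‖((u n : Lp ℝ 2 m) - f : Lp ℝ 2 m) x‖ := by
      filter_upwards [hDχ] with x hx
      rw [norm_smul, mul_comm]
      exact mul_le_mul_of_nonneg_right hx (norm_nonneg _)
    have hmem2 : MemLp (fun x => ((u n : Lp ℝ 2 m) - f : Lp ℝ 2 m) x • Dχ x) 2 m :=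
      MemLp.of_le_mul (c := C) (Lp.memLp _) ((Lp.aestronglyMeasurable _).smul hDχm) hbd2
    have heq : T (g n) - hmem.toLp _ = hmem1.toLp _ + hmem2.toLp _ := by
      refine Lp.ext ?_
      filter_upwards [Lp.coeFn_sub (T (g n)) (hmem.toLp _), hmem.coeFn_toLp, hmem1.coeFn_toLp,
        hmem2.coeFn_toLp, Lp.coeFn_add (hmem1.toLp _) (hmem2.toLp _), hg2 n,
        Lp.coeFn_sub (T (u n)) (T.closure f), Lp.coeFn_sub (u n : Lp ℝ 2 m) (f : Lp ℝ 2 m), hf,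
        hzero]
        with x h1 h2 h3 h4 h5 h6 h7 h8 h9 h10
      rw [h1, h5, Pi.sub_apply, Pi.add_apply, h2, h3, h4, h6, h7, h8, Pi.sub_apply, Pi.sub_apply,
        smul_sub, sub_smul]
      by_cases hx : χ x = 0
      · rw [h10 hx]
        simp
      · rw [h9 hx]
        simp only [zero_smul, sub_zero]
        abel
    rw [heq]
    refine (norm_add_le _ _).trans (add_le_add ?_ ?_)
    · refine Lp.norm_le_mul_norm_of_ae_le_mul ?_
      filter_upwards [hmem1.coeFn_toLp] with x h1
      rw [h1, norm_smul]
      exact mul_le_mul_of_nonneg_right (hχ x) (norm_nonneg _)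
    · refine Lp.norm_le_mul_norm_of_ae_le_mul ?_
      filter_upwards [hmem2.coeFn_toLp, hbd2] with x h1 h2
      rwa [h1]
  obtain ⟨h0, hv0⟩ := mem_domain_of_tendsto (T := T.closure) hT.closure_isClosed
    (u := fun n => ⟨g n, T.le_closure.1 (g n).2⟩) hglim
    (hTlim.congr fun n => T.le_closure.2 (x := g n) (y := ⟨g n, T.le_closure.1 (g n).2⟩) rfl)
  have hv : hmem.toLp _ = 0 := by
    rw [← hv0]
    exact T.closure.map_zero
  filter_upwards [hmem.coeFn_toLp, Lp.coeFn_zero V 2 m] with x h1 h2 hx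
  rw [hv, h2] at h1
  exact (smul_eq_zero.1 h1.symm).resolve_left hx

/-- If `T` is local and vanishes on constants, then `T u` vanishes off the support of `u` and `T v`
vanishes where `v` is constant, so that no point carries both. -/
lemma isStronglyLocal_ofOperator [TopologicalSpace X] [SecondCountableTopology X]
    {T : Lp ℝ 2 m →ₗ.[ℝ] Lp V 2 m}
    {one : T.domain} (hone : ((one : Lp ℝ 2 m) : X → ℝ) =ᵐ[m] fun _ => 1) (hTone : T one = 0)
    (hloc : ∀ U : Set X, IsOpen U → ∀ f : T.domain, (∀ᵐ x ∂m, x ∈ U → (f : Lp ℝ 2 m) x = 0) →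
      ∀ᵐ x ∂m, x ∈ U → (T f : X → V) x = 0) :
    (ofOperator T).IsStronglyLocal := by
  rintro u v - - ⟨U, c, hU, hsub, hv⟩
  change T.domain at u v
  set S := essSupport m ((u : Lp ℝ 2 m) : X → ℝ)
  have hloc' : ∀ x ∈ Sᶜ, ∃ W, IsOpen W ∧ x ∈ W ∧ ∀ᵐ y ∂m, y ∈ W → (u : Lp ℝ 2 m) y = 0 := by
    intro x hx
    simp only [S, essSupport, mem_compl_iff, mem_ofPred_eq] at hx
    push Not at hx
    obtain ⟨W, hW, h⟩ := hx
    obtain ⟨W', hW', hWo, hxW⟩ := mem_nhds_iff.1 hW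
    exact ⟨W', hWo, hxW, h.mono fun y hy hy' => hy (hW' hy')⟩
  have hTu : ∀ᵐ x ∂m, x ∈ Sᶜ → (T u : X → V) x = 0 := by
    rw [ae_iff]
    refine measure_null_of_locally_null _ fun x hx => ?_
    simp only [mem_ofPred_eq, Classical.not_imp] at hx
    obtain ⟨W, hWo, hxW, h⟩ := hloc' x hx.1
    refine ⟨_, inter_mem_nhdsWithin _ (hWo.mem_nhds hxW), ?_⟩
    refine measure_mono_null ?_ (ae_iff.1 (hloc W hWo u h))
    rintro y ⟨hy', hy⟩
    simp only [mem_ofPred_eq, Classical.not_imp] at hy' ⊢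
    exact ⟨hy, hy'.2⟩
  have hTv : ∀ᵐ x ∂m, x ∈ U → (T v : X → V) x = 0 := by
    have h1 : T (v - c • one) = T v := by
      rw [T.map_sub, T.map_smul, hTone, smul_zero, sub_zero]
    rw [← h1]
    refine hloc U hU _ ?_
    filter_upwards [hv, Lp.coeFn_sub (v : Lp ℝ 2 m) (c • (one : Lp ℝ 2 m)),
      Lp.coeFn_smul c (one : Lp ℝ 2 m), hone] with x h1 h2 h3 h4 hx
    rw [Submodule.coe_sub, Submodule.coe_smul, h2, Pi.sub_apply, h3, Pi.smul_apply, h4, h1 hx]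
    simp
  rw [ofOperator_form, L2.inner_def]
  have : ∫ x, ⟪(T u : X → V) x, (T v : X → V) x⟫_ℝ ∂m = 0 := by
    refine integral_eq_zero_of_ae ?_
    filter_upwards [hTu, hTv] with x h1 h2
    by_cases hx : x ∈ S
    · rw [h2 (hsub hx)]
      simp
    · rw [h1 hx]
      simp
  rw [this, mul_zero]

end Locality

lemma isRegular_ofOperator_closure [TopologicalSpace X] [CompactSpace X] [CompleteSpace K]
    [IsFiniteMeasure m] [m.IsOpenPosMeasure] {T : Lp ℝ 2 m →ₗ.[ℝ] K} (hT : T.IsClosable)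
    (hcont : ∀ f : T.domain, ∃ w : C(X, ℝ), ((f : Lp ℝ 2 m) : X → ℝ) =ᵐ[m] w)
    (hdense : ∀ (v : C(X, ℝ)) (ε : ℝ), 0 < ε → ∃ (f : T.domain) (w : C(X, ℝ)),
      ((f : Lp ℝ 2 m) : X → ℝ) =ᵐ[m] w ∧ dist v w < ε) :
    (ofOperator T.closure).IsRegular where
  finite_on_compacts := inferInstance
  full_support := inferInstance
  dense_dom f ε hε := by
    obtain ⟨g, hg⟩ := (ofOperator_closure_isClosureOf hT).dense f ε hε
    obtain ⟨w, hw⟩ := hcont g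
    exact ⟨⟨g, T.le_closure.1 g.2⟩, w, HasCompactSupport.of_compactSpace _, hw, hg⟩
  dense_cont v _ ε hε := by
    obtain ⟨g, w, hg, hw⟩ := hdense v ε hε
    refine ⟨⟨g, T.le_closure.1 g.2⟩, w, HasCompactSupport.of_compactSpace _, hg, fun x => ?_⟩
    rw [← Real.dist_eq]
    exact (ContinuousMap.dist_apply_le_dist x).trans_lt hw

end DForm

/-! ### Sections of product measures in one coordinate -/

section Resampling

variable {ι Z : Type*} [Fintype ι] [DecidableEq ι] [MeasurableSpace Z]

/-- Resampling one coordinate of a product measure gives a multiple of the product measure. -/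
lemma map_update_prod_pi (ν : Measure Z) [IsFiniteMeasure ν] (i : ι) :
    Measure.map (fun p : (ι → Z) × Z => Function.update p.1 i p.2)
      ((Measure.pi fun _ : ι => ν).prod ν) = ν univ • Measure.pi fun _ : ι => ν := by
  have hmeas : Measurable fun p : (ι → Z) × Z => Function.update p.1 i p.2 := by fun_prop
  have hprod : ∀ (a : ι → ℝ≥0∞), ∏ j, a j = a i * ∏ j ∈ Finset.univ.erase i, a j := fun a =>
    (Finset.mul_prod_erase _ _ (Finset.mem_univ i)).symm
  -- both sides are the product of the following measures
  set τ : ι → Measure Z := fun j => if j = i then ν univ • ν else ν with hτ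
  have hτi : τ i = ν univ • ν := if_pos rfl
  have hτj : ∀ j ∈ (Finset.univ : Finset ι).erase i, τ j = ν := fun j hj =>
    if_neg (Finset.ne_of_mem_erase hj)
  have : ∀ j, SigmaFinite (τ j) := fun j => by
    simp only [hτ]
    split_ifs
    · have : IsFiniteMeasure (ν univ • ν) := ν.smul_finite (measure_ne_top _ _)
      infer_instance
    · infer_instance
  have hτ_prod : ∀ s : ι → Set Z, ∏ j, τ j (s j)
      = ν univ * ν (s i) * ∏ j ∈ Finset.univ.erase i, ν (s j) := fun s => by
    rw [hprod fun j => τ j (s j), hτi, Finset.prod_congr rfl fun j hj => by rw [hτj j hj]]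
    rfl
  trans Measure.pi τ
  · refine (Measure.pi_eq fun s hs => ?_).symm
    rw [Measure.map_apply hmeas (MeasurableSet.univ_pi hs)]
    have : (fun p : (ι → Z) × Z => Function.update p.1 i p.2) ⁻¹' (univ.pi s)
        = (univ.pi (Function.update s i univ)) ×ˢ s i := by
      ext ⟨x, z⟩
      simp only [mem_preimage, mem_univ_pi, mem_prod]
      constructor
      · intro h
        refine ⟨fun j => ?_, by simpa using h i⟩
        by_cases hj : j = i
        · subst hj
          simp
        · simpa [hj] using h j
      · rintro ⟨h1, h2⟩ j
        by_cases hj : j = i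
        · subst hj
          simpa using h2
        · simpa [hj] using h1 j
    rw [this, Measure.prod_prod, Measure.pi_pi, hprod, hτ_prod, Function.update_self,
      Finset.prod_congr rfl fun j hj => by
        rw [Function.update_of_ne (Finset.ne_of_mem_erase hj)]]
    ring
  · refine Measure.pi_eq fun s hs => ?_
    rw [Measure.smul_apply, Measure.pi_pi, hprod, hτ_prod, smul_eq_mul, mul_assoc]

variable {ν : Measure Z} [IsFiniteMeasure ν]

lemma lintegral_lintegral_update (i : ι) {f : (ι → Z) → ℝ≥0∞} (hf : Measurable f) :
    ∫⁻ x, ∫⁻ z, f (Function.update x i z) ∂ν ∂(Measure.pi fun _ : ι => ν)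
      = ν univ * ∫⁻ x, f x ∂(Measure.pi fun _ : ι => ν) := by
  have hmeas : Measurable fun p : (ι → Z) × Z => Function.update p.1 i p.2 := by fun_prop
  rw [← smul_eq_mul, ← lintegral_smul_measure, ← map_update_prod_pi ν i, lintegral_map hf hmeas]
  exact (lintegral_prod _ (hf.comp hmeas).aemeasurable).symm

lemma ae_ae_update_of_ae (i : ι) {P : (ι → Z) → Prop}
    (h : ∀ᵐ x ∂(Measure.pi fun _ : ι => ν), P x) :
    ∀ᵐ x ∂(Measure.pi fun _ : ι => ν), ∀ᵐ z ∂ν, P (Function.update x i z) := by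
  have hmeas : Measurable fun p : (ι → Z) × Z => Function.update p.1 i p.2 := by fun_prop
  have h1 : ∀ᵐ x ∂(Measure.map (fun p : (ι → Z) × Z => Function.update p.1 i p.2)
      ((Measure.pi fun _ : ι => ν).prod ν)), P x := by
    rw [map_update_prod_pi]
    exact Measure.ae_smul_measure h _
  exact Measure.ae_ae_of_ae_prod (ae_of_ae_map hmeas.aemeasurable h1)

lemma ae_of_ae_ae_update (i : ι) {P : (ι → Z) → Prop} (hP : MeasurableSet {x | P x})
    (h : ∀ᵐ x ∂(Measure.pi fun _ : ι => ν), ∀ᵐ z ∂ν, P (Function.update x i z)) :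
    ∀ᵐ x ∂(Measure.pi fun _ : ι => ν), P x := by
  have h1 := lintegral_lintegral_update (ν := ν) i
    (f := {x | P x}ᶜ.indicator 1) (measurable_one.indicator hP.compl)
  rw [lintegral_indicator_one hP.compl] at h1
  have h2 : ∫⁻ x, ∫⁻ z, ({x | P x}ᶜ.indicator 1 (Function.update x i z) : ℝ≥0∞) ∂ν
      ∂(Measure.pi fun _ : ι => ν) = 0 := by
    rw [lintegral_congr_ae (g := fun _ => 0), lintegral_zero]
    filter_upwards [h] with x hx
    rw [lintegral_congr_ae (g := fun _ => 0), lintegral_zero]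
    filter_upwards [hx] with z hz
    simpa using hz
  rw [h2] at h1
  rcases mul_eq_zero.1 h1.symm with h3 | h3
  · have : (Measure.pi fun _ : ι => ν) = 0 := by
      rw [← Measure.measure_univ_eq_zero, Measure.pi_univ]
      exact Finset.prod_eq_zero (Finset.mem_univ i) h3
    rw [this]
    simp
  · exact h3

end Resampling

section Slices

variable {J Z : Type*} [Fintype J] [DecidableEq J] [MeasurableSpace Z] [PseudoMetricSpace Z]
  [SecondCountableTopology Z] [BorelSpace Z] {ν : Measure Z} [IsFiniteMeasure ν]

/-- If `q` is locally integrable around almost every point of a product, then almost every section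
of `q` in one coordinate is locally integrable: the balls of the product are boxes, and the theorem
of Tonelli applies to each of countably many boxes. -/
lemma ae_section_regular {q : (J → Z) → ℝ≥0∞} (hq : Measurable q) (i : J)
    (h : ∀ᵐ y ∂(Measure.pi fun _ : J => ν), ∃ ε : ℝ, 0 < ε ∧
      ∫⁻ z in Metric.ball y ε, q z ∂(Measure.pi fun _ : J => ν) < ∞) :
    ∀ᵐ y ∂(Measure.pi fun _ : J => ν), ∃ ε : ℝ, 0 < ε ∧
      ∫⁻ z in Metric.ball (y i) ε, q (Function.update y i z) ∂ν < ∞ := by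
  have hkey : ∀ᵐ y ∂(Measure.pi fun _ : J => ν), (∃ ε : ℝ, 0 < ε ∧
      ∫⁻ z in Metric.ball y ε, q z ∂(Measure.pi fun _ : J => ν) < ∞) → ∃ ε : ℝ, 0 < ε ∧
      ∫⁻ z in Metric.ball (y i) ε, q (Function.update y i z) ∂ν < ∞ := by
    rw [ae_iff]
    refine measure_null_of_locally_null _ fun y₀ hy₀ => ?_
    simp only [mem_ofPred_eq, Classical.not_imp] at hy₀
    obtain ⟨⟨ε, hε, hfin⟩, -⟩ := hy₀
    refine ⟨_, inter_mem_nhdsWithin _ (Metric.ball_mem_nhds y₀ hε), ?_⟩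
    have hball : MeasurableSet (Metric.ball y₀ ε) := by
      rw [ball_pi _ hε]
      exact MeasurableSet.univ_pi fun j => measurableSet_ball
    have h1 := lintegral_lintegral_update (ν := ν) i
      (f := (Metric.ball y₀ ε).indicator q) (hq.indicator hball)
    rw [lintegral_indicator hball] at h1
    have h2 : ∫⁻ x, ∫⁻ z, (Metric.ball y₀ ε).indicator q (Function.update x i z) ∂ν
        ∂(Measure.pi fun _ : J => ν) ≠ ∞ := by
      rw [h1]
      exact ENNReal.mul_ne_top (measure_ne_top _ _) hfin.ne
    have hmeas : Measurable fun x : J → Z =>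
        ∫⁻ z, (Metric.ball y₀ ε).indicator q (Function.update x i z) ∂ν :=
      Measurable.lintegral_prod_right' (f := fun p : (J → Z) × Z =>
        (Metric.ball y₀ ε).indicator q (Function.update p.1 i p.2))
        ((hq.indicator hball).comp (by fun_prop))
    have h3 := ae_lt_top hmeas h2
    refine measure_mono_null ?_ (ae_iff.1 h3)
    rintro y ⟨hy1, hy2⟩
    simp only [mem_ofPred_eq, Classical.not_imp] at hy1 ⊢
    intro hlt
    refine hy1.2 ?_
    rw [ball_pi _ hε, mem_univ_pi] at hy2
    refine ⟨ε - dist (y i) (y₀ i), sub_pos.2 (hy2 i), lt_of_le_of_lt ?_ hlt⟩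
    rw [← lintegral_indicator measurableSet_ball]
    refine lintegral_mono fun z => ?_
    by_cases hz : z ∈ Metric.ball (y i) (ε - dist (y i) (y₀ i))
    · have hmem : Function.update y i z ∈ Metric.ball y₀ ε := by
        rw [ball_pi _ hε, mem_univ_pi]
        intro j
        by_cases hj : j = i
        · subst hj
          rw [Function.update_self]
          rw [Metric.mem_ball] at hz ⊢
          linarith [dist_triangle z (y j) (y₀ j)]
        · rw [Function.update_of_ne hj]
          exact hy2 j
      rw [indicator_of_mem hz, indicator_of_mem hmem]
    · rw [indicator_of_notMem hz]
      exact bot_le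
  filter_upwards [h, hkey] with y h1 h2
  exact h2 h1

omit [Fintype J] in
lemma measurableSet_section_regular {Y : Type*} [MeasurableSpace Y] {q : (J → Z) × Y → ℝ≥0∞}
    (hq : Measurable q) (i : J) :
    MeasurableSet {p : (J → Z) × Y | ∃ ε : ℝ, 0 < ε ∧
      ∫⁻ z in Metric.ball (p.1 i) ε, q (Function.update p.1 i z, p.2) ∂ν < ∞} := by
  have heq : {p : (J → Z) × Y | ∃ ε : ℝ, 0 < ε ∧
      ∫⁻ z in Metric.ball (p.1 i) ε, q (Function.update p.1 i z, p.2) ∂ν < ∞} =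
      ⋃ n : ℕ, {p : (J → Z) × Y |
        ∫⁻ z in Metric.ball (p.1 i) (1 / ((n : ℝ) + 1)),
          q (Function.update p.1 i z, p.2) ∂ν < ∞} := by
    ext p
    simp only [mem_ofPred_eq, mem_iUnion]
    constructor
    · rintro ⟨ε, hε, h⟩
      obtain ⟨n, hn⟩ := exists_nat_one_div_lt hε
      exact ⟨n, lt_of_le_of_lt (lintegral_mono_set (Metric.ball_subset_ball hn.le)) h⟩
    · rintro ⟨n, h⟩
      exact ⟨_, Nat.one_div_pos_of_nat, h⟩
  rw [heq]
  refine MeasurableSet.iUnion fun n => measurableSet_lt ?_ measurable_const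
  have hS : MeasurableSet {p : ((J → Z) × Y) × Z | dist p.2 (p.1.1 i) < 1 / ((n : ℝ) + 1)} := by
    refine measurableSet_lt (Measurable.dist measurable_snd ?_) measurable_const
    fun_prop
  have hm : Measurable fun p : (J → Z) × Y => ∫⁻ z, {p : ((J → Z) × Y) × Z |
      dist p.2 (p.1.1 i) < 1 / ((n : ℝ) + 1)}.indicator
      (fun p => q (Function.update p.1.1 i p.2, p.1.2)) (p, z) ∂ν :=
    Measurable.lintegral_prod_right' (Measurable.indicator (hq.comp (by fun_prop)) hS)
  convert hm using 2 with p
  rw [← lintegral_indicator measurableSet_ball]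
  rfl

omit [Fintype J] in
lemma measurableSet_coordinate_regular {q : (J → Z) → ℝ≥0∞} (hq : Measurable q) (i : J) :
    MeasurableSet {y : J → Z | ∃ ε : ℝ, 0 < ε ∧
      ∫⁻ z in Metric.ball (y i) ε, q (Function.update y i z) ∂ν < ∞} :=
  (measurableSet_section_regular (ν := ν) (q := fun p : (J → Z) × Unit => q p.1)
    (hq.comp measurable_fst) i).preimage
    (measurable_id.prodMk measurable_const : Measurable fun y : J → Z => (y, ()))

lemma ae_prod_section_regular {Y : Type*} [MeasurableSpace Y] {τ : Measure Y} [SFinite τ]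
    {q : (J → Z) × Y → ℝ≥0∞} (hq : Measurable q) (i : J)
    (h : ∀ᵐ x ∂τ, ∀ᵐ y ∂(Measure.pi fun _ : J => ν), ∃ ε : ℝ, 0 < ε ∧
      ∫⁻ z in Metric.ball y ε, q (z, x) ∂(Measure.pi fun _ : J => ν) < ∞) :
    ∀ᵐ p ∂((Measure.pi fun _ : J => ν).prod τ), ∃ ε : ℝ, 0 < ε ∧
      ∫⁻ z in Metric.ball (p.1 i) ε, q (Function.update p.1 i z, p.2) ∂ν < ∞ := by
  have hS := measurableSet_section_regular (ν := ν) hq i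
  rw [← Measure.prod_swap, ae_map_iff measurable_swap.aemeasurable hS]
  refine (Measure.ae_prod_iff_ae_ae (measurable_swap hS)).2 ?_
  filter_upwards [h] with x hx
  exact ae_section_regular (q := fun y => q (y, x)) (by fun_prop) i hx

end Slices

/-! ### Strata of the configuration space and the Hamza condition -/

section Config

variable {d N : ℕ} {Ω : Set (EuclideanSpace ℝ (Fin d))}

lemma mem_frontier_iff_notMem (hΩ : IsOpen Ω) (z : closure Ω) :
    (z : EuclideanSpace ℝ (Fin d)) ∈ frontier Ω ↔ (z : EuclideanSpace ℝ (Fin d)) ∉ Ω := by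
  rw [hΩ.frontier_eq]
  exact ⟨fun h => h.2, fun h => ⟨z.2, h⟩⟩

lemma measurableEmbedding_coe_closure :
    MeasurableEmbedding (Subtype.val : closure Ω → EuclideanSpace ℝ (Fin d)) :=
  MeasurableEmbedding.subtype_coe isClosed_closure.measurableSet

lemma measurableSet_mem_domain (hΩ : IsOpen Ω) :
    MeasurableSet {z : closure Ω | (z : EuclideanSpace ℝ (Fin d)) ∈ Ω} :=
  hΩ.measurableSet.preimage measurable_subtype_coe

lemma ae_interiorMeasure_mem (hΩ : IsOpen Ω) :
    ∀ᵐ z : closure Ω ∂(interiorMeasure Ω), (z : EuclideanSpace ℝ (Fin d)) ∈ Ω := by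
  rw [ae_iff, interiorMeasure, measurableEmbedding_coe_closure.comap_apply,
    Measure.restrict_apply' hΩ.measurableSet]
  convert measure_empty (μ := (volume : Measure (EuclideanSpace ℝ (Fin d))))
  ext y
  simp +contextual

lemma ae_surfaceMeasure_mem :
    ∀ᵐ z : closure Ω ∂(surfaceMeasure Ω), (z : EuclideanSpace ℝ (Fin d)) ∈ frontier Ω := by
  rw [ae_iff, surfaceMeasure, measurableEmbedding_coe_closure.comap_apply,
    Measure.restrict_apply' isClosed_frontier.measurableSet]
  convert measure_empty (μ := (Measure.euclideanHausdorffMeasure (d - 1) :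
    Measure (EuclideanSpace ℝ (Fin d))))
  ext y
  simp +contextual

lemma restrict_interior (hΩ : IsOpen Ω) :
    (interiorMeasure Ω + surfaceMeasure Ω).restrict {z | (z : EuclideanSpace ℝ (Fin d)) ∈ Ω}
      = interiorMeasure Ω := by
  rw [Measure.restrict_add, Measure.restrict_eq_self_of_ae_mem
      (s := {z : closure Ω | (z : EuclideanSpace ℝ (Fin d)) ∈ Ω}) (ae_interiorMeasure_mem hΩ),
    Measure.restrict_eq_zero.2, add_zero]
  refine measure_mono_null ?_ (ae_iff.1 (ae_surfaceMeasure_mem))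
  intro z hz
  rw [mem_ofPred_eq, mem_frontier_iff_notMem hΩ]
  exact fun h => h hz

lemma restrict_surface (hΩ : IsOpen Ω) :
    (interiorMeasure Ω + surfaceMeasure Ω).restrict
      {z | (z : EuclideanSpace ℝ (Fin d)) ∈ frontier Ω} = surfaceMeasure Ω := by
  rw [Measure.restrict_add, Measure.restrict_eq_self_of_ae_mem
      (s := {z : closure Ω | (z : EuclideanSpace ℝ (Fin d)) ∈ frontier Ω}) (ae_surfaceMeasure_mem),
    Measure.restrict_eq_zero.2, zero_add]
  refine measure_mono_null ?_ (ae_iff.1 (ae_interiorMeasure_mem hΩ))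
  intro z hz
  exact (mem_frontier_iff_notMem hΩ z).1 hz

/-- The configurations whose particles inside `Ω` are exactly those in `B`. -/
def stratum (Ω : Set (EuclideanSpace ℝ (Fin d))) (B : Finset (Fin N)) : Set (Config Ω N) :=
  univ.pi fun i => if i ∈ B then {z | (z : EuclideanSpace ℝ (Fin d)) ∈ Ω}
    else {z | (z : EuclideanSpace ℝ (Fin d)) ∈ frontier Ω}

lemma measurableSet_stratum (hΩ : IsOpen Ω) (B : Finset (Fin N)) :
    MeasurableSet (stratum Ω B) := by
  refine MeasurableSet.univ_pi fun i => ?_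
  split_ifs
  · exact measurableSet_mem_domain hΩ
  · exact isClosed_frontier.measurableSet.preimage measurable_subtype_coe

open Classical in
lemma exists_mem_stratum (hΩ : IsOpen Ω) (x : Config Ω N) :
    x ∈ stratum Ω (Finset.univ.filter fun i => (x i : EuclideanSpace ℝ (Fin d)) ∈ Ω) := by
  rw [stratum, mem_univ_pi]
  intro i
  by_cases hi : (x i : EuclideanSpace ℝ (Fin d)) ∈ Ω
  · simp [hi]
  · simp [hi, mem_frontier_iff_notMem hΩ]

open Classical in
lemma glue_update_left (B : Finset (Fin N)) (y : {i // i ∈ B} → closure Ω)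
    (x : {i // i ∉ B} → closure Ω) (i : {i // i ∈ B}) (z : closure Ω) :
    glue B (Function.update y i z) x = Function.update (glue B y x) i z := by
  funext j
  by_cases hj : j = i
  · subst hj
    simp [glue]
  · by_cases hjB : j ∈ B
    · have : (⟨j, hjB⟩ : {i // i ∈ B}) ≠ i := fun h => hj (congrArg Subtype.val h)
      simp [glue, hjB, hj, this]
    · simp [glue, hjB, hj]

open Classical in
lemma glue_update_right (B : Finset (Fin N)) (y : {i // i ∈ B} → closure Ω)
    (x : {i // i ∉ B} → closure Ω) (i : {i // i ∉ B}) (z : closure Ω) :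
    glue B y (Function.update x i z) = Function.update (glue B y x) i z := by
  funext j
  by_cases hj : j = i
  · subst hj
    simp [glue, i.2]
  · by_cases hjB : j ∈ B
    · simp [glue, hjB, hj]
    · have : (⟨j, hjB⟩ : {i // i ∉ B}) ≠ i := fun h => hj (congrArg Subtype.val h)
      simp [glue, hjB, hj, this]

variable [IsFiniteMeasure (interiorMeasure Ω)] [IsFiniteMeasure (surfaceMeasure Ω)]

/-- On each stratum, the product measure is the product of volume and surface measures. -/
lemma measurePreserving_glue (hΩ : IsOpen Ω) (B : Finset (Fin N)) :
    MeasurePreserving (fun p : ({i // i ∈ B} → closure Ω) × ({i // i ∉ B} → closure Ω) =>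
      glue B p.1 p.2)
      ((Measure.pi fun _ : {i // i ∈ B} => interiorMeasure Ω).prod
        (Measure.pi fun _ : {i // i ∉ B} => surfaceMeasure Ω))
      ((baseMeasure Ω N).restrict (stratum Ω B)) := by
  set τ : Fin N → Measure (closure Ω) := fun i =>
    if i ∈ B then interiorMeasure Ω else surfaceMeasure Ω with hτ
  have : ∀ i, IsFiniteMeasure (τ i) := fun i => by
    simp only [hτ]
    split_ifs <;> infer_instance
  have h1 := (measurePreserving_piEquivPiSubtypeProd τ (fun i => i ∈ B)).symm
  have h2 : (baseMeasure Ω N).restrict (stratum Ω B) = Measure.pi τ := by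
    rw [baseMeasure, stratum, Measure.restrict_pi_pi]
    congr 1
    funext i
    simp only [hτ]
    split_ifs
    · exact restrict_interior hΩ
    · exact restrict_surface hΩ
  have h3 : (fun i : {i // i ∈ B} => τ i) = fun _ => interiorMeasure Ω :=
    funext fun i => if_pos i.2
  have h4 : (fun i : {i // i ∉ B} => τ i) = fun _ => surfaceMeasure Ω :=
    funext fun i => if_neg i.2
  rw [h2]
  have h5 : (fun p : ({i // i ∈ B} → closure Ω) × ({i // i ∉ B} → closure Ω) => glue B p.1 p.2)
      = (MeasurableEquiv.piEquivPiSubtypeProd (fun _ : Fin N => closure Ω)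
        (fun i => i ∈ B)).symm := by
    funext p i
    by_cases hi : i ∈ B
    · simp [glue, hi, MeasurableEquiv.piEquivPiSubtypeProd, Equiv.piEquivPiSubtypeProd]
    · simp [glue, hi, MeasurableEquiv.piEquivPiSubtypeProd, Equiv.piEquivPiSubtypeProd]
  rw [h5]
  convert! h1 using 2
  · simp only [h3]
    congr!
  · simp only [h4]

/-- A property that holds on almost every glued configuration of each stratum holds almost
everywhere. -/
lemma ae_baseMeasure_of_glue (hΩ : IsOpen Ω) {P : Config Ω N → Prop} (hP : MeasurableSet {x | P x})
    (h : ∀ B : Finset (Fin N), ∀ᵐ p ∂((Measure.pi fun _ : {i // i ∈ B} => interiorMeasure Ω).prod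
        (Measure.pi fun _ : {i // i ∉ B} => surfaceMeasure Ω)), P (glue B p.1 p.2)) :
    ∀ᵐ x ∂(baseMeasure Ω N), P x := by
  have h1 : ∀ᵐ x ∂(baseMeasure Ω N), ∀ B : Finset (Fin N), x ∈ stratum Ω B → P x := by
    rw [ae_all_iff]
    intro B
    rw [← ae_restrict_iff' (measurableSet_stratum hΩ B), ← (measurePreserving_glue hΩ B).map_eq,
      ae_map_iff (measurePreserving_glue hΩ B).aemeasurable hP]
    exact h B
  filter_upwards [h1] with x hx
  exact hx _ (exists_mem_stratum hΩ x)

lemma ae_glue_of_ae_baseMeasure (hΩ : IsOpen Ω) {P : Config Ω N → Prop}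
    (h : ∀ᵐ x ∂(baseMeasure Ω N), P x) (B : Finset (Fin N)) :
    ∀ᵐ p ∂((Measure.pi fun _ : {i // i ∈ B} => interiorMeasure Ω).prod
        (Measure.pi fun _ : {i // i ∉ B} => surfaceMeasure Ω)), P (glue B p.1 p.2) := by
  have h1 := ae_restrict_of_ae (s := stratum Ω B) h
  rw [← (measurePreserving_glue hΩ B).map_eq] at h1
  exact ae_of_ae_map (measurePreserving_glue hΩ B).aemeasurable h1

variable {ϱ : Config Ω N → ℝ} {w : Config Ω N → ℝ≥0∞}

/-- The Hamza condition in the interior, reduced to one particle: for almost every configuration,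
`ϱ⁻¹` is integrable near the position of each particle inside `Ω` as a function of the position of
this particle alone. -/
lemma HamzaInterior.ae_regular (hΩ : IsOpen Ω) (hH : HamzaInterior Ω ϱ) (hw : Measurable w)
    (hϱw : ∀ᵐ x ∂(baseMeasure Ω N), ENNReal.ofReal (ϱ x) = w x)
    (hϱ : ∀ᵐ x ∂(baseMeasure Ω N), 0 < ϱ x) :
    ∀ᵐ x ∂(baseMeasure Ω N), ∀ i, (x i : EuclideanSpace ℝ (Fin d)) ∈ Ω → ∃ ε : ℝ, 0 < ε ∧
      ∫⁻ z in Metric.ball (x i) ε, (w (Function.update x i z))⁻¹ ∂(interiorMeasure Ω) < ∞ := by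
  classical
  rw [ae_all_iff]
  intro i
  refine ae_baseMeasure_of_glue hΩ ?_ fun B => ?_
  · exact ((measurableSet_mem_domain hΩ).preimage (measurable_pi_apply i)).imp
      (measurableSet_coordinate_regular hw.inv i)
  -- on the stratum of `B`, particle `i` is inside `Ω` iff `i ∈ B`
  by_cases hi : i ∈ B
  · have hglue : ∀ᵐ x ∂(Measure.pi fun _ : {i // i ∉ B} => surfaceMeasure Ω),
        ∀ᵐ y ∂(Measure.pi fun _ : {i // i ∈ B} => interiorMeasure Ω),
          ENNReal.ofReal (ϱ (glue B y x)) = w (glue B y x) ∧ 0 < ϱ (glue B y x) := by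
      have h1 := ae_glue_of_ae_baseMeasure hΩ (hϱw.and hϱ) B
      rw [← Measure.prod_swap] at h1
      exact Measure.ae_ae_of_ae_prod (ae_of_ae_map measurable_swap.aemeasurable h1)
    have hmem : ∀ᵐ y ∂(Measure.pi fun _ : {i // i ∈ B} => interiorMeasure Ω),
        ∀ j, (y j : EuclideanSpace ℝ (Fin d)) ∈ Ω := by
      rw [ae_all_iff]
      exact fun j => (Measure.quasiMeasurePreserving_eval (fun _ : {i // i ∈ B} =>
        interiorMeasure Ω) j).ae (ae_interiorMeasure_mem hΩ)
    have h2 := ae_prod_section_regular (ν := interiorMeasure Ω)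
      (τ := Measure.pi fun _ : {i // i ∉ B} => surfaceMeasure Ω)
      (q := fun p : ({i // i ∈ B} → closure Ω) × ({i // i ∉ B} → closure Ω) =>
        (w (glue B p.1 p.2))⁻¹) ((hw.comp (measurePreserving_glue hΩ B).measurable).inv) ⟨i, hi⟩ ?_
    · filter_upwards [h2] with p hp _
      have hpi : glue B p.1 p.2 i = p.1 ⟨i, hi⟩ := by simp [glue, hi]
      simp only [glue_update_left] at hp
      rwa [hpi]
    filter_upwards [hglue, hH B ⟨i, hi⟩] with x h3 h4
    filter_upwards [h3, h4, hmem] with y h5 h6 h7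
    -- as `ϱ` is positive, the Hamza condition says that almost every point is regular
    have h8 : y ∈ regInterior Ω ϱ B x := by
      by_contra hn
      exact h5.2.ne' (h6 h7 hn)
    obtain ⟨-, ε, hε, hfin⟩ := h8
    refine ⟨ε, hε, lt_of_le_of_lt (le_of_eq ?_) hfin⟩
    have hset : (Metric.ball y ε : Set ({i // i ∈ B} → closure Ω))
        =ᵐ[Measure.pi fun _ : {i // i ∈ B} => interiorMeasure Ω]
        {z | (∀ i, (z i : EuclideanSpace ℝ (Fin d)) ∈ Ω) ∧ dist z y < ε} := by
      filter_upwards [hmem] with z hz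
      exact propext ⟨fun h => ⟨hz, h⟩, fun h => h.2⟩
    rw [setLIntegral_congr hset]
    refine lintegral_congr_ae (ae_restrict_of_ae ?_)
    filter_upwards [h3] with z hz
    rw [hz.1]
  · have hmem : ∀ᵐ y ∂(Measure.pi fun _ : {i // i ∉ B} => surfaceMeasure Ω),
        ∀ j, (y j : EuclideanSpace ℝ (Fin d)) ∈ frontier Ω := by
      rw [ae_all_iff]
      exact fun j => (Measure.quasiMeasurePreserving_eval (fun _ : {i // i ∉ B} =>
        surfaceMeasure Ω) j).ae (ae_surfaceMeasure_mem)
    filter_upwards [Measure.quasiMeasurePreserving_snd.ae hmem] with p hp hmemi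
    have hpi : glue B p.1 p.2 i = p.2 ⟨i, hi⟩ := by simp [glue, hi]
    rw [hpi] at hmemi
    exact absurd hmemi ((mem_frontier_iff_notMem hΩ _).1 (hp ⟨i, hi⟩))

/-- The Hamza condition on the boundary, reduced to one particle. -/
lemma HamzaBoundary.ae_regular (hΩ : IsOpen Ω) (hH : HamzaBoundary Ω ϱ) (hw : Measurable w)
    (hϱw : ∀ᵐ x ∂(baseMeasure Ω N), ENNReal.ofReal (ϱ x) = w x)
    (hϱ : ∀ᵐ x ∂(baseMeasure Ω N), 0 < ϱ x) :
    ∀ᵐ x ∂(baseMeasure Ω N), ∀ i, (x i : EuclideanSpace ℝ (Fin d)) ∈ frontier Ω →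
      ∃ ε : ℝ, 0 < ε ∧
      ∫⁻ z in Metric.ball (x i) ε, (w (Function.update x i z))⁻¹ ∂(surfaceMeasure Ω) < ∞ := by
  classical
  rw [ae_all_iff]
  intro i
  refine ae_baseMeasure_of_glue hΩ ?_ fun B => ?_
  · exact ((isClosed_frontier.measurableSet.preimage measurable_subtype_coe).preimage
      (measurable_pi_apply i)).imp (measurableSet_coordinate_regular hw.inv i)
  have hmem : ∀ᵐ y ∂(Measure.pi fun _ : {i // i ∉ B} => surfaceMeasure Ω),
      ∀ j, (y j : EuclideanSpace ℝ (Fin d)) ∈ frontier Ω := by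
    rw [ae_all_iff]
    exact fun j => (Measure.quasiMeasurePreserving_eval (fun _ : {i // i ∉ B} =>
      surfaceMeasure Ω) j).ae (ae_surfaceMeasure_mem)
  -- on the stratum of `B`, particle `i` is on the boundary iff `i ∉ B`
  by_cases hi : i ∈ B
  · have hmem' : ∀ᵐ y ∂(Measure.pi fun _ : {i // i ∈ B} => interiorMeasure Ω),
        ∀ j, (y j : EuclideanSpace ℝ (Fin d)) ∈ Ω := by
      rw [ae_all_iff]
      exact fun j => (Measure.quasiMeasurePreserving_eval (fun _ : {i // i ∈ B} =>
        interiorMeasure Ω) j).ae (ae_interiorMeasure_mem hΩ)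
    filter_upwards [Measure.quasiMeasurePreserving_fst.ae hmem'] with p hp hmemi
    have hpi : glue B p.1 p.2 i = p.1 ⟨i, hi⟩ := by simp [glue, hi]
    rw [hpi] at hmemi
    exact absurd (hp ⟨i, hi⟩) ((mem_frontier_iff_notMem hΩ _).1 hmemi)
  · have hglue : ∀ᵐ y ∂(Measure.pi fun _ : {i // i ∈ B} => interiorMeasure Ω),
        ∀ᵐ x ∂(Measure.pi fun _ : {i // i ∉ B} => surfaceMeasure Ω),
          ENNReal.ofReal (ϱ (glue B y x)) = w (glue B y x) ∧ 0 < ϱ (glue B y x) :=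
      Measure.ae_ae_of_ae_prod (ae_glue_of_ae_baseMeasure hΩ (hϱw.and hϱ) B)
    have h2 := ae_prod_section_regular (ν := surfaceMeasure Ω)
      (τ := Measure.pi fun _ : {i // i ∈ B} => interiorMeasure Ω)
      (q := fun p : ({i // i ∉ B} → closure Ω) × ({i // i ∈ B} → closure Ω) =>
        (w (glue B p.2 p.1))⁻¹)
      ((hw.comp ((measurePreserving_glue hΩ B).measurable.comp measurable_swap)).inv) ⟨i, hi⟩ ?_
    · rw [← Measure.prod_swap] at h2
      filter_upwards [ae_of_ae_map measurable_swap.aemeasurable h2] with p hp _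
      have hpi : glue B p.1 p.2 i = p.2 ⟨i, hi⟩ := by simp [glue, hi]
      simp only [glue_update_right, Prod.fst_swap, Prod.snd_swap] at hp
      rwa [hpi]
    have hB : B ≠ Finset.univ := fun h => hi (h ▸ Finset.mem_univ i)
    filter_upwards [hglue, hH B hB] with y h3 h4
    filter_upwards [h3, h4, hmem] with x h5 h6 h7
    -- as `ϱ` is positive, the Hamza condition says that almost every point is regular
    have h8 : x ∈ regBoundary Ω ϱ B y := by
      by_contra hn
      exact h5.2.ne' (h6 h7 hn)
    obtain ⟨-, ε, hε, hfin⟩ := h8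
    refine ⟨ε, hε, lt_of_le_of_lt (le_of_eq ?_) hfin⟩
    have hset : (Metric.ball x ε : Set ({i // i ∉ B} → closure Ω))
        =ᵐ[Measure.pi fun _ : {i // i ∉ B} => surfaceMeasure Ω]
        {z | (∀ i, (z i : EuclideanSpace ℝ (Fin d)) ∈ frontier Ω) ∧ dist z x < ε} := by
      filter_upwards [hmem] with z hz
      exact propext ⟨fun h => ⟨hz, h⟩, fun h => h.2⟩
    rw [setLIntegral_congr hset]
    refine lintegral_congr_ae (ae_restrict_of_ae ?_)
    filter_upwards [h3] with z hz
    rw [hz.1]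

end Config

/-! ### Closability of weighted gradients along a chart -/

section Slice

/-- The Cauchy–Schwarz inequality for `f = (f q^{1/2}) q^{-1/2}`. -/
lemma lintegral_le_sqrt_mul_sqrt {α : Type*} [MeasurableSpace α] {μ : Measure α} {f q : α → ℝ≥0∞}
    (hf : AEMeasurable f μ) (hq : AEMeasurable q μ) (hq0 : ∀ᵐ x ∂μ, q x ≠ 0)
    (hqt : ∀ᵐ x ∂μ, q x ≠ ∞) :
    ∫⁻ x, f x ∂μ ≤ (∫⁻ x, f x ^ 2 * q x ∂μ) ^ (1 / 2 : ℝ) * (∫⁻ x, (q x)⁻¹ ∂μ) ^ (1 / 2 : ℝ) := by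
  have h := ENNReal.lintegral_mul_le_Lp_mul_Lq μ Real.HolderConjugate.two_two
    (f := fun x => f x * q x ^ (1 / 2 : ℝ)) (g := fun x => (q x)⁻¹ ^ (1 / 2 : ℝ))
    (hf.mul (hq.pow_const _)) (hq.inv.pow_const _)
  have h1 : ∀ᵐ x ∂μ, f x = ((fun x => f x * q x ^ (1 / 2 : ℝ)) *
      fun x => (q x)⁻¹ ^ (1 / 2 : ℝ)) x := by
    filter_upwards [hq0, hqt] with x h0 ht
    rw [Pi.mul_apply, mul_assoc, ← ENNReal.mul_rpow_of_nonneg _ _ (by norm_num),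
      ENNReal.mul_inv_cancel h0 ht, ENNReal.one_rpow, mul_one]
  rw [lintegral_congr_ae h1]
  refine h.trans (le_of_eq ?_)
  congr 2
  · refine lintegral_congr fun x => ?_
    rw [ENNReal.mul_rpow_of_nonneg _ _ (by norm_num), ← ENNReal.rpow_mul]
    norm_num
  · refine lintegral_congr fun x => ?_
    rw [← ENNReal.rpow_mul]
    norm_num

/-- If `q⁻¹` is integrable, then convergence in `L²(q μ)` implies convergence in `L¹(μ)`. -/
lemma tendsto_lintegral_of_weighted {α : Type*} [MeasurableSpace α] {μ : Measure α}
    {f : ℕ → α → ℝ≥0∞} {q : α → ℝ≥0∞} (hf : ∀ k, AEMeasurable (f k) μ) (hq : AEMeasurable q μ)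
    (hq0 : ∀ᵐ x ∂μ, q x ≠ 0) (hqt : ∀ᵐ x ∂μ, q x ≠ ∞) (hfin : ∫⁻ x, (q x)⁻¹ ∂μ ≠ ∞)
    (h : Tendsto (fun k => ∫⁻ x, f k x ^ 2 * q x ∂μ) atTop (𝓝 0)) :
    Tendsto (fun k => ∫⁻ x, f k x ∂μ) atTop (𝓝 0) := by
  have h1 : Tendsto (fun k => (∫⁻ x, f k x ^ 2 * q x ∂μ) ^ (1 / 2 : ℝ) *
      (∫⁻ x, (q x)⁻¹ ∂μ) ^ (1 / 2 : ℝ)) atTop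
      (𝓝 ((0 : ℝ≥0∞) ^ (1 / 2 : ℝ) * (∫⁻ x, (q x)⁻¹ ∂μ) ^ (1 / 2 : ℝ))) :=
    ENNReal.Tendsto.mul_const ((ENNReal.continuous_rpow_const.tendsto 0).comp h)
      (Or.inr (ENNReal.rpow_ne_top_of_nonneg (by norm_num) hfin))
  rw [ENNReal.zero_rpow_of_pos (by norm_num), zero_mul] at h1
  exact tendsto_of_tendsto_of_tendsto_of_le_of_le tendsto_const_nhds h1 (fun _ => bot_le)
    fun k => lintegral_le_sqrt_mul_sqrt (hf k) hq hq0 hqt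

variable {E' : Type*} [NormedAddCommGroup E'] [NormedSpace ℝ E'] [FiniteDimensional ℝ E']
  [MeasurableSpace E'] [BorelSpace E'] (vol : Measure E') [vol.IsAddHaarMeasure]

/-- Closability of a directional derivative with respect to a weight `q` whose inverse is
integrable: integrate by parts against test functions. -/
lemma ae_eq_zero_of_tendsto_lineDeriv {T : Set E'} (hT : IsOpen T) (hTfin : vol T ≠ ∞)
    {q : E' → ℝ≥0∞} (hq : AEMeasurable q (vol.restrict T))
    (hq0 : ∀ᵐ t ∂(vol.restrict T), q t ≠ 0)
    (hqt : ∀ᵐ t ∂(vol.restrict T), q t ≠ ∞) (hqint : ∫⁻ t in T, (q t)⁻¹ ∂vol ≠ ∞)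
    {u : ℕ → E' → ℝ} {C : ℕ → NNReal} (hu : ∀ k, LipschitzWith (C k) (u k)) (a : E')
    {p : E' → ℝ} (hp : AEStronglyMeasurable p (vol.restrict T))
    (h1 : Tendsto (fun k => ∫⁻ t in T, ‖u k t‖ₑ ^ 2 * q t ∂vol) atTop (𝓝 0))
    (h2 : Tendsto (fun k => ∫⁻ t in T, ‖lineDeriv ℝ (u k) t a - p t‖ₑ ^ 2 * q t ∂vol) atTop
      (𝓝 0)) :
    ∀ᵐ t ∂(vol.restrict T), p t = 0 := by
  have : IsFiniteMeasure (vol.restrict T) := ⟨by simpa using hTfin.lt_top⟩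
  have hD : ∀ k, Integrable (fun t => lineDeriv ℝ (u k) t a) (vol.restrict T) := fun k =>
    ((hu k).memLp_lineDeriv (μ := vol) a).restrict T |>.integrable le_top
  have hL1 := tendsto_lintegral_of_weighted (μ := vol.restrict T) (f := fun k t => ‖u k t‖ₑ)
    (fun k => (hu k).continuous.aestronglyMeasurable.enorm) hq hq0 hqt hqint h1
  have hL2 := tendsto_lintegral_of_weighted (μ := vol.restrict T)
    (f := fun k t => ‖lineDeriv ℝ (u k) t a - p t‖ₑ)
    (fun k => ((hD k).aestronglyMeasurable.sub hp).enorm) hq hq0 hqt hqint h2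
  have hpint : IntegrableOn p T vol := by
    obtain ⟨k, hk⟩ := (hL2.eventually (gt_mem_nhds (zero_lt_one))).exists
    have h3 : Integrable (fun t => lineDeriv ℝ (u k) t a - p t) (vol.restrict T) :=
      ⟨(hD k).aestronglyMeasurable.sub hp, hk.trans ENNReal.one_lt_top⟩
    refine ((hD k).sub h3).congr (Eventually.of_forall fun t => ?_)
    simp
  rw [ae_restrict_iff' hT.measurableSet]
  refine hT.ae_eq_zero_of_integral_contDiff_smul_eq_zero hpint.locallyIntegrableOn ?_
  intro g hg hgc hgT
  obtain ⟨M, hM⟩ := hg.continuous.bounded_above_of_compact_support hgc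
  have hM0 : 0 ≤ M := (norm_nonneg _).trans (hM 0)
  obtain ⟨D, hDg⟩ := ContDiff.lipschitzWith_of_hasCompactSupport hgc hg (by simp)
  have hbd : ∀ t, ‖lineDeriv ℝ g t (-a)‖ ≤ D * ‖(-a)‖ := fun t =>
    norm_lineDeriv_le_of_lipschitz ℝ hDg
  have hzero : ∀ t, t ∉ T → g t = 0 := fun t ht =>
    image_eq_zero_of_notMem_tsupport fun h => ht (hgT h)
  have hzero' : ∀ t, t ∉ T → lineDeriv ℝ g t (-a) = 0 := fun t ht => by
    have h0 : t ∉ tsupport g := fun h => ht (hgT h)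
    have hev : g =ᶠ[𝓝 t] fun _ => 0 := notMem_tsupport_iff_eventuallyEq.1 h0
    rw [hev.lineDeriv_eq]
    simp [lineDeriv]
  have hlim : ∀ {v : ℕ → E' → ℝ} {p' : E' → ℝ} {ζ : E' → ℝ} {M' : ℝ},
      (∀ k, Integrable (v k) (vol.restrict T)) → Integrable p' (vol.restrict T) →
      AEStronglyMeasurable ζ (vol.restrict T) → 0 ≤ M' → (∀ t, ‖ζ t‖ ≤ M') →
      Tendsto (fun k => ∫⁻ t in T, ‖v k t - p' t‖ₑ ∂vol) atTop (𝓝 0) →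
      Tendsto (fun k => ∫ t in T, ζ t * v k t ∂vol) atTop (𝓝 (∫ t in T, ζ t * p' t ∂vol)) := by
    intro v p' ζ M' hv hp' hζ hM' hζM hlim
    refine tendsto_integral_of_L1 _ (hp'.bdd_mul hζ (Eventually.of_forall hζM)).aestronglyMeasurable
      (Eventually.of_forall fun k => (hv k).bdd_mul hζ (Eventually.of_forall hζM)) ?_
    have h3 : Tendsto (fun k => ENNReal.ofReal M' * ∫⁻ t in T, ‖v k t - p' t‖ₑ ∂vol) atTop
        (𝓝 (ENNReal.ofReal M' * 0)) := ENNReal.Tendsto.const_mul hlim (Or.inr ENNReal.ofReal_ne_top)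
    rw [mul_zero] at h3
    refine tendsto_of_tendsto_of_tendsto_of_le_of_le tendsto_const_nhds h3 (fun _ => bot_le)
      fun k => ?_
    rw [← lintegral_const_mul' _ _ ENNReal.ofReal_ne_top]
    refine lintegral_mono fun t => ?_
    rw [← mul_sub, enorm_mul]
    gcongr
    rw [← ofReal_norm]
    exact ENNReal.ofReal_le_ofReal (hζM t)
  have hA := hlim hD hpint hg.continuous.aestronglyMeasurable hM0 hM hL2
  have hB : Tendsto (fun k => ∫ t in T, lineDeriv ℝ g t (-a) * u k t ∂vol) atTop (𝓝 0) := by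
    rw [tendsto_zero_iff_norm_tendsto_zero]
    have h3 : Tendsto (fun k => (ENNReal.ofReal (D * ‖(-a)‖) * ∫⁻ t in T, ‖u k t‖ₑ ∂vol).toReal)
        atTop (𝓝 (ENNReal.ofReal (D * ‖(-a)‖) * 0).toReal) :=
      (ENNReal.tendsto_toReal (by simp)).comp
        (ENNReal.Tendsto.const_mul hL1 (Or.inr ENNReal.ofReal_ne_top))
    rw [mul_zero, ENNReal.toReal_zero] at h3
    refine squeeze_zero' (Eventually.of_forall fun _ => norm_nonneg _) ?_ h3
    filter_upwards [hL1.eventually (gt_mem_nhds (zero_lt_one))] with k hk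
    have h4 : ‖∫ t in T, lineDeriv ℝ g t (-a) * u k t ∂vol‖ₑ
        ≤ ENNReal.ofReal (D * ‖(-a)‖) * ∫⁻ t in T, ‖u k t‖ₑ ∂vol := by
      refine (enorm_integral_le_lintegral_enorm _).trans ?_
      rw [← lintegral_const_mul' _ _ ENNReal.ofReal_ne_top]
      refine lintegral_mono fun t => ?_
      rw [enorm_mul]
      gcongr
      rw [← ofReal_norm]
      exact ENNReal.ofReal_le_ofReal (hbd t)
    rw [← toReal_enorm]
    exact ENNReal.toReal_mono
      (ENNReal.mul_ne_top ENNReal.ofReal_ne_top (hk.trans ENNReal.one_lt_top).ne) h4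
  have hAB : ∀ k, ∫ t in T, g t * lineDeriv ℝ (u k) t a ∂vol
      = ∫ t in T, lineDeriv ℝ g t (-a) * u k t ∂vol := fun k => by
    rw [setIntegral_eq_integral_of_forall_compl_eq_zero fun t ht => by rw [hzero t ht, zero_mul],
      setIntegral_eq_integral_of_forall_compl_eq_zero fun t ht => by rw [hzero' t ht, zero_mul],
      ← (hu k).integral_lineDeriv_mul_eq hDg hgc a]
    simp_rw [mul_comm]
  have h5 := tendsto_nhds_unique (hA.congr hAB) hB
  rw [setIntegral_eq_integral_of_forall_compl_eq_zero fun t ht => by rw [hzero t ht, zero_mul]]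
    at h5
  simpa using h5

end Slice

section Chart

variable {E' : Type*} [NormedAddCommGroup E'] [NormedSpace ℝ E'] [FiniteDimensional ℝ E']
  [MeasurableSpace E'] [BorelSpace E'] (vol : Measure E') [vol.IsAddHaarMeasure]
  {F : Type*} [NormedAddCommGroup F] [InnerProductSpace ℝ F] [FiniteDimensional ℝ F]
  [MeasurableSpace F] [BorelSpace F]

/-- Closability of the gradient `Q ∇g` along the image of a Lipschitz chart `ψ`, where `Q t` is the
orthogonal projection on the tangent space `range ψ'(t)`. The derivatives of `g ∘ ψ` are the inner
products of `Q ∇g` with tangent vectors, so a limit `h` of `Q ∇g` is orthogonal to the tangent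
space; since `Q ∇g` is tangent, `‖h‖ ≤ ‖Q ∇g - h‖`, and the right side tends to `0`. -/
lemma ae_eq_zero_of_tendsto_gradient {T : Set E'} (hT : IsOpen T) (hTfin : vol T ≠ ∞)
    {q : E' → ℝ≥0∞} (hq : AEMeasurable q (vol.restrict T))
    (hq0 : ∀ᵐ t ∂(vol.restrict T), q t ≠ 0)
    (hqt : ∀ᵐ t ∂(vol.restrict T), q t ≠ ∞) (hqint : ∫⁻ t in T, (q t)⁻¹ ∂vol ≠ ∞)
    {ψ : E' → F} {L : NNReal} (hψ : LipschitzWith L ψ) {g : ℕ → F → ℝ}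
    (hg : ∀ k, ContDiff ℝ 1 (g k)) (hgc : ∀ k, HasCompactSupport (g k))
    {Q : E' → F → F} {h : E' → F} (hh : AEStronglyMeasurable h (vol.restrict T))
    (hQ : ∀ᵐ t ∂(vol.restrict T), ∀ z, Q t z ∈ LinearMap.range (fderiv ℝ ψ t : E' →ₗ[ℝ] F) ∧
      ∀ a, ⟪z - Q t z, fderiv ℝ ψ t a⟫_ℝ = 0)
    (h1 : Tendsto (fun k => ∫⁻ t in T, ‖g k (ψ t)‖ₑ ^ 2 * q t ∂vol) atTop (𝓝 0))
    (h2 : Tendsto (fun k => ∫⁻ t in T, ‖Q t (gradient (g k) (ψ t)) - h t‖ₑ ^ 2 * q t ∂vol) atTop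
      (𝓝 0)) :
    ∀ᵐ t ∂(vol.restrict T), h t = 0 := by
  have hdiff : ∀ᵐ t ∂(vol.restrict T), DifferentiableAt ℝ ψ t :=
    ae_restrict_of_ae hψ.ae_differentiableAt
  have hperp : ∀ a : E', ∀ᵐ t ∂(vol.restrict T), ⟪h t, fderiv ℝ ψ t a⟫_ℝ = 0 := by
    intro a
    choose C hC using fun k => ContDiff.lipschitzWith_of_hasCompactSupport (hgc k) (hg k) (by simp)
    refine ae_eq_zero_of_tendsto_lineDeriv vol hT hTfin hq hq0 hqt hqint
      (u := fun k => g k ∘ ψ) (fun k => (hC k).comp hψ) a ?_ h1 ?_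
    · exact hh.inner (measurable_fderiv_apply_const ℝ ψ a).aestronglyMeasurable
    · have h3 : Tendsto (fun k => ENNReal.ofReal (L * ‖a‖) ^ 2 *
          ∫⁻ t in T, ‖Q t (gradient (g k) (ψ t)) - h t‖ₑ ^ 2 * q t ∂vol) atTop
          (𝓝 (ENNReal.ofReal (L * ‖a‖) ^ 2 * 0)) :=
        ENNReal.Tendsto.const_mul h2 (Or.inr (ENNReal.pow_ne_top ENNReal.ofReal_ne_top))
      rw [mul_zero] at h3
      refine tendsto_of_tendsto_of_tendsto_of_le_of_le tendsto_const_nhds h3 (fun _ => bot_le)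
        fun k => ?_
      rw [← lintegral_const_mul' _ _ (ENNReal.pow_ne_top ENNReal.ofReal_ne_top)]
      refine lintegral_mono_ae ?_
      filter_upwards [hdiff, hQ] with t ht hQt
      have hgd : DifferentiableAt ℝ (g k) (ψ t) := (hg k).differentiable (by simp) _
      have h4 : lineDeriv ℝ (g k ∘ ψ) t a = ⟪gradient (g k) (ψ t), fderiv ℝ ψ t a⟫_ℝ := by
        rw [(hgd.comp t ht).lineDeriv_eq_fderiv, fderiv_comp t hgd ht, gradient]
        simp
      have h5 : lineDeriv ℝ (g k ∘ ψ) t a - ⟪h t, fderiv ℝ ψ t a⟫_ℝ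
          = ⟪Q t (gradient (g k) (ψ t)) - h t, fderiv ℝ ψ t a⟫_ℝ := by
        have h6 := (hQt (gradient (g k) (ψ t))).2 a
        rw [inner_sub_left] at h6 ⊢
        rw [h4]
        linarith
      rw [h5, ← mul_assoc, ← mul_pow]
      gcongr
      rw [← ofReal_norm, ← ofReal_norm, ← ENNReal.ofReal_mul (by positivity)]
      refine ENNReal.ofReal_le_ofReal ((norm_inner_le_norm _ _).trans ?_)
      rw [mul_comm]
      gcongr
      exact (ContinuousLinearMap.le_opNorm _ _).trans
        (mul_le_mul_of_nonneg_right (norm_fderiv_le_of_lipschitz ℝ hψ) (norm_nonneg _))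
  have hperp' : ∀ᵐ t ∂(vol.restrict T), ∀ a, ⟪h t, fderiv ℝ ψ t a⟫_ℝ = 0 := by
    set b := Module.finBasis ℝ E'
    have h3 : ∀ᵐ t ∂(vol.restrict T), ∀ i, ⟪h t, fderiv ℝ ψ t (b i)⟫_ℝ = 0 := by
      rw [ae_all_iff]
      exact fun i => hperp (b i)
    filter_upwards [h3] with t ht a
    have : ((innerₗ F (h t)).comp (fderiv ℝ ψ t : E' →ₗ[ℝ] F)) = 0 :=
      b.ext fun i => by simpa using ht i
    simpa using LinearMap.congr_fun this a
  have hle : ∀ k, ∫⁻ t in T, ‖h t‖ₑ ^ 2 * q t ∂vol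
      ≤ ∫⁻ t in T, ‖Q t (gradient (g k) (ψ t)) - h t‖ₑ ^ 2 * q t ∂vol := fun k => by
    refine lintegral_mono_ae ?_
    filter_upwards [hperp', hQ] with t ht hQt
    gcongr
    rw [← ofReal_norm, ← ofReal_norm]
    refine ENNReal.ofReal_le_ofReal ?_
    obtain ⟨a, ha⟩ := (hQt (gradient (g k) (ψ t))).1
    have h0 : ⟪h t, Q t (gradient (g k) (ψ t))⟫_ℝ = 0 := by
      rw [← ha]
      exact ht a
    refine le_of_sq_le_sq ?_ (norm_nonneg _)
    rw [norm_sub_sq_real, real_inner_comm, h0]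
    nlinarith [sq_nonneg ‖Q t (gradient (g k) (ψ t))‖]
  have hz : ∫⁻ t in T, ‖h t‖ₑ ^ 2 * q t ∂vol = 0 :=
    le_antisymm (ge_of_tendsto' h2 hle) bot_le
  replace hz := (lintegral_eq_zero_iff' (f := fun t => ‖h t‖ₑ ^ 2 * q t)
    ((hh.enorm.pow_const 2).mul hq)).1 hz
  filter_upwards [hz, hq0] with t ht h0
  have h3 : ‖h t‖ₑ ^ 2 * q t = 0 := ht
  simpa [h0] using h3

/-- The same for a measure `μ₀` on the image of the chart which dominates the image of Lebesgue
measure and has the same null sets. -/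
lemma ae_eq_zero_of_tendsto_gradient_of_chart {T : Set E'} (hT : IsOpen T) (hTfin : vol T ≠ ∞)
    {ψ : E' → F} {L : NNReal} (hψ : LipschitzWith L ψ) {μ₀ : Measure F}
    (hle : (vol.restrict T).map ψ ≤ μ₀) (hac : μ₀ ≪ (vol.restrict T).map ψ)
    {q : F → ℝ≥0∞} (hq : Measurable q) (hq0 : ∀ y, q y ≠ 0) (hqt : ∀ y, q y ≠ ∞)
    (hqint : ∫⁻ y, (q y)⁻¹ ∂μ₀ ≠ ∞)
    {g : ℕ → F → ℝ} (hg : ∀ k, ContDiff ℝ 1 (g k)) (hgc : ∀ k, HasCompactSupport (g k))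
    {Q : F → F → F} {h : F → F} (hh : Measurable h)
    (hmeas : ∀ k, AEMeasurable (fun y => Q y (gradient (g k) y)) μ₀)
    (hQ : ∀ᵐ t ∂(vol.restrict T), ∀ z, Q (ψ t) z ∈ LinearMap.range (fderiv ℝ ψ t : E' →ₗ[ℝ] F) ∧
      ∀ a, ⟪z - Q (ψ t) z, fderiv ℝ ψ t a⟫_ℝ = 0)
    (h1 : Tendsto (fun k => ∫⁻ y, ‖g k y‖ₑ ^ 2 * q y ∂μ₀) atTop (𝓝 0))
    (h2 : Tendsto (fun k => ∫⁻ y, ‖Q y (gradient (g k) y) - h y‖ₑ ^ 2 * q y ∂μ₀) atTop (𝓝 0)) :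
    ∀ᵐ y ∂μ₀, h y = 0 := by
  have hψm : Measurable ψ := hψ.continuous.measurable
  have htrans : ∀ {f : F → ℝ≥0∞}, AEMeasurable f μ₀ →
      ∫⁻ t in T, f (ψ t) ∂vol ≤ ∫⁻ y, f y ∂μ₀ := fun {f} hf => by
    rw [← lintegral_map' (hf.mono_measure hle) hψm.aemeasurable]
    exact lintegral_mono' hle le_rfl
  have hsqueeze : ∀ {f : ℕ → F → ℝ≥0∞}, (∀ k, AEMeasurable (f k) μ₀) →
      Tendsto (fun k => ∫⁻ y, f k y ∂μ₀) atTop (𝓝 0) →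
      Tendsto (fun k => ∫⁻ t in T, f k (ψ t) ∂vol) atTop (𝓝 0) := fun hf hlim =>
    tendsto_of_tendsto_of_tendsto_of_le_of_le tendsto_const_nhds hlim (fun _ => bot_le)
      fun k => htrans (hf k)
  have h3 := ae_eq_zero_of_tendsto_gradient vol hT hTfin (q := q ∘ ψ)
    (hq.comp hψm).aemeasurable (Eventually.of_forall fun _ => hq0 _)
    (Eventually.of_forall fun _ => hqt _)
    ((htrans (f := fun y => (q y)⁻¹) hq.inv.aemeasurable).trans_lt hqint.lt_top).ne hψ hg hgc
    (Q := fun t => Q (ψ t)) (h := h ∘ ψ) (hh.comp hψm).aestronglyMeasurable hQ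
    (hsqueeze (f := fun k y => ‖g k y‖ₑ ^ 2 * q y)
      (fun k => (((hg k).continuous.measurable.enorm.pow_const 2).mul hq).aemeasurable) h1)
    (hsqueeze (f := fun k y => ‖Q y (gradient (g k) y) - h y‖ₑ ^ 2 * q y)
      (fun k => ((((hmeas k).sub hh.aemeasurable).enorm.pow_const 2).mul hq.aemeasurable)) h2)
  exact hac.ae_le ((ae_map_iff hψm.aemeasurable (p := fun y => h y = 0)
    (hh (measurableSet_singleton 0))).2 h3)

end Chart

/-! ### Lipschitz graphs: surface measure and normals -/

section Hausdorff

lemma LipschitzWith.euclideanHausdorffMeasure_image_le {X Y : Type*} [MetricSpace X]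
    [MetricSpace Y] [MeasurableSpace X] [BorelSpace X] [MeasurableSpace Y] [BorelSpace Y]
    {f : X → Y} {K : NNReal} (hf : LipschitzWith K f) (n : ℕ) (s : Set X) :
    (Measure.euclideanHausdorffMeasure n : Measure Y) (f '' s)
      ≤ (K : ℝ≥0∞) ^ n * (Measure.euclideanHausdorffMeasure n : Measure X) s := by
  rw [Measure.euclideanHausdorffMeasure_def, Measure.euclideanHausdorffMeasure_def,
    Measure.smul_apply, Measure.smul_apply, ENNReal.smul_def, ENNReal.smul_def, smul_eq_mul,
    smul_eq_mul, mul_left_comm]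
  gcongr
  simpa using hf.hausdorffMeasure_image_le (d := (n : ℝ)) (by positivity) s

end Hausdorff

section Chart

variable {d : ℕ} {Ω : Set (EuclideanSpace ℝ (Fin d))}

/-- Inside the ball with centre `x` and radius `r`, the set `Ω` is the region below the graph of `φ`
in the direction `e`, and its boundary is the graph. -/
structure IsGraphNear (Ω : Set (EuclideanSpace ℝ (Fin d))) (x e : EuclideanSpace ℝ (Fin d))
    (φ : (ℝ ∙ e)ᗮ → ℝ) (K : NNReal) (r : ℝ) : Prop where
  norm_eq : ‖e‖ = 1
  lipschitz : LipschitzWith K φ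
  pos : 0 < r
  mem_iff : ∀ y ∈ Metric.ball x r,
    (y ∈ Ω ↔ ⟪e, y⟫_ℝ < φ ((ℝ ∙ e)ᗮ.orthogonalProjectionOnto y))
  mem_frontier_iff : ∀ y ∈ Metric.ball x r,
    (y ∈ frontier Ω ↔ ⟪e, y⟫_ℝ = φ ((ℝ ∙ e)ᗮ.orthogonalProjectionOnto y))

lemma HasLipschitzBoundary.exists_isGraphNear (h : HasLipschitzBoundary Ω)
    {x : EuclideanSpace ℝ (Fin d)} (hx : x ∈ frontier Ω) :
    ∃ e φ K r, IsGraphNear Ω x e φ K r := by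
  obtain ⟨e, φ, K, r, h1, h2, h3, h4⟩ := h x hx
  exact ⟨e, φ, K, r, h1, h2, h3, fun y hy => (h4 y hy).1, fun y hy => (h4 y hy).2⟩

/-- The parametrization `t ↦ t + φ(t) e` of the graph of `φ`. -/
def graphMap (e : EuclideanSpace ℝ (Fin d)) (φ : (ℝ ∙ e)ᗮ → ℝ) (t : (ℝ ∙ e)ᗮ) :
    EuclideanSpace ℝ (Fin d) := t + φ t • e

variable {x e : EuclideanSpace ℝ (Fin d)} {φ : (ℝ ∙ e)ᗮ → ℝ} {K : NNReal} {r : ℝ}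

lemma inner_coe_orthogonal (t : (ℝ ∙ e)ᗮ) : ⟪e, (t : EuclideanSpace ℝ (Fin d))⟫_ℝ = 0 :=
  Submodule.mem_orthogonal_singleton_iff_inner_right.1 t.2

lemma orthogonalProjectionOnto_self : (ℝ ∙ e)ᗮ.orthogonalProjectionOnto e = 0 := by
  rw [Submodule.orthogonalProjectionOnto_eq_zero_iff]
  exact Submodule.le_orthogonal_orthogonal _ (Submodule.mem_span_singleton_self e)

lemma eq_projection_add (he : ‖e‖ = 1) (y : EuclideanSpace ℝ (Fin d)) :
    y = (ℝ ∙ e)ᗮ.orthogonalProjectionOnto y + ⟪e, y⟫_ℝ • e := by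
  have h1 : (((ℝ ∙ e)ᗮ.orthogonalProjectionOnto y : (ℝ ∙ e)ᗮ) : EuclideanSpace ℝ (Fin d))
      = y - (ℝ ∙ e).orthogonalProjectionOnto y := by
    rw [Submodule.orthogonalProjectionOnto_orthogonal]
    rfl
  rw [h1, Submodule.coe_orthogonalProjectionOnto_apply,
    Submodule.starProjection_unit_singleton ℝ he]
  abel

lemma projection_graphMap (t : (ℝ ∙ e)ᗮ) :
    (ℝ ∙ e)ᗮ.orthogonalProjectionOnto (graphMap e φ t) = t := by
  rw [graphMap, map_add, map_smul, orthogonalProjectionOnto_self, smul_zero, add_zero,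
    Submodule.orthogonalProjectionOnto_mem_subspace_eq_self]

lemma inner_graphMap (he : ‖e‖ = 1) (t : (ℝ ∙ e)ᗮ) : ⟪e, graphMap e φ t⟫_ℝ = φ t := by
  rw [graphMap, inner_add_right, inner_coe_orthogonal, inner_smul_right,
    real_inner_self_eq_norm_sq, he]
  ring

lemma lipschitzWith_projection :
    LipschitzWith 1 ((ℝ ∙ e)ᗮ.orthogonalProjectionOnto : EuclideanSpace ℝ (Fin d) → (ℝ ∙ e)ᗮ) :=
  ContinuousLinearMap.lipschitzWith_of_opNorm_le (Submodule.orthogonalProjectionOnto_norm_le _)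

lemma volume_graphMap_preimage_ball_ne_top :
    (volume : Measure (ℝ ∙ e)ᗮ) (graphMap e φ ⁻¹' Metric.ball x r) ≠ ∞ := by
  refine ((measure_mono ?_).trans_lt (measure_ball_lt_top
    (x := (ℝ ∙ e)ᗮ.orthogonalProjectionOnto x) (r := r))).ne
  intro t ht
  have h1 := lipschitzWith_projection (e := e).dist_le_mul (graphMap e φ t) x
  rw [projection_graphMap, NNReal.coe_one, one_mul] at h1
  exact lt_of_le_of_lt h1 ht

lemma hasFDerivAt_graphMap {t : (ℝ ∙ e)ᗮ} (hφ : DifferentiableAt ℝ φ t) :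
    HasFDerivAt (graphMap e φ) ((ℝ ∙ e)ᗮ.subtypeL + (fderiv ℝ φ t).smulRight e) t :=
  (ℝ ∙ e)ᗮ.subtypeL.hasFDerivAt.add (hφ.hasFDerivAt.smul_const e)

namespace IsGraphNear

variable (h : IsGraphNear Ω x e φ K r)
include h

lemma lipschitz_graphMap : LipschitzWith (1 + K) (graphMap e φ) := by
  refine LipschitzWith.of_dist_le_mul fun s t => ?_
  rw [dist_eq_norm, graphMap, graphMap]
  have h1 : (s : EuclideanSpace ℝ (Fin d)) + φ s • e - (t + φ t • e)
      = ((s - t : (ℝ ∙ e)ᗮ) : EuclideanSpace ℝ (Fin d)) + (φ s - φ t) • e := by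
    rw [Submodule.coe_sub, sub_smul]
    abel
  rw [h1]
  refine (norm_add_le _ _).trans ?_
  rw [norm_smul, h.norm_eq, mul_one, ← dist_eq_norm, NNReal.coe_add, NNReal.coe_one, add_mul,
    one_mul]
  refine add_le_add (le_of_eq ?_) ?_
  · rw [dist_eq_norm, Submodule.coe_norm]
  · exact h.lipschitz.dist_le_mul s t

lemma isOpen_preimage_ball : IsOpen (graphMap e φ ⁻¹' Metric.ball x r) :=
  Metric.isOpen_ball.preimage h.lipschitz_graphMap.continuous

lemma graphMap_projection {y : EuclideanSpace ℝ (Fin d)} (hy : y ∈ Metric.ball x r)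
    (hyΩ : y ∈ frontier Ω) : graphMap e φ ((ℝ ∙ e)ᗮ.orthogonalProjectionOnto y) = y := by
  conv_rhs => rw [eq_projection_add h.norm_eq y]
  rw [graphMap, (h.mem_frontier_iff y hy).1 hyΩ]

lemma graphMap_mem_frontier {t : (ℝ ∙ e)ᗮ} (ht : graphMap e φ t ∈ Metric.ball x r) :
    graphMap e φ t ∈ frontier Ω := by
  rw [h.mem_frontier_iff _ ht, inner_graphMap h.norm_eq, projection_graphMap]

lemma euclideanHausdorffMeasure_eq_volume :
    (Measure.euclideanHausdorffMeasure (d - 1) : Measure (ℝ ∙ e)ᗮ) = volume := by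
  have he : e ≠ 0 := fun h0 => by simpa [h0] using h.norm_eq
  have hd : 0 < d := by
    rcases Nat.eq_zero_or_pos d with rfl | hd
    · exact absurd (Subsingleton.elim e 0) he
    · exact hd
  have : Fact (Module.finrank ℝ (EuclideanSpace ℝ (Fin d)) = (d - 1) + 1) :=
    ⟨by rw [finrank_euclideanSpace_fin]; omega⟩
  rw [← InnerProductSpace.euclideanHausdorffMeasure_eq_volume,
    Submodule.finrank_orthogonal_span_singleton (n := d - 1) he]

/-- Surface measure dominates the image of Lebesgue measure, as the projection is a contraction. -/
lemma map_graphMap_le :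
    ((volume : Measure (ℝ ∙ e)ᗮ).restrict (graphMap e φ ⁻¹' Metric.ball x r)).map (graphMap e φ) ≤
      ((Measure.euclideanHausdorffMeasure (d - 1) : Measure (EuclideanSpace ℝ (Fin d))).restrict
        (frontier Ω)).restrict (Metric.ball x r) := by
  refine Measure.le_iff.2 fun A hA => ?_
  have hm := h.lipschitz_graphMap.continuous.measurable
  rw [Measure.map_apply hm hA, Measure.restrict_apply (hm hA), Measure.restrict_apply hA,
    Measure.restrict_apply (hA.inter measurableSet_ball)]
  have h1 : graphMap e φ ⁻¹' A ∩ graphMap e φ ⁻¹' Metric.ball x r ⊆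
      (ℝ ∙ e)ᗮ.orthogonalProjectionOnto '' (A ∩ Metric.ball x r ∩ frontier Ω) := fun t ht =>
    ⟨graphMap e φ t, ⟨ht, h.graphMap_mem_frontier ht.2⟩, projection_graphMap t⟩
  refine (measure_mono h1).trans ?_
  rw [← h.euclideanHausdorffMeasure_eq_volume]
  simpa using (lipschitzWith_projection (e := e)).euclideanHausdorffMeasure_image_le (d - 1)
    (A ∩ Metric.ball x r ∩ frontier Ω)

lemma hausdorffMeasure_image_le (S : Set (ℝ ∙ e)ᗮ) :
    (Measure.euclideanHausdorffMeasure (d - 1) : Measure (EuclideanSpace ℝ (Fin d)))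
      (graphMap e φ '' S) ≤ ((1 + K : NNReal) : ℝ≥0∞) ^ (d - 1) * volume S := by
  rw [← h.euclideanHausdorffMeasure_eq_volume]
  exact h.lipschitz_graphMap.euclideanHausdorffMeasure_image_le (d - 1) S

/-- A property that holds almost everywhere in the chart holds almost everywhere on the boundary. -/
lemma ae_of_ae_graphMap {P : EuclideanSpace ℝ (Fin d) → Prop}
    (hP : ∀ᵐ t ∂((volume : Measure (ℝ ∙ e)ᗮ).restrict (graphMap e φ ⁻¹' Metric.ball x r)),
      P (graphMap e φ t)) :
    ∀ᵐ y ∂(((Measure.euclideanHausdorffMeasure (d - 1) :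
      Measure (EuclideanSpace ℝ (Fin d))).restrict (frontier Ω)).restrict (Metric.ball x r)),
      P y := by
  rw [ae_restrict_iff' h.isOpen_preimage_ball.measurableSet, ae_iff] at hP
  rw [ae_restrict_iff' measurableSet_ball, ae_restrict_iff' isClosed_frontier.measurableSet, ae_iff]
  have h1 := h.hausdorffMeasure_image_le
    {t | ¬(t ∈ graphMap e φ ⁻¹' Metric.ball x r → P (graphMap e φ t))}
  rw [hP, mul_zero] at h1
  refine measure_mono_null ?_ (le_antisymm h1 bot_le)
  intro y hy
  simp only [mem_ofPred_eq, Classical.not_imp] at hy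
  refine ⟨(ℝ ∙ e)ᗮ.orthogonalProjectionOnto y, ?_, h.graphMap_projection hy.2.1 hy.1⟩
  rw [mem_ofPred_eq, mem_preimage, h.graphMap_projection hy.2.1 hy.1, Classical.not_imp]
  exact hy.2

lemma absolutelyContinuous_map_graphMap :
    ((Measure.euclideanHausdorffMeasure (d - 1) : Measure (EuclideanSpace ℝ (Fin d))).restrict
        (frontier Ω)).restrict (Metric.ball x r) ≪
    ((volume : Measure (ℝ ∙ e)ᗮ).restrict (graphMap e φ ⁻¹' Metric.ball x r)).map
      (graphMap e φ) := by
  intro A hA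
  have h1 := h.ae_of_ae_graphMap (P := fun y => y ∉ A)
    (ae_of_ae_map h.lipschitz_graphMap.continuous.measurable.aemeasurable
      (measure_eq_zero_iff_ae_notMem.1 hA))
  exact measure_eq_zero_iff_ae_notMem.2 h1

lemma measure_ball_lt_top :
    ((Measure.euclideanHausdorffMeasure (d - 1) : Measure (EuclideanSpace ℝ (Fin d))).restrict
        (frontier Ω)) (Metric.ball x r) < ∞ := by
  rw [Measure.restrict_apply measurableSet_ball]
  have h1 : Metric.ball x r ∩ frontier Ω ⊆ graphMap e φ '' (graphMap e φ ⁻¹' Metric.ball x r) := by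
    rintro y ⟨hy, hyΩ⟩
    refine ⟨(ℝ ∙ e)ᗮ.orthogonalProjectionOnto y, ?_, h.graphMap_projection hy hyΩ⟩
    rwa [mem_preimage, h.graphMap_projection hy hyΩ]
  refine (measure_mono h1).trans_lt ((h.hausdorffMeasure_image_le _).trans_lt ?_)
  exact ENNReal.mul_lt_top (by simp) volume_graphMap_preimage_ball_ne_top.lt_top

end IsGraphNear

lemma IsOutwardNormal.unique {x ν ν' : EuclideanSpace ℝ (Fin d)} (h : IsOutwardNormal Ω x ν)
    (h' : IsOutwardNormal Ω x ν') : ν = ν' := by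
  by_contra hne
  -- in the direction `w` the two normals disagree on which side of the boundary is `Ω`
  set w := ν' - ν with hw
  have hw0 : 0 < ‖w‖ := norm_pos_iff.2 (sub_ne_zero.2 (Ne.symm hne))
  have hlt : ⟪ν, ν'⟫_ℝ < 1 := by
    have h1 : ‖w‖ ^ 2 = 2 - 2 * ⟪ν, ν'⟫_ℝ := by
      rw [hw, norm_sub_sq_real, h.1, h'.1, real_inner_comm]
      ring
    nlinarith [pow_pos hw0 2]
  set ε := (1 - ⟪ν, ν'⟫_ℝ) / (2 * ‖w‖) with hε
  have hε0 : 0 < ε := div_pos (by linarith) (by linarith)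
  have hεw : ε * ‖w‖ = (1 - ⟪ν, ν'⟫_ℝ) / 2 := by
    rw [hε]
    field_simp
  obtain ⟨r, hr, h1⟩ := h.2 ε hε0
  obtain ⟨r', hr', h2⟩ := h'.2 ε hε0
  set s := min r r' / (2 * ‖w‖) with hs
  have hs0 : 0 < s := div_pos (lt_min hr hr') (by linarith)
  have hsw : s * ‖w‖ = min r r' / 2 := by
    rw [hs]
    field_simp
  have hmin := lt_min hr hr'
  have hdist : dist (x + s • w) x < min r r' := by
    rw [dist_eq_norm, add_sub_cancel_left, norm_smul, Real.norm_eq_abs, abs_of_pos hs0, hsw]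
    linarith
  have hnorm : ‖s • w‖ = s * ‖w‖ := by rw [norm_smul, Real.norm_eq_abs, abs_of_pos hs0]
  have hin := (h1 (x + s • w) (lt_of_lt_of_le hdist (min_le_left _ _))).1 (by
    rw [add_sub_cancel_left, hnorm, inner_smul_right, hw, inner_sub_right,
      real_inner_self_eq_norm_sq, h.1]
    nlinarith)
  refine (h2 (x + s • w) (lt_of_lt_of_le hdist (min_le_right _ _))).2 ?_ hin
  rw [add_sub_cancel_left, hnorm, inner_smul_right, hw, inner_sub_right,
    real_inner_self_eq_norm_sq, h'.1, real_inner_comm]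
  nlinarith

lemma IsOutwardNormal.outwardNormal_eq {x ν : EuclideanSpace ℝ (Fin d)}
    (h : IsOutwardNormal Ω x ν) : outwardNormal Ω x = ν := by
  have hex : ∃ ν, IsOutwardNormal Ω x ν := ⟨ν, h⟩
  rw [outwardNormal, dif_pos hex]
  exact hex.choose_spec.unique h

/-- The vector `e - ∇φ`, normal to the graph of `φ`. -/
def graphConormal (e : EuclideanSpace ℝ (Fin d)) (φ : (ℝ ∙ e)ᗮ → ℝ) (t : (ℝ ∙ e)ᗮ) :
    EuclideanSpace ℝ (Fin d) := e - gradient φ t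

lemma inner_graphConormal (t : (ℝ ∙ e)ᗮ) (y : EuclideanSpace ℝ (Fin d)) :
    ⟪graphConormal e φ t, y⟫_ℝ
      = ⟪e, y⟫_ℝ - fderiv ℝ φ t ((ℝ ∙ e)ᗮ.orthogonalProjectionOnto y) := by
  rw [graphConormal, inner_sub_left]
  congr 1
  rw [← inner_gradient_left, ← Submodule.inner_orthogonalProjectionOnto_eq_of_mem_left]

lemma graphConormal_ne_zero (he : ‖e‖ = 1) (t : (ℝ ∙ e)ᗮ) : graphConormal e φ t ≠ 0 := by
  intro h0
  have h1 := inner_graphConormal (φ := φ) t e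
  rw [h0, inner_zero_left, orthogonalProjectionOnto_self, map_zero, real_inner_self_eq_norm_sq,
    he] at h1
  norm_num at h1

lemma measurable_graphConormal : Measurable (graphConormal e φ) := by
  refine measurable_const.sub (measurable_subtype_coe.comp ?_)
  exact (LinearIsometryEquiv.continuous _).measurable.comp (measurable_fderiv ℝ φ)

namespace IsGraphNear

variable (h : IsGraphNear Ω x e φ K r)
include h

/-- At points of differentiability of `φ`, the graph has the normal `e - ∇φ`, up to
normalization. -/
lemma isOutwardNormal {t : (ℝ ∙ e)ᗮ} (ht : graphMap e φ t ∈ Metric.ball x r)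
    (hφ : DifferentiableAt ℝ φ t) :
    IsOutwardNormal Ω (graphMap e φ t) (‖graphConormal e φ t‖⁻¹ • graphConormal e φ t) := by
  set n := graphConormal e φ t with hn
  have hn0 : 0 < ‖n‖ := norm_pos_iff.2 (graphConormal_ne_zero h.norm_eq t)
  refine ⟨by rw [norm_smul, norm_inv, norm_norm, inv_mul_cancel₀ hn0.ne'], fun ε hε => ?_⟩
  have hlit := hφ.hasFDerivAt.isLittleO.def (c := ‖n‖ * ε) (by positivity)
  have hpt : Tendsto (fun y => (ℝ ∙ e)ᗮ.orthogonalProjectionOnto y) (𝓝 (graphMap e φ t)) (𝓝 t) := by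
    have := (ContinuousLinearMap.continuous (ℝ ∙ e)ᗮ.orthogonalProjectionOnto).tendsto
      (graphMap e φ t)
    rwa [projection_graphMap] at this
  obtain ⟨ρ, hρ, hball⟩ := Metric.eventually_nhds_iff_ball.1
    ((hpt.eventually hlit).and (Metric.isOpen_ball.mem_nhds ht))
  refine ⟨ρ, hρ, fun y hy => ?_⟩
  obtain ⟨hrem, hyB⟩ := hball y hy
  set y₀ := graphMap e φ t with hy₀
  set s := (ℝ ∙ e)ᗮ.orthogonalProjectionOnto y with hs
  have hst : ‖s - t‖ ≤ ‖y - y₀‖ := by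
    have := (lipschitzWith_projection (e := e)).dist_le_mul y y₀
    rwa [hy₀, projection_graphMap, NNReal.coe_one, one_mul, dist_eq_norm, dist_eq_norm] at this
  have hproj : (ℝ ∙ e)ᗮ.orthogonalProjectionOnto (y - y₀) = s - t := by
    rw [map_sub, hy₀, projection_graphMap]
  have hinner : ⟪n, y - y₀⟫_ℝ = ⟪e, y⟫_ℝ - φ t - fderiv ℝ φ t (s - t) := by
    rw [hn, inner_graphConormal, hproj, inner_sub_right, hy₀, inner_graphMap h.norm_eq]
  have hrem' : |φ s - φ t - fderiv ℝ φ t (s - t)| ≤ ‖n‖ * ε * ‖y - y₀‖ :=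
    hrem.trans (mul_le_mul_of_nonneg_left hst (by positivity))
  have hν : ⟪‖n‖⁻¹ • n, y - y₀⟫_ℝ = ‖n‖⁻¹ * ⟪n, y - y₀⟫_ℝ := by
    rw [real_inner_smul_left]
  rw [hν, h.mem_iff y hyB]
  have hmul : ‖n‖ * (‖n‖⁻¹ * ⟪n, y - y₀⟫_ℝ) = ⟪n, y - y₀⟫_ℝ := mul_inv_cancel_left₀ hn0.ne' _
  rw [abs_le] at hrem'
  constructor
  · intro hlt
    have := mul_lt_mul_of_pos_left hlt hn0
    rw [hmul] at this
    linarith [hrem'.1]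
  · intro hlt
    have := mul_lt_mul_of_pos_left hlt hn0
    rw [hmul] at this
    rw [not_lt]
    linarith [hrem'.2]

/-- The tangential projection is the orthogonal projection on the tangent space of the graph. -/
lemma tangentProj_graphMap {t : (ℝ ∙ e)ᗮ} (ht : graphMap e φ t ∈ Metric.ball x r)
    (hφ : DifferentiableAt ℝ φ t) (z : EuclideanSpace ℝ (Fin d)) :
    tangentProj Ω (graphMap e φ t) z ∈
      LinearMap.range (fderiv ℝ (graphMap e φ) t : (ℝ ∙ e)ᗮ →ₗ[ℝ] EuclideanSpace ℝ (Fin d)) ∧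
    ∀ a, ⟪z - tangentProj Ω (graphMap e φ t) z, fderiv ℝ (graphMap e φ) t a⟫_ℝ = 0 := by
  have hnormal := h.isOutwardNormal ht hφ
  have hder := (hasFDerivAt_graphMap hφ).fderiv
  set n := graphConormal e φ t with hn
  have hn0 : 0 < ‖n‖ := norm_pos_iff.2 (graphConormal_ne_zero h.norm_eq t)
  rw [tangentProj, hnormal.outwardNormal_eq, hder]
  have hperp : ∀ a : (ℝ ∙ e)ᗮ, ⟪n, ((ℝ ∙ e)ᗮ.subtypeL + (fderiv ℝ φ t).smulRight e) a⟫_ℝ = 0 := by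
    intro a
    have h1 : ((ℝ ∙ e)ᗮ.subtypeL + (fderiv ℝ φ t).smulRight e) a
        = (a : EuclideanSpace ℝ (Fin d)) + fderiv ℝ φ t a • e := rfl
    rw [h1, hn, inner_graphConormal, map_add, map_smul, orthogonalProjectionOnto_self, smul_zero,
      add_zero, Submodule.orthogonalProjectionOnto_mem_subspace_eq_self, inner_add_right,
      inner_coe_orthogonal, inner_smul_right, real_inner_self_eq_norm_sq, h.norm_eq]
    ring
  constructor
  · set p := z - ⟪‖n‖⁻¹ • n, z⟫_ℝ • ‖n‖⁻¹ • n with hp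
    have hnp : ⟪n, p⟫_ℝ = 0 := by
      rw [hp, inner_sub_right, inner_smul_right, inner_smul_right, real_inner_smul_left,
        real_inner_self_eq_norm_sq]
      field_simp
      ring
    refine ⟨(ℝ ∙ e)ᗮ.orthogonalProjectionOnto p, ?_⟩
    have h1 : ⟪e, p⟫_ℝ = fderiv ℝ φ t ((ℝ ∙ e)ᗮ.orthogonalProjectionOnto p) := by
      rw [hn, inner_graphConormal] at hnp
      linarith
    conv_rhs => rw [eq_projection_add h.norm_eq p, h1]
    rfl
  · intro a
    rw [sub_sub_cancel, real_inner_smul_left, real_inner_smul_left, real_inner_smul_left, hperp a]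
    ring

lemma ae_tangentProj_graphMap :
    ∀ᵐ t ∂((volume : Measure (ℝ ∙ e)ᗮ).restrict (graphMap e φ ⁻¹' Metric.ball x r)),
    ∀ z, tangentProj Ω (graphMap e φ t) z ∈
      LinearMap.range (fderiv ℝ (graphMap e φ) t : (ℝ ∙ e)ᗮ →ₗ[ℝ] EuclideanSpace ℝ (Fin d)) ∧
    ∀ a, ⟪z - tangentProj Ω (graphMap e φ t) z, fderiv ℝ (graphMap e φ) t a⟫_ℝ = 0 := by
  rw [ae_restrict_iff' h.isOpen_preimage_ball.measurableSet]
  filter_upwards [h.lipschitz.ae_differentiableAt (μ := volume)] with t ht htB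
  exact h.tangentProj_graphMap htB ht

lemma aemeasurable_outwardNormal :
    AEMeasurable (outwardNormal Ω) (((Measure.euclideanHausdorffMeasure (d - 1) :
      Measure (EuclideanSpace ℝ (Fin d))).restrict (frontier Ω)).restrict (Metric.ball x r)) := by
  have hm : Measurable fun y : EuclideanSpace ℝ (Fin d) =>
      ‖graphConormal e φ ((ℝ ∙ e)ᗮ.orthogonalProjectionOnto y)‖⁻¹ •
        graphConormal e φ ((ℝ ∙ e)ᗮ.orthogonalProjectionOnto y) := by
    have h1 := (measurable_graphConormal (φ := φ)).comp
      (ContinuousLinearMap.measurable (ℝ ∙ e)ᗮ.orthogonalProjectionOnto)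
    exact h1.norm.inv.smul h1
  refine ⟨_, hm, h.ae_of_ae_graphMap ?_⟩
  rw [ae_restrict_iff' h.isOpen_preimage_ball.measurableSet]
  filter_upwards [h.lipschitz.ae_differentiableAt (μ := volume)] with t ht htB
  rw [projection_graphMap]
  exact (h.isOutwardNormal htB ht).outwardNormal_eq

end IsGraphNear

section Boundary

variable (hlip : HasLipschitzBoundary Ω) (hbdd : Bornology.IsBounded Ω)
include hlip hbdd

lemma isFiniteMeasure_hausdorff_frontier :
    IsFiniteMeasure ((Measure.euclideanHausdorffMeasure (d - 1) :
      Measure (EuclideanSpace ℝ (Fin d))).restrict (frontier Ω)) := by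
  have hcomp : IsCompact (frontier Ω) := hbdd.isCompact_closure.of_isClosed_subset isClosed_frontier
    frontier_subset_closure
  have h1 : ((Measure.euclideanHausdorffMeasure (d - 1) :
      Measure (EuclideanSpace ℝ (Fin d))).restrict (frontier Ω)) (frontier Ω) < ∞ := by
    refine hcomp.measure_lt_top_of_nhdsWithin fun x hx => ?_
    obtain ⟨e, φ, K, r, h⟩ := hlip.exists_isGraphNear hx
    exact ⟨_, mem_nhdsWithin_of_mem_nhds (Metric.ball_mem_nhds x h.pos), h.measure_ball_lt_top⟩
  constructor
  rwa [Measure.restrict_apply MeasurableSet.univ, univ_inter, ← Measure.restrict_apply_self]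

lemma aemeasurable_outwardNormal :
    AEMeasurable (outwardNormal Ω) ((Measure.euclideanHausdorffMeasure (d - 1) :
      Measure (EuclideanSpace ℝ (Fin d))).restrict (frontier Ω)) := by
  have hcomp : IsCompact (frontier Ω) := hbdd.isCompact_closure.of_isClosed_subset isClosed_frontier
    frontier_subset_closure
  choose! e φ K r h using fun (x : EuclideanSpace ℝ (Fin d)) (hx : x ∈ frontier Ω) =>
    hlip.exists_isGraphNear hx
  obtain ⟨s, hs, hcover⟩ := hcomp.elim_nhds_subcover (fun x => Metric.ball x (r x))
    fun x hx => Metric.ball_mem_nhds x (h x hx).pos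
  have h1 : AEMeasurable (outwardNormal Ω) (((Measure.euclideanHausdorffMeasure (d - 1) :
      Measure (EuclideanSpace ℝ (Fin d))).restrict (frontier Ω)).restrict
      (⋃ x : s, Metric.ball (x : EuclideanSpace ℝ (Fin d)) (r x))) :=
    aemeasurable_iUnion_iff.2 fun x => (h x (hs x x.2)).aemeasurable_outwardNormal
  refine h1.mono_measure (le_of_eq ?_)
  refine (Measure.restrict_eq_self_of_ae_mem ?_).symm
  filter_upwards [ae_restrict_mem isClosed_frontier.measurableSet] with y hy
  have := hcover hy
  rw [mem_iUnion₂] at this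
  obtain ⟨x, hx, hy⟩ := this
  exact mem_iUnion.2 ⟨⟨x, hx⟩, hy⟩

end Boundary

end Chart

/-! ### Closability for one particle -/

section OneParticle

lemma continuous_gradient_of_contDiff {F : Type*} [NormedAddCommGroup F]
    [InnerProductSpace ℝ F] [CompleteSpace F] {g : F → ℝ} (hg : ContDiff ℝ 1 g) :
    Continuous (gradient g) :=
  (LinearIsometryEquiv.continuous _).comp (hg.continuous_fderiv (by simp))

variable {F : Type*} [NormedAddCommGroup F] [InnerProductSpace ℝ F] [FiniteDimensional ℝ F]
  [MeasurableSpace F] [BorelSpace F]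

/-- Closability of the operator `g ↦ Q ∇g`, where `Q` is a field of projections, in `L²(q μ₀)` for
every weight `q` whose inverse is integrable. -/
def IsGradientClosable (μ₀ : Measure F) (Q : F → F → F) : Prop :=
  ∀ q : F → ℝ≥0∞, Measurable q → (∀ y, q y ≠ 0) → (∀ y, q y ≠ ∞) → ∫⁻ y, (q y)⁻¹ ∂μ₀ ≠ ∞ →
  ∀ g : ℕ → F → ℝ, (∀ k, ContDiff ℝ 1 (g k)) → (∀ k, HasCompactSupport (g k)) →
  ∀ h : F → F, Measurable h →
  Tendsto (fun k => ∫⁻ y, ‖g k y‖ₑ ^ 2 * q y ∂μ₀) atTop (𝓝 0) →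
  Tendsto (fun k => ∫⁻ y, ‖Q y (gradient (g k) y) - h y‖ₑ ^ 2 * q y ∂μ₀) atTop (𝓝 0) →
  ∀ᵐ y ∂μ₀, h y = 0

variable {d : ℕ} {Ω : Set (EuclideanSpace ℝ (Fin d))}

lemma isGradientClosable_volume (hΩ : IsOpen Ω) (y : EuclideanSpace ℝ (Fin d)) (r : ℝ) :
    IsGradientClosable (((volume : Measure (EuclideanSpace ℝ (Fin d))).restrict Ω).restrict
      (Metric.ball y r)) (fun _ z => z) := by
  intro q hq hq0 hqt hqint g hg hgc h hh h1 h2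
  rw [Measure.restrict_restrict measurableSet_ball] at *
  refine ae_eq_zero_of_tendsto_gradient_of_chart volume (T := Metric.ball y r ∩ Ω)
    (Metric.isOpen_ball.inter hΩ)
    ((measure_mono inter_subset_left).trans_lt measure_ball_lt_top).ne
    (ψ := id) LipschitzWith.id (by rw [Measure.map_id]) (by rw [Measure.map_id])
    hq hq0 hqt hqint hg hgc (Q := fun _ z => z) hh
    (fun k => (continuous_gradient_of_contDiff (hg k)).measurable.aemeasurable) ?_ h1 h2
  refine Eventually.of_forall fun t z => ⟨⟨z, ?_⟩, fun a => ?_⟩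
  · simp
  · simp

lemma IsGraphNear.mono {x e : EuclideanSpace ℝ (Fin d)} {φ : (ℝ ∙ e)ᗮ → ℝ} {K : NNReal} {r r' : ℝ}
    (h : IsGraphNear Ω x e φ K r) (hr' : 0 < r') (hle : r' ≤ r) : IsGraphNear Ω x e φ K r' where
  norm_eq := h.norm_eq
  lipschitz := h.lipschitz
  pos := hr'
  mem_iff y hy := h.mem_iff y (Metric.ball_subset_ball hle hy)
  mem_frontier_iff y hy := h.mem_frontier_iff y (Metric.ball_subset_ball hle hy)

lemma aemeasurable_tangentProj {μ₀ : Measure (EuclideanSpace ℝ (Fin d))}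
    (hn : AEMeasurable (outwardNormal Ω) μ₀)
    {v : EuclideanSpace ℝ (Fin d) → EuclideanSpace ℝ (Fin d)} (hv : AEMeasurable v μ₀) :
    AEMeasurable (fun y => tangentProj Ω y (v y)) μ₀ :=
  hv.sub (AEMeasurable.smul (hn.inner (𝕜 := ℝ) hv) hn)

lemma IsGraphNear.isGradientClosable {x e : EuclideanSpace ℝ (Fin d)} {φ : (ℝ ∙ e)ᗮ → ℝ}
    {K : NNReal} {r : ℝ} (hg : IsGraphNear Ω x e φ K r) :
    IsGradientClosable (((Measure.euclideanHausdorffMeasure (d - 1) :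
      Measure (EuclideanSpace ℝ (Fin d))).restrict (frontier Ω)).restrict (Metric.ball x r))
      (tangentProj Ω) := by
  intro q hq hq0 hqt hqint g hgd hgc h hh h1 h2
  exact ae_eq_zero_of_tendsto_gradient_of_chart volume hg.isOpen_preimage_ball
    volume_graphMap_preimage_ball_ne_top hg.lipschitz_graphMap hg.map_graphMap_le
    hg.absolutelyContinuous_map_graphMap hq hq0 hqt hqint hgd hgc (Q := tangentProj Ω) hh
    (fun k => aemeasurable_tangentProj hg.aemeasurable_outwardNormal
      (continuous_gradient_of_contDiff (hgd k)).measurable.aemeasurable)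
    hg.ae_tangentProj_graphMap h1 h2

/-- A cutoff function makes functions compactly supported without changing them near `closure Ω`. -/
lemma exists_cutoff (hbdd : Bornology.IsBounded Ω) :
    ∃ χ : EuclideanSpace ℝ (Fin d) → ℝ, ContDiff ℝ 1 χ ∧ HasCompactSupport χ ∧
      ∀ y ∈ closure Ω, χ =ᶠ[𝓝 y] 1 := by
  obtain ⟨R, hR⟩ := hbdd.subset_closedBall 0
  have hRpos : 0 < |R| + 1 := by positivity
  let b : ContDiffBump (0 : EuclideanSpace ℝ (Fin d)) := ⟨|R| + 1, |R| + 2, hRpos, by linarith⟩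
  refine ⟨b, b.contDiff, b.hasCompactSupport, fun y hy => ?_⟩
  refine b.eventuallyEq_one_of_mem_ball ?_
  have h1 := (closure_minimal hR Metric.isClosed_closedBall) hy
  rw [mem_closedBall_zero_iff] at h1
  rw [mem_ball_zero_iff]
  have h2 : b.rIn = |R| + 1 := rfl
  linarith [le_abs_self R]

/-- Closability for one particle. The position space `closure Ω` carries a measure `μ₀` such that
the projected gradient `Q ∇` is closable in small balls around the points of a set `S` of full
measure. -/
lemma ae_eq_zero_of_locally_closable (hbdd : Bornology.IsBounded Ω)
    {μ₀ : Measure (EuclideanSpace ℝ (Fin d))} (hμ₀ : ∀ᵐ y ∂μ₀, y ∈ closure Ω)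
    {Q : EuclideanSpace ℝ (Fin d) → EuclideanSpace ℝ (Fin d) → EuclideanSpace ℝ (Fin d)}
    {S : Set (EuclideanSpace ℝ (Fin d))}
    (hS : ∀ᵐ z : closure Ω ∂(Measure.comap Subtype.val μ₀), (z : EuclideanSpace ℝ (Fin d)) ∈ S)
    (hQ : ∀ y ∈ S, ∀ ε : ℝ, 0 < ε → ∃ r : ℝ, 0 < r ∧ r ≤ ε ∧
      IsGradientClosable (μ₀.restrict (Metric.ball y r)) Q)
    {q : closure Ω → ℝ≥0∞} (hq : Measurable q) (hq0 : ∀ z, q z ≠ 0) (hqt : ∀ z, q z ≠ ∞)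
    (hreg : ∀ᵐ z ∂(Measure.comap Subtype.val μ₀), ∃ ε : ℝ, 0 < ε ∧
      ∫⁻ y in Metric.ball z ε, (q y)⁻¹ ∂(Measure.comap Subtype.val μ₀) < ∞)
    {g : ℕ → EuclideanSpace ℝ (Fin d) → ℝ} (hg : ∀ k, ContDiff ℝ 1 (g k))
    {h : closure Ω → EuclideanSpace ℝ (Fin d)} (hh : Measurable h)
    (h1 : Tendsto (fun k => ∫⁻ z : closure Ω, ‖g k z‖ₑ ^ 2 * q z ∂(Measure.comap Subtype.val μ₀))
      atTop (𝓝 0))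
    (h2 : Tendsto (fun k => ∫⁻ z : closure Ω, ‖Q z (gradient (g k) z) - h z‖ₑ ^ 2 * q z
      ∂(Measure.comap Subtype.val μ₀)) atTop (𝓝 0)) :
    ∀ᵐ z ∂(Measure.comap Subtype.val μ₀ : Measure (closure Ω)), h z = 0 := by
  set κ : Measure (closure Ω) := Measure.comap Subtype.val μ₀ with hκ
  have hemb := measurableEmbedding_coe_closure (Ω := Ω)
  have hmap : κ.map Subtype.val = μ₀ := by
    rw [hκ, hemb.map_comap, Subtype.range_coe, Measure.restrict_eq_self_of_ae_mem hμ₀]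
  obtain ⟨χ, hχ, hχc, hχ1⟩ := exists_cutoff hbdd
  have hloc : ∀ᵐ z : closure Ω ∂κ, (z : EuclideanSpace ℝ (Fin d)) ∈ S ∧ (∃ ε : ℝ, 0 < ε ∧
      ∫⁻ y in Metric.ball z ε, (q y)⁻¹ ∂κ < ∞) → h z = 0 := by
    rw [ae_iff]
    refine measure_null_of_locally_null _ fun z₀ hz₀ => ?_
    simp only [mem_ofPred_eq, Classical.not_imp] at hz₀
    obtain ⟨⟨hz₀S, ε, hε, hfin⟩, -⟩ := hz₀
    obtain ⟨r, hr, hrε, hclos⟩ := hQ _ hz₀S ε hε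
    -- a measurable retraction of the whole space on `closure Ω` extends functions
    obtain ⟨ρ, hρ, hρval⟩ := hemb.exists_measurable_extend (g := id) measurable_id fun _ => ⟨z₀⟩
    have hρz : ∀ z : closure Ω, ρ z = z := fun z => congrFun hρval z
    have hball : μ₀.restrict (Metric.ball (z₀ : EuclideanSpace ℝ (Fin d)) r)
        = (κ.restrict (Metric.ball z₀ r)).map Subtype.val := by
      rw [← hmap, hemb.restrict_map]
      rfl
    have hint : ∀ f : EuclideanSpace ℝ (Fin d) → ℝ≥0∞,
        ∫⁻ y, f y ∂(μ₀.restrict (Metric.ball (z₀ : EuclideanSpace ℝ (Fin d)) r))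
          = ∫⁻ z in Metric.ball z₀ r, f z ∂κ := fun f => by
      rw [hball, hemb.lintegral_map]
    have hsqueeze : ∀ {f : ℕ → closure Ω → ℝ≥0∞},
        Tendsto (fun k => ∫⁻ z, f k z ∂κ) atTop (𝓝 0) →
        Tendsto (fun k => ∫⁻ z in Metric.ball z₀ r, f k z ∂κ) atTop (𝓝 0) := fun hf =>
      tendsto_of_tendsto_of_tendsto_of_le_of_le tendsto_const_nhds hf (fun _ => bot_le)
        fun k => setLIntegral_le_lintegral _ _
    have h3 := hclos (q ∘ ρ) (hq.comp hρ) (fun y => hq0 _) (fun y => hqt _) (by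
        rw [hint]
        simp only [Function.comp_apply, hρz]
        exact ((lintegral_mono_set (Metric.ball_subset_ball hrε)).trans_lt hfin).ne)
      (fun k => χ * g k) (fun k => hχ.mul (hg k)) (fun k => hχc.mul_right) (h ∘ ρ) (hh.comp hρ)
      (by
        simp only [hint, Function.comp_apply, hρz, Pi.mul_apply]
        refine (hsqueeze h1).congr fun k => lintegral_congr fun z => ?_
        rw [(hχ1 z z.2).eq_of_nhds, Pi.one_apply, one_mul])
      (by
        simp only [hint, Function.comp_apply, hρz]
        refine (hsqueeze h2).congr fun k => lintegral_congr fun z => ?_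
        have h4 : χ * g k =ᶠ[𝓝 (z : EuclideanSpace ℝ (Fin d))] g k := by
          filter_upwards [hχ1 z z.2] with y hy
          rw [Pi.mul_apply, hy, Pi.one_apply, one_mul]
        rw [gradient, gradient, h4.fderiv_eq])
    rw [hball] at h3
    have h4 := ae_of_ae_map measurable_subtype_coe.aemeasurable h3
    simp only [Function.comp_apply, hρz] at h4
    rw [ae_restrict_iff' measurableSet_ball, ae_iff] at h4
    refine ⟨_, inter_mem_nhdsWithin _ (Metric.ball_mem_nhds z₀ hr), measure_mono_null ?_ h4⟩
    rintro z ⟨hz1, hz2⟩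
    simp only [mem_ofPred_eq, Classical.not_imp] at hz1 ⊢
    exact ⟨hz2, hz1.2⟩
  filter_upwards [hloc, hS, hreg] with z h3 h4 h5
  exact h3 ⟨h4, h5⟩

lemma ae_eq_zero_interior (hΩ : IsOpen Ω) (hbdd : Bornology.IsBounded Ω)
    {q : closure Ω → ℝ≥0∞} (hq : Measurable q) (hq0 : ∀ z, q z ≠ 0) (hqt : ∀ z, q z ≠ ∞)
    (hreg : ∀ᵐ z ∂(interiorMeasure Ω), ∃ ε : ℝ, 0 < ε ∧
      ∫⁻ y in Metric.ball z ε, (q y)⁻¹ ∂(interiorMeasure Ω) < ∞)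
    {g : ℕ → EuclideanSpace ℝ (Fin d) → ℝ} (hg : ∀ k, ContDiff ℝ 1 (g k))
    {h : closure Ω → EuclideanSpace ℝ (Fin d)} (hh : Measurable h)
    (h1 : Tendsto (fun k => ∫⁻ z : closure Ω, ‖g k z‖ₑ ^ 2 * q z ∂(interiorMeasure Ω))
      atTop (𝓝 0))
    (h2 : Tendsto (fun k => ∫⁻ z : closure Ω, ‖gradient (g k) z - h z‖ₑ ^ 2 * q z
      ∂(interiorMeasure Ω)) atTop (𝓝 0)) :
    ∀ᵐ z ∂(interiorMeasure Ω), h z = 0 :=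
  ae_eq_zero_of_locally_closable hbdd
    ((ae_restrict_mem hΩ.measurableSet).mono fun _ hy => subset_closure hy)
    (Q := fun _ z => z) (S := Ω) (ae_interiorMeasure_mem hΩ)
    (fun y _ ε hε => ⟨ε, hε, le_rfl, isGradientClosable_volume hΩ y ε⟩) hq hq0 hqt hreg hg hh h1 h2

lemma ae_eq_zero_boundary (hbdd : Bornology.IsBounded Ω) (hlip : HasLipschitzBoundary Ω)
    {q : closure Ω → ℝ≥0∞} (hq : Measurable q) (hq0 : ∀ z, q z ≠ 0) (hqt : ∀ z, q z ≠ ∞)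
    (hreg : ∀ᵐ z ∂(surfaceMeasure Ω), ∃ ε : ℝ, 0 < ε ∧
      ∫⁻ y in Metric.ball z ε, (q y)⁻¹ ∂(surfaceMeasure Ω) < ∞)
    {g : ℕ → EuclideanSpace ℝ (Fin d) → ℝ} (hg : ∀ k, ContDiff ℝ 1 (g k))
    {h : closure Ω → EuclideanSpace ℝ (Fin d)} (hh : Measurable h)
    (h1 : Tendsto (fun k => ∫⁻ z : closure Ω, ‖g k z‖ₑ ^ 2 * q z ∂(surfaceMeasure Ω))
      atTop (𝓝 0))
    (h2 : Tendsto (fun k => ∫⁻ z : closure Ω, ‖tangentProj Ω z (gradient (g k) z) - h z‖ₑ ^ 2 * q z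
      ∂(surfaceMeasure Ω)) atTop (𝓝 0)) :
    ∀ᵐ z ∂(surfaceMeasure Ω), h z = 0 :=
  ae_eq_zero_of_locally_closable hbdd
    ((ae_restrict_mem isClosed_frontier.measurableSet).mono fun _ hy => frontier_subset_closure hy)
    (Q := tangentProj Ω) (S := frontier Ω) ae_surfaceMeasure_mem
    (fun y hy ε hε => by
      obtain ⟨e, φ, K, r, hgr⟩ := hlip.exists_isGraphNear hy
      have hpos : 0 < min r ε := lt_min hgr.pos hε
      exact ⟨min r ε, hpos, min_le_right _ _,
        (hgr.mono hpos (min_le_left _ _)).isGradientClosable⟩)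
    hq hq0 hqt hreg hg hh h1 h2

end OneParticle

/-! ### The gradient field on the configuration space -/

section SliceConvergence

variable {ι Z : Type*} [Fintype ι] [DecidableEq ι] [MeasurableSpace Z] {ν : Measure Z}
  [IsFiniteMeasure ν]

/-- Convergence to `0` in `L¹` of a product implies, along a subsequence, convergence to `0` in
`L¹` of almost all sections in one coordinate. -/
lemma exists_subseq_tendsto_section (i : ι) {f : ℕ → (ι → Z) → ℝ≥0∞}
    (hf : ∀ k, AEMeasurable (f k) (Measure.pi fun _ : ι => ν))
    (hlim : Tendsto (fun k => ∫⁻ x, f k x ∂(Measure.pi fun _ : ι => ν)) atTop (𝓝 0)) :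
    ∃ s : ℕ → ℕ, StrictMono s ∧ ∀ᵐ x ∂(Measure.pi fun _ : ι => ν),
      Tendsto (fun k => ∫⁻ z, f (s k) (Function.update x i z) ∂ν) atTop (𝓝 0) := by
  set g : ℕ → (ι → Z) → ℝ≥0∞ := fun k => (hf k).mk (f k)
  have hg : ∀ k, Measurable (g k) := fun k => (hf k).measurable_mk
  have hfg : ∀ᵐ x ∂(Measure.pi fun _ : ι => ν), ∀ᵐ z ∂ν, ∀ k,
      f k (Function.update x i z) = g k (Function.update x i z) :=
    ae_ae_update_of_ae i (ae_all_iff.2 fun k => (hf k).ae_eq_mk)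
  have hgint : ∀ k, ∫⁻ x, g k x ∂(Measure.pi fun _ : ι => ν)
      = ∫⁻ x, f k x ∂(Measure.pi fun _ : ι => ν) := fun k =>
    lintegral_congr_ae (hf k).ae_eq_mk.symm
  -- with a summable sequence of bounds, the integrals of almost all sections are summable
  have hpow : ∀ j : ℕ, (0 : ℝ≥0∞) < (2⁻¹) ^ j := fun j => ENNReal.pow_pos (by simp) j
  obtain ⟨s, hs, hsle⟩ := extraction_forall_of_eventually
    (fun j => hlim.eventually (gt_mem_nhds (hpow j)))
  refine ⟨s, hs, ?_⟩
  have hmeas : ∀ j, Measurable fun x : ι → Z => ∫⁻ z, g (s j) (Function.update x i z) ∂ν := fun j =>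
    Measurable.lintegral_prod_right' (f := fun p : (ι → Z) × Z =>
      g (s j) (Function.update p.1 i p.2))
      ((hg _).comp (by fun_prop))
  have htsum : ∫⁻ x, ∑' j, ∫⁻ z, g (s j) (Function.update x i z) ∂ν ∂(Measure.pi fun _ : ι => ν)
      ≠ ∞ := by
    rw [lintegral_tsum fun j => (hmeas j).aemeasurable]
    have hle : ∑' j, ∫⁻ x, ∫⁻ z, g (s j) (Function.update x i z) ∂ν ∂(Measure.pi fun _ : ι => ν)
        ≤ ∑' j : ℕ, ν univ * 2⁻¹ ^ j := by
      refine ENNReal.tsum_le_tsum fun j => ?_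
      rw [lintegral_lintegral_update i (hg _), hgint]
      gcongr
      exact (hsle j).le
    refine (hle.trans_lt ?_).ne
    rw [ENNReal.tsum_mul_left]
    refine ENNReal.mul_lt_top (measure_lt_top _ _) ?_
    rw [ENNReal.tsum_geometric, ENNReal.one_sub_inv_two, inv_inv]
    exact ENNReal.ofNat_lt_top
  filter_upwards [ae_lt_top' (AEMeasurable.tsum fun j => (hmeas j).aemeasurable) htsum, hfg]
    with x h1 h2
  refine (ENNReal.tendsto_atTop_zero_of_tsum_ne_top h1.ne).congr fun j => ?_
  refine lintegral_congr_ae ?_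
  filter_upwards [h2] with z hz
  exact (hz _).symm

end SliceConvergence

section GradientField

variable {d N : ℕ} {Ω : Set (EuclideanSpace ℝ (Fin d))}

lemma hasFDerivAt_comp_update {F : (Fin N → EuclideanSpace ℝ (Fin d)) → ℝ}
    {x : Fin N → EuclideanSpace ℝ (Fin d)} (hF : DifferentiableAt ℝ F x) (i : Fin N) :
    HasFDerivAt (fun y => F (Function.update x i y))
      ((fderiv ℝ F x).comp (.pi (Pi.single i (.id ℝ (EuclideanSpace ℝ (Fin d)))))) (x i) := by
  have h1 : HasFDerivAt F (fderiv ℝ F x) (Function.update x i (x i)) := by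
    rw [Function.update_eq_self]
    exact hF.hasFDerivAt
  exact h1.comp (x i) (hasFDerivAt_update x (x i))

lemma partGrad_eq {F : (Fin N → EuclideanSpace ℝ (Fin d)) → ℝ}
    {x : Fin N → EuclideanSpace ℝ (Fin d)} (hF : DifferentiableAt ℝ F x) (i : Fin N) :
    partGrad F i x = (InnerProductSpace.toDual ℝ (EuclideanSpace ℝ (Fin d))).symm
      ((fderiv ℝ F x).comp (.pi (Pi.single i (.id ℝ (EuclideanSpace ℝ (Fin d)))))) := by
  rw [partGrad, gradient, (hasFDerivAt_comp_update hF i).fderiv]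

lemma continuous_partGrad {F : (Fin N → EuclideanSpace ℝ (Fin d)) → ℝ} (hF : ContDiff ℝ 1 F)
    (i : Fin N) : Continuous (partGrad F i) := by
  have h1 : partGrad F i = fun x => (InnerProductSpace.toDual ℝ (EuclideanSpace ℝ (Fin d))).symm
      ((fderiv ℝ F x).comp (.pi (Pi.single i (.id ℝ (EuclideanSpace ℝ (Fin d)))))) :=
    funext fun x => partGrad_eq (hF.differentiable (by simp) x) i
  rw [h1]
  exact (LinearIsometryEquiv.continuous _).comp
    ((hF.continuous_fderiv (by simp)).clm_comp continuous_const)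

lemma continuous_configCoe : Continuous (Config.coe : Config Ω N → _) :=
  continuous_pi fun i => continuous_subtype_val.comp (continuous_apply i)

lemma configCoe_update (x : Config Ω N) (i : Fin N) (z : closure Ω) :
    Config.coe (Function.update x i z)
      = Function.update x.coe i (z : EuclideanSpace ℝ (Fin d)) := by
  funext j
  by_cases hj : j = i
  · subst hj
    simp [Config.coe]
  · simp [Config.coe, hj]

open Classical in
/-- The map that turns the gradient at the position `z` of a particle into the gradient seen by the
form: the identity inside `Ω`, and `δ` times the tangential projection on the boundary. -/
def siteProj (Ω : Set (EuclideanSpace ℝ (Fin d))) (δ : ℝ) (z v : EuclideanSpace ℝ (Fin d)) :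
    EuclideanSpace ℝ (Fin d) :=
  if z ∈ Ω then v else δ • tangentProj Ω z v

/-- The gradient field whose square is the square field of the form. -/
def gradField (Ω : Set (EuclideanSpace ℝ (Fin d))) (δ : ℝ)
    (F : (Fin N → EuclideanSpace ℝ (Fin d)) → ℝ) (x : Config Ω N) :
    PiLp 2 (fun _ : Fin N => EuclideanSpace ℝ (Fin d)) :=
  WithLp.toLp 2 fun i => siteProj Ω δ (x i) (partGrad F i x.coe)

lemma squareField_eq_inner (hΩ : IsOpen Ω) {δ : ℝ} (hδ : δ * δ = δ)
    (F G : (Fin N → EuclideanSpace ℝ (Fin d)) → ℝ) (x : Config Ω N) :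
    squareField Ω δ F G x = ⟪gradField Ω δ F x, gradField Ω δ G x⟫_ℝ := by
  rw [squareField, PiLp.inner_apply]
  refine Finset.sum_congr rfl fun i _ => ?_
  by_cases hi : (x i : EuclideanSpace ℝ (Fin d)) ∈ Ω
  · have hi' : (x i : EuclideanSpace ℝ (Fin d)) ∉ frontier Ω := fun h =>
      (mem_frontier_iff_notMem hΩ _).1 h hi
    simp [gradField, siteProj, hi, hi']
  · have hi' := (mem_frontier_iff_notMem hΩ _).2 hi
    simp only [gradField, siteProj, hi, hi', if_true, if_false, partSurfGrad, zero_add]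
    rw [real_inner_smul_left, inner_smul_right, ← mul_assoc, hδ]
    rfl

lemma not_isOutwardNormal_of_mem (hΩ : IsOpen Ω) {z ν : EuclideanSpace ℝ (Fin d)} (hz : z ∈ Ω) :
    ¬ IsOutwardNormal Ω z ν := by
  rintro ⟨hν, h⟩
  obtain ⟨r, hr, h1⟩ := h (1 / 2) (by norm_num)
  obtain ⟨ρ, hρ, h2⟩ := Metric.isOpen_iff.1 hΩ z hz
  have hmin : 0 < min r ρ := lt_min hr hρ
  have hnorm : ‖(min r ρ / 2) • ν‖ = min r ρ / 2 := by
    rw [norm_smul, hν, mul_one, Real.norm_eq_abs, abs_of_pos (by linarith)]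
  have hdist : dist (z + (min r ρ / 2) • ν) z < min r ρ := by
    rw [dist_eq_norm, add_sub_cancel_left, hnorm]
    linarith
  refine (h1 _ (lt_of_lt_of_le hdist (min_le_left _ _))).2 ?_
    (h2 (lt_of_lt_of_le hdist (min_le_right _ _)))
  rw [add_sub_cancel_left, hnorm, inner_smul_right, real_inner_self_eq_norm_sq, hν]
  linarith

/-- Inside `Ω` there is no normal, so `outwardNormal` has its default value. -/
lemma outwardNormal_of_mem (hΩ : IsOpen Ω) {z : EuclideanSpace ℝ (Fin d)} (hz : z ∈ Ω) :
    outwardNormal Ω z = 0 := by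
  rw [outwardNormal, dif_neg]
  rintro ⟨ν, hν⟩
  exact not_isOutwardNormal_of_mem hΩ hz hν

lemma aemeasurable_outwardNormal_closure (hΩ : IsOpen Ω) (hbdd : Bornology.IsBounded Ω)
    (hlip : HasLipschitzBoundary Ω) :
    AEMeasurable (fun z : closure Ω => outwardNormal Ω z)
      (interiorMeasure Ω + surfaceMeasure Ω) := by
  have hemb := measurableEmbedding_coe_closure (Ω := Ω)
  refine aemeasurable_add_measure_iff.2 ⟨⟨fun _ => 0, measurable_const, ?_⟩, ?_⟩
  · filter_upwards [ae_interiorMeasure_mem hΩ] with z hz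
    exact outwardNormal_of_mem hΩ hz
  · have h1 : (surfaceMeasure Ω).map Subtype.val = (Measure.euclideanHausdorffMeasure (d - 1) :
        Measure (EuclideanSpace ℝ (Fin d))).restrict (frontier Ω) := by
      rw [surfaceMeasure, hemb.map_comap, Subtype.range_coe, Measure.restrict_eq_self_of_ae_mem]
      exact (ae_restrict_mem isClosed_frontier.measurableSet).mono
        fun _ hy => frontier_subset_closure hy
    have h2 := aemeasurable_outwardNormal hlip hbdd
    rw [← h1] at h2
    exact hemb.aemeasurable_map_iff.1 h2

variable [IsFiniteMeasure (interiorMeasure Ω)] [IsFiniteMeasure (surfaceMeasure Ω)]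

lemma aemeasurable_siteProj (hΩ : IsOpen Ω) (hbdd : Bornology.IsBounded Ω)
    (hlip : HasLipschitzBoundary Ω) (δ : ℝ) (i : Fin N)
    {G : Config Ω N → EuclideanSpace ℝ (Fin d)} (hG : Measurable G) :
    AEMeasurable (fun x => siteProj Ω δ (x i) (G x)) (baseMeasure Ω N) := by
  classical
  have hn : AEMeasurable (fun x : Config Ω N => outwardNormal Ω (x i)) (baseMeasure Ω N) :=
    (aemeasurable_outwardNormal_closure hΩ hbdd hlip).comp_quasiMeasurePreserving
      (Measure.quasiMeasurePreserving_eval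
        (fun _ : Fin N => interiorMeasure Ω + surfaceMeasure Ω) i)
  have h1 : AEMeasurable (fun x : Config Ω N => δ • tangentProj Ω (x i) (G x)) (baseMeasure Ω N) :=
    AEMeasurable.const_smul (hG.aemeasurable.sub
      (AEMeasurable.smul (hn.inner (𝕜 := ℝ) hG.aemeasurable) hn)) δ
  refine ⟨fun x => if (x i : EuclideanSpace ℝ (Fin d)) ∈ Ω then G x else h1.mk _ x,
    Measurable.ite ((measurableSet_mem_domain hΩ).preimage (measurable_pi_apply i)) hG
      h1.measurable_mk, ?_⟩
  filter_upwards [h1.ae_eq_mk] with x hx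
  rw [siteProj, hx]

lemma aemeasurable_gradField (hΩ : IsOpen Ω) (hbdd : Bornology.IsBounded Ω)
    (hlip : HasLipschitzBoundary Ω) (δ : ℝ) {F : (Fin N → EuclideanSpace ℝ (Fin d)) → ℝ}
    (hF : ContDiff ℝ 1 F) : AEMeasurable (gradField Ω δ F) (baseMeasure Ω N) := by
  refine (PiLp.continuous_toLp 2 _).measurable.comp_aemeasurable (aemeasurable_pi_iff.2 fun i => ?_)
  exact aemeasurable_siteProj hΩ hbdd hlip δ i
    ((continuous_partGrad hF i).comp continuous_configCoe).measurable

/-- Closability of the gradient field in one particle. All other particles are fixed at almost all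
positions. Inside `Ω`, and on the boundary if `δ = 1`, closability comes from the local
integrability of the inverse weight; if `δ = 0`, the gradient field vanishes on the boundary. -/
lemma ae_gradField_limit_coordinate_eq_zero (hΩ : IsOpen Ω) (hbdd : Bornology.IsBounded Ω)
    (hlip : HasLipschitzBoundary Ω) {δ : ℝ} (hδ : δ = 0 ∨ δ = 1) {w : Config Ω N → ℝ≥0∞}
    (hw : Measurable w) (hw0 : ∀ x, w x ≠ 0) (hwt : ∀ x, w x ≠ ∞)
    (hI : ∀ᵐ x ∂(baseMeasure Ω N), ∀ i, (x i : EuclideanSpace ℝ (Fin d)) ∈ Ω → ∃ ε : ℝ, 0 < ε ∧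
      ∫⁻ z in Metric.ball (x i) ε, (w (Function.update x i z))⁻¹ ∂(interiorMeasure Ω) < ∞)
    (hB : δ = 1 → ∀ᵐ x ∂(baseMeasure Ω N), ∀ i, (x i : EuclideanSpace ℝ (Fin d)) ∈ frontier Ω →
      ∃ ε : ℝ, 0 < ε ∧
      ∫⁻ z in Metric.ball (x i) ε, (w (Function.update x i z))⁻¹ ∂(surfaceMeasure Ω) < ∞)
    {F : ℕ → (Fin N → EuclideanSpace ℝ (Fin d)) → ℝ} (hF : ∀ k, ContDiff ℝ 1 (F k)) (i : Fin N)
    {v : Config Ω N → EuclideanSpace ℝ (Fin d)} (hv : Measurable v)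
    (h1 : Tendsto (fun k => ∫⁻ x, ‖F k x.coe‖ₑ ^ 2 * w x ∂(baseMeasure Ω N)) atTop (𝓝 0))
    (h2 : Tendsto (fun k => ∫⁻ x, ‖siteProj Ω δ (x i) (partGrad (F k) i x.coe) - v x‖ₑ ^ 2 * w x
      ∂(baseMeasure Ω N)) atTop (𝓝 0)) :
    ∀ᵐ x ∂(baseMeasure Ω N), v x = 0 := by
  refine ae_of_ae_ae_update i (hv (measurableSet_singleton 0)) ?_
  have hm1 : ∀ k, AEMeasurable (fun x : Config Ω N => ‖F k x.coe‖ₑ ^ 2 * w x) (baseMeasure Ω N) :=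
    fun k => ((((hF k).continuous.comp continuous_configCoe).measurable.enorm.pow_const 2).mul
      hw).aemeasurable
  have hm2 : ∀ k, AEMeasurable (fun x : Config Ω N =>
      ‖siteProj Ω δ (x i) (partGrad (F k) i x.coe) - v x‖ₑ ^ 2 * w x) (baseMeasure Ω N) := fun k =>
    (((aemeasurable_siteProj hΩ hbdd hlip δ i
      ((continuous_partGrad (hF k) i).comp continuous_configCoe).measurable).sub
      hv.aemeasurable).enorm.pow_const 2).mul hw.aemeasurable
  have hsum : Tendsto (fun k => ∫⁻ x, (‖F k x.coe‖ₑ ^ 2 * w x +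
      ‖siteProj Ω δ (x i) (partGrad (F k) i x.coe) - v x‖ₑ ^ 2 * w x) ∂(baseMeasure Ω N)) atTop
      (𝓝 0) := by
    have := h1.add h2
    rw [add_zero] at this
    exact this.congr fun k => (lintegral_add_left' (hm1 k) _).symm
  obtain ⟨s, -, hs⟩ := exists_subseq_tendsto_section i
    (f := fun k x => ‖F k (Config.coe x)‖ₑ ^ 2 * w x +
    ‖siteProj Ω δ (x i) (partGrad (F k) i (Config.coe x)) - v x‖ₑ ^ 2 * w x)
    (fun k => (hm1 k).add (hm2 k)) hsum
  have hI' : ∀ᵐ x ∂(baseMeasure Ω N), ∀ᵐ z : closure Ω ∂(interiorMeasure Ω + surfaceMeasure Ω),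
      (z : EuclideanSpace ℝ (Fin d)) ∈ Ω → ∃ ε : ℝ, 0 < ε ∧
      ∫⁻ y in Metric.ball z ε, (w (Function.update x i y))⁻¹ ∂(interiorMeasure Ω) < ∞ := by
    filter_upwards [ae_ae_update_of_ae i hI] with x hx
    filter_upwards [hx] with z hz
    simpa using hz i
  have hB' : δ = 1 → ∀ᵐ x ∂(baseMeasure Ω N),
      ∀ᵐ z : closure Ω ∂(interiorMeasure Ω + surfaceMeasure Ω),
      (z : EuclideanSpace ℝ (Fin d)) ∈ frontier Ω → ∃ ε : ℝ, 0 < ε ∧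
      ∫⁻ y in Metric.ball z ε, (w (Function.update x i y))⁻¹ ∂(surfaceMeasure Ω) < ∞ := by
    intro hδ1
    filter_upwards [ae_ae_update_of_ae i (hB hδ1)] with x hx
    filter_upwards [hx] with z hz
    simpa using hz i
  have hB'' : ∀ᵐ x ∂(baseMeasure Ω N), δ = 1 →
      ∀ᵐ z : closure Ω ∂(interiorMeasure Ω + surfaceMeasure Ω),
      (z : EuclideanSpace ℝ (Fin d)) ∈ frontier Ω → ∃ ε : ℝ, 0 < ε ∧
      ∫⁻ y in Metric.ball z ε, (w (Function.update x i y))⁻¹ ∂(surfaceMeasure Ω) < ∞ := by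
    by_cases hδ1 : δ = 1
    · filter_upwards [hB' hδ1] with x hx _
      exact hx
    · exact Eventually.of_forall fun x h => absurd h hδ1
  filter_upwards [hs, hI', hB''] with x hx hxI hxB
  -- the sections of all data in the position of the `i`-th particle
  set g : ℕ → EuclideanSpace ℝ (Fin d) → ℝ := fun k y =>
    F (s k) (Function.update (Config.coe x) i y)
  set q : closure Ω → ℝ≥0∞ := fun z => w (Function.update x i z)
  set h : closure Ω → EuclideanSpace ℝ (Fin d) := fun z => v (Function.update x i z)
  have hg : ∀ k, ContDiff ℝ 1 (g k) := fun k => (hF (s k)).comp (contDiff_update 1 (Config.coe x) i)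
  have hq : Measurable q := hw.comp (measurable_update x)
  have hh : Measurable h := hv.comp (measurable_update x)
  have hgrad : ∀ k (z : closure Ω), partGrad (F (s k)) i (Config.coe (Function.update x i z))
      = gradient (g k) z := fun k z => by
    rw [partGrad, configCoe_update, Function.update_self]
    simp only [Function.update_idem]
    rfl
  have hlim : ∀ κ : Measure (closure Ω), κ ≤ interiorMeasure Ω + surfaceMeasure Ω →
      Tendsto (fun k => ∫⁻ z : closure Ω, ‖g k z‖ₑ ^ 2 * q z ∂κ) atTop (𝓝 0) ∧
      Tendsto (fun k => ∫⁻ z : closure Ω, ‖siteProj Ω δ z (gradient (g k) z) - h z‖ₑ ^ 2 * q z ∂κ)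
        atTop (𝓝 0) := by
    intro κ hκ
    constructor
    · refine tendsto_of_tendsto_of_tendsto_of_le_of_le tendsto_const_nhds hx (fun _ => bot_le)
        fun k => lintegral_mono' hκ fun z => ?_
      rw [configCoe_update]
      exact le_self_add
    · refine tendsto_of_tendsto_of_tendsto_of_le_of_le tendsto_const_nhds hx (fun _ => bot_le)
        fun k => lintegral_mono' hκ fun z => ?_
      rw [hgrad, Function.update_self]
      exact le_add_self
  rw [ae_add_measure_iff] at hxI ⊢
  constructor
  · obtain ⟨h3, h4⟩ := hlim (interiorMeasure Ω) (Measure.le_add_right le_rfl)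
    refine ae_eq_zero_interior hΩ hbdd hq (fun _ => hw0 _) (fun _ => hwt _) ?_ hg hh h3 ?_
    · filter_upwards [hxI.1, ae_interiorMeasure_mem hΩ] with z hz hzΩ
      exact hz hzΩ
    · refine h4.congr fun k => lintegral_congr_ae ?_
      filter_upwards [ae_interiorMeasure_mem hΩ] with z hz
      rw [siteProj, if_pos hz]
  · obtain ⟨h3, h4⟩ := hlim (surfaceMeasure Ω) (Measure.le_add_left le_rfl)
    rcases hδ with hδ | hδ
    · have h5 : ∫⁻ z, ‖h z‖ₑ ^ 2 * q z ∂(surfaceMeasure Ω) = 0 := by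
        refine tendsto_nhds_unique (tendsto_const_nhds.congr fun k => ?_) h4
        refine lintegral_congr_ae ?_
        filter_upwards [ae_surfaceMeasure_mem] with z hz
        rw [siteProj, if_neg ((mem_frontier_iff_notMem hΩ z).1 hz), hδ, zero_smul, zero_sub,
          enorm_neg]
      rw [lintegral_eq_zero_iff (f := fun z => ‖h z‖ₑ ^ 2 * q z)
        ((hh.enorm.pow_const 2).mul hq)] at h5
      filter_upwards [h5] with z hz
      have h6 : ‖h z‖ₑ ^ 2 * q z = 0 := hz
      have h7 : q z ≠ 0 := hw0 _
      simpa [h7] using h6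
    · have h5 := hxB hδ
      rw [ae_add_measure_iff] at h5
      refine ae_eq_zero_boundary hbdd hlip hq (fun _ => hw0 _) (fun _ => hwt _) ?_ hg hh h3 ?_
      · filter_upwards [h5.2, ae_surfaceMeasure_mem] with z hz hzΩ
        exact hz hzΩ
      · refine h4.congr fun k => lintegral_congr_ae ?_
        filter_upwards [ae_surfaceMeasure_mem] with z hz
        rw [siteProj, if_neg ((mem_frontier_iff_notMem hΩ z).1 hz), hδ, one_smul]

end GradientField

/-! ### Finiteness, support and density of the measures -/

section Measures

variable {d N : ℕ} {Ω : Set (EuclideanSpace ℝ (Fin d))} {ϱ : Config Ω N → ℝ}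

lemma isFiniteMeasure_interiorMeasure (hbdd : Bornology.IsBounded Ω) :
    IsFiniteMeasure (interiorMeasure Ω) := by
  have : IsFiniteMeasure ((volume : Measure (EuclideanSpace ℝ (Fin d))).restrict Ω) :=
    isFiniteMeasure_restrict.2 hbdd.measure_lt_top.ne
  refine ⟨?_⟩
  rw [interiorMeasure, measurableEmbedding_coe_closure.comap_apply]
  exact measure_lt_top _ _

lemma isFiniteMeasure_surfaceMeasure (hbdd : Bornology.IsBounded Ω)
    (hlip : HasLipschitzBoundary Ω) : IsFiniteMeasure (surfaceMeasure Ω) := by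
  have := isFiniteMeasure_hausdorff_frontier hlip hbdd
  refine ⟨?_⟩
  rw [surfaceMeasure, measurableEmbedding_coe_closure.comap_apply]
  exact measure_lt_top _ _

lemma isOpenPosMeasure_interiorMeasure (hΩ : IsOpen Ω) :
    (interiorMeasure Ω).IsOpenPosMeasure := by
  refine ⟨fun U hU ⟨x, hx⟩ h0 => ?_⟩
  obtain ⟨O, hO, rfl⟩ := isOpen_induced_iff.1 hU
  rw [interiorMeasure, measurableEmbedding_coe_closure.comap_apply,
    Subtype.image_preimage_coe, Measure.restrict_apply' hΩ.measurableSet] at h0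
  have hne : (O ∩ Ω).Nonempty := mem_closure_iff.1 x.2 O hO hx
  refine (hO.inter hΩ).measure_ne_zero volume hne (measure_mono_null ?_ h0)
  exact fun y hy => ⟨⟨subset_closure hy.2, hy.1⟩, hy.2⟩

lemma baseMeasure_absolutelyContinuous (hϱ : AEMeasurable ϱ (baseMeasure Ω N))
    (hϱ_pos : ∀ᵐ x ∂(baseMeasure Ω N), 0 < ϱ x) : baseMeasure Ω N ≪ weightedMeasure Ω ϱ :=
  withDensity_absolutelyContinuous' hϱ.ennreal_ofReal
    (hϱ_pos.mono fun _ hx => (ENNReal.ofReal_pos.2 hx).ne')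

/-- The density has a version that is measurable, finite and nonzero everywhere. -/
lemma exists_measurable_density (hϱ : AEMeasurable ϱ (baseMeasure Ω N))
    (hϱ_pos : ∀ᵐ x ∂(baseMeasure Ω N), 0 < ϱ x) :
    ∃ w : Config Ω N → ℝ≥0∞, Measurable w ∧ (∀ x, w x ≠ 0) ∧ (∀ x, w x ≠ ∞) ∧
      ∀ᵐ x ∂(baseMeasure Ω N), ENNReal.ofReal (ϱ x) = w x := by
  classical
  refine ⟨fun x => if 0 < hϱ.mk ϱ x then ENNReal.ofReal (hϱ.mk ϱ x) else 1,
    Measurable.ite (measurableSet_lt measurable_const hϱ.measurable_mk)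
      hϱ.measurable_mk.ennreal_ofReal measurable_const, fun x => ?_, fun x => ?_, ?_⟩
  · by_cases h : 0 < hϱ.mk ϱ x <;> simp [h]
  · by_cases h : 0 < hϱ.mk ϱ x <;> simp [h]
  · filter_upwards [hϱ.ae_eq_mk, hϱ_pos] with x h1 h2
    rw [← h1, if_pos h2]

lemma isOpenPosMeasure_baseMeasure [IsFiniteMeasure (interiorMeasure Ω)]
    [IsFiniteMeasure (surfaceMeasure Ω)] (hΩ : IsOpen Ω) :
    (baseMeasure Ω N).IsOpenPosMeasure := by
  have := isOpenPosMeasure_interiorMeasure hΩ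
  have : (interiorMeasure Ω + surfaceMeasure Ω).IsOpenPosMeasure :=
    (Measure.le_add_right le_rfl : interiorMeasure Ω ≤ _).isOpenPosMeasure
  exact Measure.pi.isOpenPosMeasure _

end Measures

/-! ### Calculus of the gradient field -/

section FieldAlgebra

variable {d N : ℕ} {Ω : Set (EuclideanSpace ℝ (Fin d))} {δ : ℝ}
  {F G : (Fin N → EuclideanSpace ℝ (Fin d)) → ℝ}

lemma siteProj_add (z u v : EuclideanSpace ℝ (Fin d)) :
    siteProj Ω δ z (u + v) = siteProj Ω δ z u + siteProj Ω δ z v := by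
  by_cases h : z ∈ Ω
  · simp [siteProj, h]
  · simp only [siteProj, h, if_false, tangentProj, inner_add_right]
    module

lemma siteProj_smul (z : EuclideanSpace ℝ (Fin d)) (c : ℝ) (v : EuclideanSpace ℝ (Fin d)) :
    siteProj Ω δ z (c • v) = c • siteProj Ω δ z v := by
  by_cases h : z ∈ Ω
  · simp [siteProj, h]
  · simp only [siteProj, h, if_false, tangentProj, inner_smul_right]
    module

lemma norm_outwardNormal_le (z : EuclideanSpace ℝ (Fin d)) : ‖outwardNormal Ω z‖ ≤ 1 := by
  by_cases h : ∃ ν, IsOutwardNormal Ω z ν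
  · rw [outwardNormal, dif_pos h]
    exact h.choose_spec.1.le
  · rw [outwardNormal, dif_neg h]
    simp

lemma norm_siteProj_le (z v : EuclideanSpace ℝ (Fin d)) :
    ‖siteProj Ω δ z v‖ ≤ (1 + |δ| * 2) * ‖v‖ := by
  by_cases h : z ∈ Ω
  · simp only [siteProj, h, if_true]
    nlinarith [abs_nonneg δ, norm_nonneg v, mul_nonneg (abs_nonneg δ) (norm_nonneg v)]
  · simp only [siteProj, h, if_false, norm_smul, Real.norm_eq_abs]
    have hn := norm_outwardNormal_le (Ω := Ω) z
    have h1 : ‖tangentProj Ω z v‖ ≤ 2 * ‖v‖ := by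
      have h2 : ‖⟪outwardNormal Ω z, v⟫_ℝ • outwardNormal Ω z‖ ≤ 1 * ‖v‖ * 1 := by
        rw [norm_smul]
        gcongr
        exact (norm_inner_le_norm _ _).trans (by gcongr)
      refine (norm_sub_le _ _).trans ?_
      linarith
    nlinarith [mul_le_mul_of_nonneg_left h1 (abs_nonneg δ), norm_nonneg v]

/-- The linear map which turns the derivative of a function at a configuration into the value of
its gradient field. -/
def fieldMap (Ω : Set (EuclideanSpace ℝ (Fin d))) (δ : ℝ) (x : Config Ω N) :
    ((Fin N → EuclideanSpace ℝ (Fin d)) →L[ℝ] ℝ) →ₗ[ℝ]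
      PiLp 2 (fun _ : Fin N => EuclideanSpace ℝ (Fin d)) where
  toFun ℓ := WithLp.toLp 2 fun i => siteProj Ω δ (x i)
    ((InnerProductSpace.toDual ℝ (EuclideanSpace ℝ (Fin d))).symm
      (ℓ.comp (.pi (Pi.single i (.id ℝ (EuclideanSpace ℝ (Fin d)))))))
  map_add' ℓ ℓ' := by
    ext1 i
    simp [ContinuousLinearMap.add_comp, siteProj_add]
  map_smul' c ℓ := by
    ext1 i
    simp [ContinuousLinearMap.smul_comp, siteProj_smul]

lemma gradField_eq (hF : ContDiff ℝ 1 F) (x : Config Ω N) :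
    gradField Ω δ F x = fieldMap Ω δ x (fderiv ℝ F x.coe) := by
  ext1 i
  simp only [gradField, fieldMap, LinearMap.coe_mk, AddHom.coe_mk]
  rw [partGrad_eq (hF.differentiable (by simp) _)]

lemma gradField_add (hF : ContDiff ℝ 1 F) (hG : ContDiff ℝ 1 G) (x : Config Ω N) :
    gradField Ω δ (F + G) x = gradField Ω δ F x + gradField Ω δ G x := by
  rw [gradField_eq hF, gradField_eq hG, gradField_eq (F := F + G) (hF.add hG), ← map_add,
    fderiv_add (hF.differentiable (by simp) _) (hG.differentiable (by simp) _)]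

lemma gradField_const_smul (hF : ContDiff ℝ 1 F) (c : ℝ) (x : Config Ω N) :
    gradField Ω δ (c • F) x = c • gradField Ω δ F x := by
  rw [gradField_eq hF, gradField_eq (F := c • F) (hF.const_smul c), ← map_smul,
    fderiv_const_smul (hF.differentiable (by simp) _)]

lemma gradField_const (c : ℝ) (x : Config Ω N) : gradField Ω δ (fun _ => c) x = 0 := by
  rw [gradField_eq contDiff_const, fderiv_const_apply, map_zero]

lemma gradField_mul (hF : ContDiff ℝ 1 F) (hG : ContDiff ℝ 1 G) (x : Config Ω N) :
    gradField Ω δ (fun y => F y * G y) x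
      = F x.coe • gradField Ω δ G x + G x.coe • gradField Ω δ F x := by
  rw [gradField_eq hF, gradField_eq hG, gradField_eq (hF.mul hG), ← map_smul, ← map_smul,
    ← map_add, fderiv_fun_mul (hF.differentiable (by simp) _) (hG.differentiable (by simp) _)]

lemma gradField_comp {φ : ℝ → ℝ} (hφ : ContDiff ℝ 1 φ) (hF : ContDiff ℝ 1 F) (x : Config Ω N) :
    gradField Ω δ (fun y => φ (F y)) x = deriv φ (F x.coe) • gradField Ω δ F x := by
  rw [gradField_eq hF, gradField_eq (F := fun y => φ (F y)) (hφ.comp hF), ← map_smul]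
  congr 1
  exact (((hφ.differentiable (by simp) _).hasDerivAt.comp_hasFDerivAt _
    (hF.differentiable (by simp) _).hasFDerivAt)).fderiv

/-- The gradient field depends only on the restriction to `Λ`: the derivatives of two functions
that agree on `Λ` agree on the open set `Ω^N`, hence on its closure `Λ`. -/
lemma gradField_congr (hΩ : IsOpen Ω) (hF : ContDiff ℝ 1 F) (hG : ContDiff ℝ 1 G)
    (h : ∀ x : Config Ω N, F x.coe = G x.coe) (x : Config Ω N) :
    gradField Ω δ F x = gradField Ω δ G x := by
  rw [gradField_eq hF, gradField_eq hG]
  congr 1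
  have hclosed : IsClosed {y | fderiv ℝ F y = fderiv ℝ G y} :=
    isClosed_eq (hF.continuous_fderiv (by simp)) (hG.continuous_fderiv (by simp))
  have hopen : IsOpen (Set.pi univ fun _ : Fin N => Ω) := isOpen_set_pi finite_univ fun _ _ => hΩ
  have hsub : Set.pi univ (fun _ : Fin N => Ω) ⊆ {y | fderiv ℝ F y = fderiv ℝ G y} := by
    intro y hy
    refine Filter.EventuallyEq.fderiv_eq ?_
    filter_upwards [hopen.mem_nhds hy] with z hz
    exact h fun i => ⟨z i, subset_closure (hz i (mem_univ i))⟩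
  have hx : x.coe ∈ closure (Set.pi univ fun _ : Fin N => Ω) := by
    rw [closure_pi_set]
    exact fun i _ => (x i).2
  exact hclosed.closure_subset_iff.2 hsub hx

lemma gradField_eq_zero_of_nonneg (hF : ContDiff ℝ 1 F) (h0 : ∀ y, 0 ≤ F y) {x : Config Ω N}
    (hx : F x.coe = 0) : gradField Ω δ F x = 0 := by
  have hmin : IsLocalMin F x.coe := Eventually.of_forall fun y => by
    rw [hx]
    exact h0 y
  rw [gradField_eq hF, hmin.fderiv_eq_zero, map_zero]

lemma exists_norm_gradField_le [CompactSpace (closure Ω)] (hF : ContDiff ℝ 1 F) :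
    ∃ C : ℝ, ∀ x : Config Ω N, ‖gradField Ω δ F x‖ ≤ C := by
  choose C hC using fun i : Fin N => isCompact_univ.exists_bound_of_continuousOn
    ((continuous_partGrad hF i).comp (continuous_configCoe (Ω := Ω))).continuousOn
  refine ⟨√(∑ i, ((1 + |δ| * 2) * C i) ^ 2), fun x => ?_⟩
  rw [PiLp.norm_eq_of_L2]
  refine Real.sqrt_le_sqrt (Finset.sum_le_sum fun i _ => ?_)
  gcongr
  refine (norm_siteProj_le _ _).trans ?_
  gcongr
  exact hC i x (mem_univ x)

end FieldAlgebra

section ContinuousFunctions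

variable {d N : ℕ} {Ω : Set (EuclideanSpace ℝ (Fin d))}

/-- The algebra of restrictions to `Λ` of continuously differentiable functions. -/
def contDiffRestrict (Ω : Set (EuclideanSpace ℝ (Fin d))) (N : ℕ) :
    Subalgebra ℝ C(Config Ω N, ℝ) where
  carrier := {f | ∃ F : (Fin N → EuclideanSpace ℝ (Fin d)) → ℝ, ContDiff ℝ 1 F ∧
    ∀ x, f x = F x.coe}
  mul_mem' := by
    rintro f g ⟨F, hF, hf⟩ ⟨G, hG, hg⟩
    exact ⟨F * G, hF.mul hG, fun x => by simp [hf, hg]⟩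
  add_mem' := by
    rintro f g ⟨F, hF, hf⟩ ⟨G, hG, hg⟩
    exact ⟨F + G, hF.add hG, fun x => by simp [hf, hg]⟩
  algebraMap_mem' c := ⟨fun _ => c, contDiff_const, fun x => by simp⟩

lemma dense_contDiffRestrict [CompactSpace (closure Ω)] :
    Dense (contDiffRestrict Ω N : Set C(Config Ω N, ℝ)) := by
  have hsep : (contDiffRestrict Ω N).SeparatesPoints := by
    intro x y hxy
    obtain ⟨i, hi⟩ := Function.ne_iff.1 hxy
    have hi' : (x i : EuclideanSpace ℝ (Fin d)) ≠ y i := fun h => hi (Subtype.ext h)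
    obtain ⟨j, hj⟩ : ∃ j,
        (x i : EuclideanSpace ℝ (Fin d)) j ≠ (y i : EuclideanSpace ℝ (Fin d)) j := by
      by_contra! h
      exact hi' (by ext j; exact h j)
    have hF : ContDiff ℝ 1 fun z : Fin N → EuclideanSpace ℝ (Fin d) => z i j := by fun_prop
    exact ⟨_, ⟨⟨fun x => x.coe i j, hF.continuous.comp continuous_configCoe⟩,
      ⟨_, hF, fun _ => rfl⟩, rfl⟩, hj⟩
  have h := ContinuousMap.subalgebra_topologicalClosure_eq_top_of_separatesPoints _ hsep
  intro f
  have hf : f ∈ (contDiffRestrict Ω N).topologicalClosure := by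
    rw [h]
    trivial
  exact hf

end ContinuousFunctions

/-! ### The gradient operator -/

section GradientOperator

variable {d N : ℕ} {Ω : Set (EuclideanSpace ℝ (Fin d))} {δ : ℝ} {ϱ : Config Ω N → ℝ}

/-- The pairs in `L²` of a function in `C¹(Λ)` and its gradient field. -/
def gradGraph (Ω : Set (EuclideanSpace ℝ (Fin d))) (δ : ℝ) (ϱ : Config Ω N → ℝ) :
    Submodule ℝ (Lp ℝ 2 (weightedMeasure Ω ϱ) ×
      Lp (PiLp 2 (fun _ : Fin N => EuclideanSpace ℝ (Fin d))) 2 (weightedMeasure Ω ϱ)) where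
  carrier := {p | ∃ F : (Fin N → EuclideanSpace ℝ (Fin d)) → ℝ, ContDiff ℝ 1 F ∧
    p.1 =ᵐ[weightedMeasure Ω ϱ] (fun x => F x.coe) ∧
    p.2 =ᵐ[weightedMeasure Ω ϱ] gradField Ω δ F}
  add_mem' := by
    rintro p q ⟨F, hF, hp1, hp2⟩ ⟨G, hG, hq1, hq2⟩
    refine ⟨F + G, hF.add hG, ?_, ?_⟩
    · filter_upwards [hp1, hq1, Lp.coeFn_add p.1 q.1] with x h1 h2 h3
      rw [Prod.fst_add, h3, Pi.add_apply, h1, h2, Pi.add_apply]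
    · filter_upwards [hp2, hq2, Lp.coeFn_add p.2 q.2] with x h1 h2 h3
      rw [Prod.snd_add, h3, Pi.add_apply, h1, h2, gradField_add hF hG]
  zero_mem' := by
    refine ⟨fun _ => 0, contDiff_const, Lp.coeFn_zero _ _ _, ?_⟩
    filter_upwards [Lp.coeFn_zero (PiLp 2 (fun _ : Fin N => EuclideanSpace ℝ (Fin d))) 2
      (weightedMeasure Ω ϱ)] with x hx
    rw [gradField_const]
    exact hx
  smul_mem' := by
    rintro c p ⟨F, hF, hp1, hp2⟩
    refine ⟨c • F, hF.const_smul c, ?_, ?_⟩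
    · filter_upwards [hp1, Lp.coeFn_smul c p.1] with x h1 h3
      rw [Prod.smul_fst, h3, Pi.smul_apply, h1, Pi.smul_apply]
    · filter_upwards [hp2, Lp.coeFn_smul c p.2] with x h1 h3
      rw [Prod.smul_snd, h3, Pi.smul_apply, h1, gradField_const_smul hF]

/-- The gradient operator from `L²(Λ; μ)` to the `L²` vector fields, with domain `C¹(Λ)`. -/
def gradOperator (Ω : Set (EuclideanSpace ℝ (Fin d))) (δ : ℝ) (ϱ : Config Ω N → ℝ) :
    Lp ℝ 2 (weightedMeasure Ω ϱ) →ₗ.[ℝ]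
      Lp (PiLp 2 (fun _ : Fin N => EuclideanSpace ℝ (Fin d))) 2 (weightedMeasure Ω ϱ) :=
  (gradGraph Ω δ ϱ).toLinearPMap

lemma mem_domain_gradOperator_iff {f : Lp ℝ 2 (weightedMeasure Ω ϱ)} :
    f ∈ (gradOperator Ω δ ϱ).domain ↔ ∃ v, (f, v) ∈ gradGraph Ω δ ϱ := by
  rw [gradOperator, Submodule.toLinearPMap_domain, Submodule.mem_map]
  constructor
  · rintro ⟨⟨f, v⟩, h, rfl⟩
    exact ⟨v, h⟩
  · rintro ⟨v, h⟩
    exact ⟨(f, v), h, rfl⟩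

section WellDefined

variable [(weightedMeasure Ω ϱ).IsOpenPosMeasure]

lemma eq_of_ae_eq_configCoe {F G : (Fin N → EuclideanSpace ℝ (Fin d)) → ℝ} (hF : ContDiff ℝ 1 F)
    (hG : ContDiff ℝ 1 G)
    (h : (fun x : Config Ω N => F x.coe) =ᵐ[weightedMeasure Ω ϱ] fun x => G x.coe)
    (x : Config Ω N) : F x.coe = G x.coe :=
  congrFun (((hF.continuous.comp continuous_configCoe).ae_eq_iff_eq _
    (hG.continuous.comp continuous_configCoe)).1 h) x

lemma ae_eq_gradField_of_mem_gradGraph (hΩ : IsOpen Ω)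
    {p : Lp ℝ 2 (weightedMeasure Ω ϱ) ×
      Lp (PiLp 2 (fun _ : Fin N => EuclideanSpace ℝ (Fin d))) 2 (weightedMeasure Ω ϱ)}
    (hp : p ∈ gradGraph Ω δ ϱ) {F : (Fin N → EuclideanSpace ℝ (Fin d)) → ℝ} (hF : ContDiff ℝ 1 F)
    (h : p.1 =ᵐ[weightedMeasure Ω ϱ] fun x => F x.coe) :
    p.2 =ᵐ[weightedMeasure Ω ϱ] gradField Ω δ F := by
  obtain ⟨G, hG, h1, h2⟩ := hp
  refine h2.trans (Eventually.of_forall fun x => ?_)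
  exact gradField_congr hΩ hG hF (eq_of_ae_eq_configCoe hG hF (h1.symm.trans h)) x

lemma gradOperator_mem_gradGraph (hΩ : IsOpen Ω) (f : (gradOperator Ω δ ϱ).domain) :
    ((f : Lp ℝ 2 (weightedMeasure Ω ϱ)), gradOperator Ω δ ϱ f) ∈ gradGraph Ω δ ϱ := by
  refine Submodule.mem_graph_toLinearPMap (fun p hp hp0 => ?_) f
  have h1 : p.1 =ᵐ[weightedMeasure Ω ϱ] fun _ => (0 : ℝ) := by
    rw [hp0]
    exact Lp.coeFn_zero _ _ _
  have h2 := ae_eq_gradField_of_mem_gradGraph hΩ hp (F := fun _ => 0) contDiff_const h1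
  rw [Lp.eq_zero_iff_ae_eq_zero]
  filter_upwards [h2] with x hx
  rw [hx, gradField_const]
  rfl

lemma exists_contDiff_gradOperator (hΩ : IsOpen Ω) (f : (gradOperator Ω δ ϱ).domain) :
    ∃ F : (Fin N → EuclideanSpace ℝ (Fin d)) → ℝ, ContDiff ℝ 1 F ∧
      (f : Lp ℝ 2 (weightedMeasure Ω ϱ)) =ᵐ[weightedMeasure Ω ϱ] (fun x => F x.coe) ∧
      gradOperator Ω δ ϱ f =ᵐ[weightedMeasure Ω ϱ] gradField Ω δ F :=
  gradOperator_mem_gradGraph hΩ f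

lemma gradOperator_ae_eq (hΩ : IsOpen Ω) (f : (gradOperator Ω δ ϱ).domain)
    {F : (Fin N → EuclideanSpace ℝ (Fin d)) → ℝ} (hF : ContDiff ℝ 1 F)
    (h : (f : Lp ℝ 2 (weightedMeasure Ω ϱ)) =ᵐ[weightedMeasure Ω ϱ] (fun x => F x.coe)) :
    gradOperator Ω δ ϱ f =ᵐ[weightedMeasure Ω ϱ] gradField Ω δ F :=
  ae_eq_gradField_of_mem_gradGraph hΩ (gradOperator_mem_gradGraph hΩ f) hF h

end WellDefined

lemma memLp_configCoe [CompactSpace (closure Ω)] [IsFiniteMeasure (weightedMeasure Ω ϱ)]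
    {F : (Fin N → EuclideanSpace ℝ (Fin d)) → ℝ} (hF : ContDiff ℝ 1 F) :
    MemLp (fun x : Config Ω N => F x.coe) 2 (weightedMeasure Ω ϱ) := by
  have hc : Continuous fun x : Config Ω N => F x.coe := hF.continuous.comp continuous_configCoe
  obtain ⟨C, hC⟩ := isCompact_univ.exists_bound_of_continuousOn hc.continuousOn
  exact MemLp.of_bound hc.aestronglyMeasurable C (Eventually.of_forall fun x => hC x (mem_univ x))

variable [IsFiniteMeasure (interiorMeasure Ω)] [IsFiniteMeasure (surfaceMeasure Ω)]

lemma aestronglyMeasurable_gradField (hΩ : IsOpen Ω) (hbdd : Bornology.IsBounded Ω)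
    (hlip : HasLipschitzBoundary Ω) {F : (Fin N → EuclideanSpace ℝ (Fin d)) → ℝ}
    (hF : ContDiff ℝ 1 F) : AEStronglyMeasurable (gradField Ω δ F) (weightedMeasure Ω ϱ) :=
  ((aemeasurable_gradField hΩ hbdd hlip δ hF).mono_ac
    (withDensity_absolutelyContinuous _ _)).aestronglyMeasurable

variable [CompactSpace (closure Ω)] [IsFiniteMeasure (weightedMeasure Ω ϱ)]

lemma memLp_gradField (hΩ : IsOpen Ω) (hbdd : Bornology.IsBounded Ω)
    (hlip : HasLipschitzBoundary Ω) {F : (Fin N → EuclideanSpace ℝ (Fin d)) → ℝ}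
    (hF : ContDiff ℝ 1 F) : MemLp (gradField Ω δ F) 2 (weightedMeasure Ω ϱ) := by
  obtain ⟨C, hC⟩ := exists_norm_gradField_le (Ω := Ω) (δ := δ) hF
  exact MemLp.of_bound (aestronglyMeasurable_gradField hΩ hbdd hlip hF) C
    (Eventually.of_forall hC)

lemma mem_domain_gradOperator (hΩ : IsOpen Ω) (hbdd : Bornology.IsBounded Ω)
    (hlip : HasLipschitzBoundary Ω) {F : (Fin N → EuclideanSpace ℝ (Fin d)) → ℝ}
    (hF : ContDiff ℝ 1 F) {f : Lp ℝ 2 (weightedMeasure Ω ϱ)}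
    (hf : f =ᵐ[weightedMeasure Ω ϱ] fun x => F x.coe) : f ∈ (gradOperator Ω δ ϱ).domain :=
  mem_domain_gradOperator_iff.2
    ⟨_, F, hF, hf, (memLp_gradField (δ := δ) (ϱ := ϱ) hΩ hbdd hlip hF).coeFn_toLp⟩

lemma exists_domain_gradOperator (hΩ : IsOpen Ω) (hbdd : Bornology.IsBounded Ω)
    (hlip : HasLipschitzBoundary Ω) {F : (Fin N → EuclideanSpace ℝ (Fin d)) → ℝ}
    (hF : ContDiff ℝ 1 F) : ∃ f : (gradOperator Ω δ ϱ).domain,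
      (f : Lp ℝ 2 (weightedMeasure Ω ϱ)) =ᵐ[weightedMeasure Ω ϱ] fun x => F x.coe :=
  ⟨⟨_, mem_domain_gradOperator hΩ hbdd hlip hF (memLp_configCoe hF).coeFn_toLp⟩,
    (memLp_configCoe hF).coeFn_toLp⟩

lemma dense_domain_gradOperator (hΩ : IsOpen Ω) (hbdd : Bornology.IsBounded Ω)
    (hlip : HasLipschitzBoundary Ω) :
    Dense ((gradOperator Ω δ ϱ).domain : Set (Lp ℝ 2 (weightedMeasure Ω ϱ))) := by
  have h1 := ContinuousMap.toLp_denseRange (E := ℝ) (μ := weightedMeasure Ω ϱ) (p := 2) ℝ (by simp)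
  refine (h1.dense_image (ContinuousLinearMap.continuous _)
    (dense_contDiffRestrict (Ω := Ω) (N := N))).mono ?_
  rintro _ ⟨f, ⟨F, hF, hf⟩, rfl⟩
  refine mem_domain_gradOperator hΩ hbdd hlip hF ?_
  filter_upwards [ContinuousMap.coeFn_toLp (p := 2) (weightedMeasure Ω ϱ) (𝕜 := ℝ) f] with x hx
  rw [hx, hf]

variable [(weightedMeasure Ω ϱ).IsOpenPosMeasure]

lemma isGradientForm_gradOperator (hΩ : IsOpen Ω) (hbdd : Bornology.IsBounded Ω)
    (hlip : HasLipschitzBoundary Ω) (hδ : δ * δ = δ) :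
    IsGradientForm Ω δ ϱ (DForm.ofOperator (gradOperator Ω δ ϱ)) where
  mem_dom f := by
    constructor
    · intro hf
      obtain ⟨F, hF, h, -⟩ := exists_contDiff_gradOperator hΩ ⟨f, hf⟩
      exact ⟨F, hF, h⟩
    · rintro ⟨F, hF, h⟩
      exact mem_domain_gradOperator hΩ hbdd hlip hF h
  restrict_mem_dom F hF := exists_domain_gradOperator hΩ hbdd hlip hF
  integrable F G hF hG := by
    have h1 := memLp_gradField (δ := δ) (ϱ := ϱ) hΩ hbdd hlip hF
    have h2 := memLp_gradField (δ := δ) (ϱ := ϱ) hΩ hbdd hlip hG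
    refine (L2.integrable_inner (𝕜 := ℝ) (h1.toLp _) (h2.toLp _)).congr ?_
    filter_upwards [h1.coeFn_toLp, h2.coeFn_toLp] with x hx1 hx2
    rw [hx1, hx2, squareField_eq_inner hΩ hδ]
  form_eq f g F G hF hG hf hg := by
    rw [DForm.ofOperator_form, gradEnergy, L2.inner_def]
    congr 1
    refine integral_congr_ae ?_
    filter_upwards [gradOperator_ae_eq hΩ f hF hf, gradOperator_ae_eq hΩ g hG hg] with x h1 h2
    rw [h1, h2, squareField_eq_inner hΩ hδ]

lemma operates_gradOperator (hΩ : IsOpen Ω) (hbdd : Bornology.IsBounded Ω)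
    (hlip : HasLipschitzBoundary Ω) {φ : ℝ → ℝ} (hφ : ContDiff ℝ 1 φ)
    (hφ' : ∀ t, |deriv φ t| ≤ 1) : DForm.Operates (gradOperator Ω δ ϱ) φ := by
  intro f
  obtain ⟨F, hF, hf, hTf⟩ := exists_contDiff_gradOperator hΩ f
  have hφF : ContDiff ℝ 1 fun y => φ (F y) := hφ.comp hF
  obtain ⟨g, hg⟩ := exists_domain_gradOperator (δ := δ) (ϱ := ϱ) hΩ hbdd hlip hφF
  refine ⟨g, ?_, Lp.norm_le_norm_of_ae_le ?_⟩
  · filter_upwards [hf, hg] with x h1 h2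
    rw [h1, h2]
  · filter_upwards [hTf, gradOperator_ae_eq hΩ g hφF hg] with x h1 h2
    rw [h1, h2, gradField_comp hφ hF, norm_smul]
    exact mul_le_of_le_one_left (norm_nonneg _) (hφ' _)

/-- A function in the domain of the closure that vanishes on an open set has vanishing gradient
there. The open set is the trace of an open set of the ambient space, on which a smooth function
with exactly this support serves as a multiplier. -/
lemma closure_gradOperator_local (hΩ : IsOpen Ω) (hbdd : Bornology.IsBounded Ω)
    (hlip : HasLipschitzBoundary Ω) (hT : (gradOperator Ω δ ϱ).IsClosable) {U : Set (Config Ω N)}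
    (hU : IsOpen U) (f : (gradOperator Ω δ ϱ).closure.domain)
    (hf : ∀ᵐ x ∂(weightedMeasure Ω ϱ), x ∈ U → (f : Lp ℝ 2 (weightedMeasure Ω ϱ)) x = 0) :
    ∀ᵐ x ∂(weightedMeasure Ω ϱ), x ∈ U → (gradOperator Ω δ ϱ).closure f x = 0 := by
  have hind : IsInducing (Config.coe : Config Ω N → _) :=
    IsInducing.piMap fun _ => IsInducing.subtypeVal
  obtain ⟨O, hO, rfl⟩ := hind.isOpen_iff.1 hU
  obtain ⟨χ, hχO, hχ, hχr⟩ := hO.exists_contDiff_support_eq (n := 1)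
  have hχ0 : ∀ y, 0 ≤ χ y := fun y => (hχr (mem_range_self y)).1
  have hχ1 : ∀ y, χ y ≤ 1 := fun y => (hχr (mem_range_self y)).2
  have hmem : ∀ x : Config Ω N, x ∈ Config.coe ⁻¹' O ↔ χ x.coe ≠ 0 := fun x => by
    rw [mem_preimage, ← hχO, Function.mem_support]
  obtain ⟨C, hC⟩ := exists_norm_gradField_le (Ω := Ω) (δ := δ) hχ
  simp only [hmem] at hf ⊢
  refine DForm.closure_apply_eq_zero_of_eq_zero hT (C := max 1 C)
    (hχ.continuous.comp continuous_configCoe).aestronglyMeasurable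
    (aestronglyMeasurable_gradField (δ := δ) hΩ hbdd hlip hχ) (fun x => ?_)
    (Eventually.of_forall fun x => (hC x).trans (le_max_right _ _))
    (Eventually.of_forall fun x hx => gradField_eq_zero_of_nonneg hχ hχ0 hx) (fun u => ?_) f hf
  · simp only [Function.comp_apply]
    rw [abs_of_nonneg (hχ0 _)]
    exact (hχ1 _).trans (le_max_left _ _)
  · obtain ⟨F, hF, hu, hTu⟩ := exists_contDiff_gradOperator hΩ u
    have hχF : ContDiff ℝ 1 fun y => χ y * F y := hχ.mul hF
    obtain ⟨g, hg⟩ := exists_domain_gradOperator (δ := δ) (ϱ := ϱ) hΩ hbdd hlip hχF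
    refine ⟨g, ?_, ?_⟩
    · filter_upwards [hu, hg] with x h1 h2
      rw [h1, h2, Function.comp_apply]
    · filter_upwards [hu, hTu, gradOperator_ae_eq hΩ g hχF hg] with x h1 h2 h3
      rw [h1, h2, h3, gradField_mul hχ hF, Function.comp_apply]

lemma exists_one_closure_gradOperator (hΩ : IsOpen Ω) (hbdd : Bornology.IsBounded Ω)
    (hlip : HasLipschitzBoundary Ω) : ∃ one : (gradOperator Ω δ ϱ).closure.domain,
      (one : Lp ℝ 2 (weightedMeasure Ω ϱ)) =ᵐ[weightedMeasure Ω ϱ] (fun _ => (1 : ℝ)) ∧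
      (gradOperator Ω δ ϱ).closure one = 0 := by
  have h1 : ContDiff ℝ 1 fun _ : Fin N → EuclideanSpace ℝ (Fin d) => (1 : ℝ) := contDiff_const
  obtain ⟨f, hf⟩ := exists_domain_gradOperator (δ := δ) (ϱ := ϱ) hΩ hbdd hlip h1
  refine ⟨⟨f, (gradOperator Ω δ ϱ).le_closure.1 f.2⟩, hf, ?_⟩
  rw [← (gradOperator Ω δ ϱ).le_closure.2 (x := f) rfl, Lp.eq_zero_iff_ae_eq_zero]
  filter_upwards [gradOperator_ae_eq hΩ f h1 hf] with x hx
  rw [hx, gradField_const]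
  rfl

lemma isRegular_closure_gradOperator (hΩ : IsOpen Ω) (hbdd : Bornology.IsBounded Ω)
    (hlip : HasLipschitzBoundary Ω) (hT : (gradOperator Ω δ ϱ).IsClosable) :
    (DForm.ofOperator (gradOperator Ω δ ϱ).closure).IsRegular := by
  refine DForm.isRegular_ofOperator_closure hT (fun f => ?_) fun v ε hε => ?_
  · obtain ⟨F, hF, hf, -⟩ := exists_contDiff_gradOperator hΩ f
    exact ⟨⟨fun x => F x.coe, hF.continuous.comp continuous_configCoe⟩, hf⟩
  · obtain ⟨w, hvw, F, hF, hw⟩ :=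
      Metric.dense_iff.1 (dense_contDiffRestrict (Ω := Ω) (N := N)) v ε hε
    obtain ⟨g, hg⟩ := exists_domain_gradOperator (δ := δ) (ϱ := ϱ) hΩ hbdd hlip hF
    refine ⟨g, w, hg.trans (Eventually.of_forall fun x => (hw x).symm), ?_⟩
    rw [dist_comm]
    exact hvw

end GradientOperator

/-! ### Closability and the gradient form -/

section Closability

lemma lintegral_enorm_sq_eq_enorm_sq {X V : Type*} [MeasurableSpace X] {m : Measure X}
    [NormedAddCommGroup V] (f : Lp V 2 m) : ∫⁻ x, ‖f x‖ₑ ^ 2 ∂m = ‖f‖ₑ ^ 2 := by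
  have h := eLpNorm_nnreal_pow_eq_lintegral (f := (f : X → V)) (μ := m) (p := 2) (by simp)
  rw [Lp.enorm_def]
  simpa using h.symm

variable {d N : ℕ} {Ω : Set (EuclideanSpace ℝ (Fin d))} {δ : ℝ} {ϱ : Config Ω N → ℝ}
  [IsFiniteMeasure (interiorMeasure Ω)] [IsFiniteMeasure (surfaceMeasure Ω)]
  [(weightedMeasure Ω ϱ).IsOpenPosMeasure]

/-- The gradient operator is closable. The Hamza conditions enter through the local integrability
of the inverse density in the position of a single particle. -/
lemma isClosable_gradOperator (hΩ : IsOpen Ω) (hbdd : Bornology.IsBounded Ω)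
    (hlip : HasLipschitzBoundary Ω) (hδ : δ = 0 ∨ δ = 1)
    (hϱ : AEMeasurable ϱ (baseMeasure Ω N)) (hϱ_pos : ∀ᵐ x ∂(baseMeasure Ω N), 0 < ϱ x)
    (hH1 : HamzaInterior Ω ϱ) (hH2 : δ = 1 → HamzaBoundary Ω ϱ) :
    (gradOperator Ω δ ϱ).IsClosable := by
  obtain ⟨w, hw, hw0, hwt, hϱw⟩ := exists_measurable_density hϱ hϱ_pos
  have hμ : weightedMeasure Ω ϱ = (baseMeasure Ω N).withDensity w := withDensity_congr_ae hϱw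
  have hac : weightedMeasure Ω ϱ ≪ baseMeasure Ω N := withDensity_absolutelyContinuous _ _
  have hint : ∀ {g h : Config Ω N → ℝ≥0∞}, AEMeasurable h (baseMeasure Ω N) →
      g =ᵐ[weightedMeasure Ω ϱ] h →
      ∫⁻ x, h x * w x ∂(baseMeasure Ω N) = ∫⁻ x, g x ∂(weightedMeasure Ω ϱ) := by
    intro g h hh hgh
    rw [lintegral_congr_ae hgh, hμ, lintegral_withDensity_eq_lintegral_mul₀ hw.aemeasurable hh]
    simp only [Pi.mul_apply, mul_comm]
  refine DForm.isClosable_of_forall_seq fun u v hu hTu => ?_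
  choose F hF huF hTuF using fun k => exists_contDiff_gradOperator hΩ (u k)
  set V : Config Ω N → PiLp 2 (fun _ : Fin N => EuclideanSpace ℝ (Fin d)) := fun x => v x
  have hV : Measurable V := (Lp.stronglyMeasurable v).measurable
  have hsq : ∀ {Y : Type} [NormedAddCommGroup Y] {a : ℕ → Lp Y 2 (weightedMeasure Ω ϱ)},
      Tendsto a atTop (𝓝 0) → Tendsto (fun k => ‖a k‖ₑ ^ 2) atTop (𝓝 0) := by
    intro Y _ a ha
    simpa [Function.comp_def] using
      (((ENNReal.continuous_pow 2).comp continuous_enorm).tendsto 0).comp ha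
  have h1 : Tendsto (fun k => ∫⁻ x, ‖F k x.coe‖ₑ ^ 2 * w x ∂(baseMeasure Ω N)) atTop (𝓝 0) := by
    refine (hsq hu).congr fun k => ?_
    rw [← lintegral_enorm_sq_eq_enorm_sq]
    refine (hint (h := fun x => ‖F k x.coe‖ₑ ^ 2) (((hF k).continuous.comp
      continuous_configCoe).measurable.enorm.pow_const 2).aemeasurable ?_).symm
    filter_upwards [huF k] with x hx
    rw [hx]
  have h2 : Tendsto (fun k => ∫⁻ x, ‖gradField Ω δ (F k) x - V x‖ₑ ^ 2 * w x ∂(baseMeasure Ω N))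
      atTop (𝓝 0) := by
    have h3 : Tendsto (fun k => gradOperator Ω δ ϱ (u k) - v) atTop (𝓝 0) := by
      simpa using hTu.sub_const v
    refine (hsq h3).congr fun k => ?_
    rw [← lintegral_enorm_sq_eq_enorm_sq]
    refine (hint (h := fun x => ‖gradField Ω δ (F k) x - V x‖ₑ ^ 2) (((aemeasurable_gradField hΩ
      hbdd hlip δ (hF k)).sub hV.aemeasurable).enorm.pow_const 2) ?_).symm
    filter_upwards [hTuF k, Lp.coeFn_sub (gradOperator Ω δ ϱ (u k)) v] with x hx hx'
    rw [hx', Pi.sub_apply, hx]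
  have hcoord : ∀ i : Fin N, ∀ᵐ x ∂(baseMeasure Ω N), V x i = 0 := fun i => by
    refine ae_gradField_limit_coordinate_eq_zero hΩ hbdd hlip hδ hw hw0 hwt
      (hH1.ae_regular hΩ hw hϱw hϱ_pos) (fun h => (hH2 h).ae_regular hΩ hw hϱw hϱ_pos) hF i
      (by fun_prop) h1 ?_
    refine tendsto_of_tendsto_of_tendsto_of_le_of_le tendsto_const_nhds h2 (fun _ => bot_le)
      fun k => lintegral_mono fun x => ?_
    gcongr
    exact enorm_le_iff_norm_le.2 (PiLp.norm_apply_le (gradField Ω δ (F k) x - V x) i)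
  rw [Lp.eq_zero_iff_ae_eq_zero]
  filter_upwards [hac.ae_le (ae_all_iff.2 hcoord)] with x hx
  ext1 i
  exact hx i

end Closability

theorem mainTheorem4 (d N : ℕ) (hd : 1 ≤ d) (hN : 1 ≤ N)
    (Ω : Set (EuclideanSpace ℝ (Fin d)))
    (hΩ_open : IsOpen Ω) (hΩ_conn : IsConnected Ω) (hΩ_bdd : Bornology.IsBounded Ω)
    (hΩ_lip : HasLipschitzBoundary Ω)
    (δ : ℝ) (hδ : δ = 0 ∨ (δ = 1 ∧ 2 ≤ d))
    (ϱ : Config Ω N → ℝ)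
    (hϱ_int : Integrable ϱ (baseMeasure Ω N))
    (hϱ_pos : ∀ᵐ x ∂(baseMeasure Ω N), 0 < ϱ x)
    (hH1 : HamzaInterior Ω ϱ)
    (hH2 : δ = 1 → HamzaBoundary Ω ϱ) :
    ∃ A : DForm (Lp ℝ 2 (weightedMeasure Ω ϱ)),
      IsGradientForm Ω δ ϱ A ∧
      A.IsSymmetric ∧ A.IsNonneg ∧ A.IsDenselyDefined ∧ A.IsClosable ∧
      ∃ E : DForm (Lp ℝ 2 (weightedMeasure Ω ϱ)),
        E.IsClosureOf A ∧
        E.IsSymmDirichletForm ∧ E.IsRegular ∧ E.IsStronglyLocal ∧ E.IsRecurrent := by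
  have hfin_int := isFiniteMeasure_interiorMeasure hΩ_bdd
  have hfin_surf := isFiniteMeasure_surfaceMeasure hΩ_bdd hΩ_lip
  have hcomp : CompactSpace (closure Ω) := isCompact_iff_compactSpace.1 hΩ_bdd.isCompact_closure
  have hfin : IsFiniteMeasure (weightedMeasure Ω ϱ) := isFiniteMeasure_withDensity_ofReal hϱ_int.2
  have hpos_base := isOpenPosMeasure_baseMeasure (N := N) hΩ_open
  have hpos : (weightedMeasure Ω ϱ).IsOpenPosMeasure :=
    (baseMeasure_absolutelyContinuous hϱ_int.aemeasurable hϱ_pos).isOpenPosMeasure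
  have hδ' : δ = 0 ∨ δ = 1 := hδ.imp_right And.left
  have hδδ : δ * δ = δ := by rcases hδ' with rfl | rfl <;> simp
  have hT := isClosable_gradOperator hΩ_open hΩ_bdd hΩ_lip hδ' hϱ_int.aemeasurable hϱ_pos hH1 hH2
  have hdense := dense_domain_gradOperator (δ := δ) (ϱ := ϱ) hΩ_open hΩ_bdd hΩ_lip
  have hop : ∀ φ : ℝ → ℝ, LipschitzWith 1 φ →
      DForm.Operates (gradOperator Ω δ ϱ).closure φ := fun φ =>
    DForm.operates_closure hT fun _ => operates_gradOperator hΩ_open hΩ_bdd hΩ_lip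
  obtain ⟨one, hone, hTone⟩ :=
    exists_one_closure_gradOperator (δ := δ) (ϱ := ϱ) hΩ_open hΩ_bdd hΩ_lip
  exact ⟨DForm.ofOperator (gradOperator Ω δ ϱ),
    isGradientForm_gradOperator hΩ_open hΩ_bdd hΩ_lip hδδ,
    DForm.ofOperator_isSymmetric _, DForm.ofOperator_isNonneg _, hdense,
    DForm.ofOperator_isClosable hT,
    DForm.ofOperator (gradOperator Ω δ ϱ).closure,
    DForm.ofOperator_closure_isClosureOf hT,
    DForm.isSymmDirichletForm_ofOperator hT.closure_isClosed
      (hdense.mono (gradOperator Ω δ ϱ).le_closure.1) hop,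
    isRegular_closure_gradOperator hΩ_open hΩ_bdd hΩ_lip hT,
    DForm.isStronglyLocal_ofOperator hone hTone fun U hU f hf =>
      closure_gradOperator_local hΩ_open hΩ_bdd hΩ_lip hT hU f hf,
    DForm.isRecurrent_ofOperator hop hone hTone⟩

end
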